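/- Let $N\ge 3$ and let $\delta_1,\dots,\delta_N>0$ with $\delta_1+\dots+\delta_N=2\pi$. Let $\mathcal{C}_{2N}(\delta_1,\dots,\delta_N)$ be the space of centrally symmetric convex polyhedral surfaces with $2N$ distinct vertices labeled $1^\pm,\dots,N^\pm$, up to label-preserving isometry: Euclidean cone spheres (surfaces homeomorphic to $S^2$ with an intrinsic metric) that have cone-deficit $\delta_k\in(0,2\pi)$, i.e. cone-angle $2\pi-\delta_k$, at $k^+$ and at $k^-$, that are locally Euclidean elsewhere, and that carry an antipodal map, i.e. an isometric involution without fixed points, which exchanges $k^+$ and $k^-$ for every $k$. On the unit sphere $S^2$ let $2N$ distinct points labeled $1^\pm,\dots,N^\pm$ be given, with $k^+$ and $k^-$ antipodal. Let $\mathscr{A}$ be a loop arrangement of $2N-2$ loops $l_1,\dots,l_{2N-2}$: great circles that pass through no labeled point, that are pairwise non-homotopic relative to the labeled points, and no three of which are concurrent. If $N\ge 6$, assume moreover that every face of $\mathscr{A}$ (component of the complement of the loops) contains at most one labeled point. Let $\mathscr{D}^*$ be the dual graph of $\mathscr{A}$, with one vertex in each face of $\mathscr{A}$, the labeled point if the face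 contains one. All faces of $\mathscr{D}^*$ are quadrilaterals, one for each crossing point of two loops. Choose numbers $a_1,\dots,a_{2N-2}>0$, and give length $a_i$ to every edge of $\mathscr{D}^*$ dual to an arc of $l_i$. At a vertex $v$ of a quadrilateral whose two edges at $v$ are dual to arcs of $l_i$ and $l_j$, assign the angle $$\theta=\pi-\frac12\sum_{n^+\text{ or }n^-\in\mathcal{L}}\delta_n ,$$ where $\mathcal{L}$ is the one of the four lunes bounded by $l_i$ and $l_j$ whose interior contains $v$, and the sum has one term for each labeled point in $\mathcal{L}$. This makes every quadrilateral a solid Euclidean parallelogram. Let $\mathscr{S}$ be the surface obtained by gluing these parallelograms along the common edges of $\mathscr{D}^*$, with the vertex labels of $\mathscr{D}^*$. Then $\mathscr{S}\in\mathcal{C}_{2N}(\delta_1,\dots,\delta_N)$. -/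

import Mathlib

noncomputable section

open scoped Real ENNReal RealInnerProductSpace

namespace LoopSurface

/-! ### Centrally symmetric convex polyhedral surfaces -/

/-- The unit sphere in three-space. -/
abbrev S2 : Type := Metric.sphere (0 : EuclideanSpace ℝ (Fin 3)) 1

/-- The distance is intrinsic: the distance of two points is the infimum of the lengths of the
paths that join them. -/
def IsLengthSpace (X : Type) [PseudoEMetricSpace X] : Prop :=
  ∀ x y : X, edist x y = ⨅ γ : Path x y, eVariationOn γ Set.univ

/-- The distance, in the Euclidean cone, of two points at distances `r` and `s` from the apex
whose directions are at angular distance `φ`. -/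
def coneDist (r s φ : ℝ) : ℝ :=
  √(r ^ 2 + s ^ 2 - 2 * r * s * Real.cos (min φ π))

/-- A ball around `x` is isometric to the ball of the same radius around the apex of the Euclidean
cone of angle `θ`; the isometry is given in polar coordinates `(r, α)`, where the directions `α`
form a circle of length `θ`. The cone of angle `2 * π` is the Euclidean plane. -/
def HasConeAngle {X : Type} [PseudoEMetricSpace X] (x : X) (θ : ℝ) : Prop :=
  0 < θ ∧ ∃ ε : ℝ, 0 < ε ∧ ∃ Φ : ℝ → AddCircle θ → X,
    (∀ α, Φ 0 α = x) ∧
    (∀ r ∈ Set.Ico 0 ε, ∀ s ∈ Set.Ico 0 ε, ∀ α β : AddCircle θ,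
      edist (Φ r α) (Φ s β) = ENNReal.ofReal (coneDist r s ‖α - β‖)) ∧
    (∀ y, edist y x < ENNReal.ofReal ε → ∃ r ∈ Set.Ico 0 ε, ∃ α, Φ r α = y)

/-- A space with a distance and with points labeled `1⁺, 1⁻, …, N⁺, N⁻`
(`true` stands for `+` and `false` for `-`). -/
structure LabeledSurface (N : ℕ) where
  carrier : Type
  [metric : PseudoEMetricSpace carrier]
  vertex : Fin N → Bool → carrier

attribute [instance] LabeledSurface.metric

/-- Two labeled surfaces are equivalent if an isometry carries one to the other and preserves all
the labels. -/
instance LabeledSurface.setoid (N : ℕ) : Setoid (LabeledSurface N) where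
  r S T := ∃ e : S.carrier ≃ᵢ T.carrier, ∀ k b, e (S.vertex k b) = T.vertex k b
  iseqv :=
    { refl := fun S => ⟨IsometryEquiv.refl S.carrier, fun _ _ => rfl⟩
      symm := fun {_ _} ⟨e, h⟩ => ⟨e.symm, fun k b => by rw [← h k b, e.symm_apply_apply]⟩
      trans := fun {_ _ _} ⟨e, h⟩ ⟨f, g⟩ =>
        ⟨e.trans f, fun k b => by rw [IsometryEquiv.trans_apply, h, g]⟩ }

/-- A convex Euclidean cone sphere with `2 * N` distinct labeled vertices, of cone-deficit `δ k` at
`k⁺` and at `k⁻` and without other singularities, which is centrally symmetric: it has an antipodal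
map, that is, an isometric involution without fixed points, and this map exchanges `k⁺` and `k⁻`.
By the first field, the distance separates points and has finite values. -/
structure IsCentrallySymmetricConvex {N : ℕ} (δ : Fin N → ℝ) (S : LabeledSurface N) : Prop where
  sphere : Nonempty (S.carrier ≃ₜ S2)
  isLengthSpace : IsLengthSpace S.carrier
  vertex_injective : Function.Injective fun v : Fin N × Bool => S.vertex v.1 v.2
  convex : ∀ k, 0 < δ k ∧ δ k < 2 * π
  cone : ∀ k b, HasConeAngle (S.vertex k b) (2 * π - δ k)
  flat : ∀ x, (∀ k b, x ≠ S.vertex k b) → HasConeAngle x (2 * π)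
  antipodal : ∃ τ : S.carrier ≃ᵢ S.carrier, (∀ x, τ (τ x) = x) ∧ (∀ x, τ x ≠ x) ∧
    ∀ k b, τ (S.vertex k b) = S.vertex k (!b)

/-- The space `𝒞_{2N}(δ₁, …, δ_N)` of centrally symmetric convex polyhedral surfaces, up to
isometries that preserve the labels. -/
def centrallySymmetricSpace {N : ℕ} (δ : Fin N → ℝ) : Set (Quotient (LabeledSurface.setoid N)) :=
  {c | ∃ S : LabeledSurface N, IsCentrallySymmetricConvex δ S ∧ Quotient.mk _ S = c}

/-! ### Loop arrangements -/

/-- `2 * N` distinct points `1⁺, 1⁻, …, N⁺, N⁻` of the sphere with `k⁺` and `k⁻` antipodal. -/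
structure LabeledSphere (N : ℕ) where
  vertex : Fin N → Bool → S2
  injective : Function.Injective fun v : Fin N × Bool => vertex v.1 v.2
  antipodal : ∀ k b, vertex k (!b) = -vertex k b

/-- The great circle with normal vector `n`. -/
def greatCircle (n : S2) : Set S2 := {x | ⟪(n : EuclideanSpace ℝ (Fin 3)), x⟫ = 0}

/-- The sphere without the labeled vertices. -/
abbrev LabeledSphere.Punctured {N : ℕ} (V : LabeledSphere N) : Type :=
  {x : S2 // ∀ k b, x ≠ V.vertex k b}

/-- Two simple closed curves, given as sets, are homotopic relative to the labeled vertices: they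
have parametrizations that are freely homotopic in the complement of the labeled vertices. -/
def LabeledSphere.HomotopicLoops {N : ℕ} (V : LabeledSphere N) (l l' : Set S2) : Prop :=
  ∃ f g : C(Circle, V.Punctured), Function.Injective f ∧ Function.Injective g ∧
    Set.range (fun z => (f z : S2)) = l ∧ Set.range (fun z => (g z : S2)) = l' ∧
    ContinuousMap.Homotopic f g

/-- An arrangement of `n` loops: great circles that avoid the labeled vertices, that are pairwise
non-homotopic relative to them, and no three of which are concurrent. A normal vector is chosen for
each loop; it only serves to name the two sides of the loop. -/
structure LoopArrangement {N : ℕ} (V : LabeledSphere N) (n : ℕ) where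
  normal : Fin n → S2
  avoids : ∀ i k b, V.vertex k b ∉ greatCircle (normal i)
  nonhomotopic : ∀ i j, i ≠ j →
    ¬ V.HomotopicLoops (greatCircle (normal i)) (greatCircle (normal j))
  nonconcurrent : ∀ i j k, i ≠ j → j ≠ k → i ≠ k →
    greatCircle (normal i) ∩ greatCircle (normal j) ∩ greatCircle (normal k) = ∅

namespace LoopArrangement

variable {N n : ℕ} {V : LabeledSphere N}

/-- The side of each loop on which `x` lies: `1`, `-1`, or `0` if `x` lies on the loop. For points
on no loop, this vector tells in which face of the arrangement `x` lies. -/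
def code (A : LoopArrangement V n) (x : S2) : Fin n → ℝ :=
  fun i => Real.sign ⟪(A.normal i : EuclideanSpace ℝ (Fin 3)), x⟫

/-- No two labeled vertices lie in the same face of the arrangement. -/
def Separating (A : LoopArrangement V n) : Prop :=
  ∀ v w : Fin N × Bool, A.code (V.vertex v.1 v.2) = A.code (V.vertex w.1 w.2) → v = w

/-! ### The dual graph and the surfaces that arise from it

A face of the arrangement, that is, a vertex of the dual graph, is represented by its vector of
signs. Two faces that share an arc of loop `i` differ exactly in coordinate `i`, so the dual edge,
which is transverse to loop `i`, is represented by the segment between them, on which only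
coordinate `i` varies from `-1` to `1`. The four faces at a crossing of the loops `i` and `j` are
the corners of a quadrilateral, on which the coordinates `i` and `j` vary. Quadrilaterals are glued
along common edges of the dual graph because these have the same coordinates. -/

/-- A crossing point of two loops. Crossings correspond to the quadrilaterals of the dual graph. -/
structure Crossing (A : LoopArrangement V n) where
  point : S2
  i : Fin n
  j : Fin n
  ne : i ≠ j
  mem_i : point ∈ greatCircle (A.normal i)
  mem_j : point ∈ greatCircle (A.normal j)

/-- The vertices of the dual graph: the faces of the arrangement. -/
def dualVertices (A : LoopArrangement V n) : Set (Fin n → ℝ) :=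
  {t | ∃ x : S2, (∀ i, x ∉ greatCircle (A.normal i)) ∧ t = A.code x}

/-- The solid quadrilateral dual to a crossing. -/
def quad (A : LoopArrangement V n) (c : A.Crossing) : Set (Fin n → ℝ) :=
  {t | t c.i ∈ Set.Icc (-1) 1 ∧ t c.j ∈ Set.Icc (-1) 1 ∧
    ∀ k, k ≠ c.i → k ≠ c.j → t k = A.code c.point k}

/-- The sign named by a label. -/
def sgn (b : Bool) : ℝ := if b then 1 else -1

/-- One of the four open lunes cut out by the loops `i` and `j`, given by a side of each. -/
def lune (A : LoopArrangement V n) (i j : Fin n) (s s' : Bool) : Set S2 :=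
  {x | 0 < sgn s * ⟪(A.normal i : EuclideanSpace ℝ (Fin 3)), x⟫ ∧
    0 < sgn s' * ⟪(A.normal j : EuclideanSpace ℝ (Fin 3)), x⟫}

/-- The angle assigned to the corner, on the sides `s` and `s'` of the loops `i` and `j`, of a
quadrilateral dual to a crossing of these loops: `π` minus half the sum of the cone-deficits of the
labeled vertices in the lune that contains the corner. -/
def cornerAngle (A : LoopArrangement V n) (δ : Fin N → ℝ) (i j : Fin n) (s s' : Bool) : ℝ :=
  π - (1 / 2) * ∑ v : Fin N × Bool,
    Set.indicator {v : Fin N × Bool | V.vertex v.1 v.2 ∈ A.lune i j s s'} (fun v => δ v.1) v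

/-- The quadrilateral of a crossing as a solid parallelogram in the plane: the edges transverse to
the loop `i` have length `a i` and those transverse to the loop `j` have length `a j`. The angle at
the corner on the positive sides of both loops is the assigned one; so are then the other three
angles, by the two lemmas below. -/
def place (A : LoopArrangement V n) (δ : Fin N → ℝ) (a : Fin n → ℝ) (c : A.Crossing)
    (t : Fin n → ℝ) : ℂ :=
  (t c.i * a c.i / 2 : ℝ) +
    (t c.j * a c.j / 2 : ℝ) * Complex.exp (A.cornerAngle δ c.i c.j true true * Complex.I)

/-- Opposite corners are assigned the same angle. -/
theorem cornerAngle_opposite (A : LoopArrangement V n) (δ : Fin N → ℝ) (i j : Fin n)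
    (s s' : Bool) : A.cornerAngle δ i j (!s) (!s') = A.cornerAngle δ i j s s' := by
  unfold cornerAngle
  rw [Fintype.sum_prod_type, Fintype.sum_prod_type]
  congr 2
  refine Finset.sum_congr rfl fun k _ => ?_
  have h : ∀ b, (V.vertex k (!b) ∈ A.lune i j (!s) (!s')) ↔ V.vertex k b ∈ A.lune i j s s' := by
    intro b
    simp only [lune, Set.mem_ofPred_eq, V.antipodal, Metric.sphere, sgn]
    cases s <;> cases s' <;> simp
  have h1 := h true
  have h2 := h false
  simp only [Bool.not_true, Bool.not_false] at h1 h2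
  classical
  simp only [Fintype.sum_bool, Set.indicator_apply, Set.mem_ofPred_eq, h1, h2]
  ring

/-- Adjacent corners are assigned supplementary angles. -/
theorem cornerAngle_adjacent (A : LoopArrangement V n) (δ : Fin N → ℝ)
    (hsum : ∑ k, δ k = 2 * π) (i j : Fin n) (s s' : Bool) :
    A.cornerAngle δ i j s s' + A.cornerAngle δ i j s (!s') = π := by
  classical
  have key : ∀ k, ∑ b : Bool,
      (Set.indicator {v : Fin N × Bool | V.vertex v.1 v.2 ∈ A.lune i j s s'}
        (fun v => δ v.1) (k, b) +
      Set.indicator {v : Fin N × Bool | V.vertex v.1 v.2 ∈ A.lune i j s (!s')}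
        (fun v => δ v.1) (k, b)) = δ k := by
    intro k
    have hi := A.avoids i k true
    have hj := A.avoids j k true
    have hf : V.vertex k false = -V.vertex k true := V.antipodal k true
    simp only [greatCircle, Set.mem_ofPred_eq] at hi hj
    simp only [Fintype.sum_bool, Set.indicator_apply, Set.mem_ofPred_eq, lune, hf, sgn]
    rcases lt_or_gt_of_ne hi with h1 | h1 <;> rcases lt_or_gt_of_ne hj with h2 | h2 <;>
      cases s <;> cases s' <;> simp [h1, h2, h1.not_gt, h2.not_gt]
  have total : (∑ v : Fin N × Bool,
      Set.indicator {v : Fin N × Bool | V.vertex v.1 v.2 ∈ A.lune i j s s'}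
        (fun v => δ v.1) v) +
      (∑ v : Fin N × Bool,
      Set.indicator {v : Fin N × Bool | V.vertex v.1 v.2 ∈ A.lune i j s (!s')}
        (fun v => δ v.1) v) = 2 * π := by
    rw [← Finset.sum_add_distrib, Fintype.sum_prod_type, ← hsum]
    exact Finset.sum_congr rfl fun k _ => key k
  unfold cornerAngle
  linarith

/-- The points of the surface: the vertices of the dual graph and the points of its
quadrilaterals. -/
def Points (A : LoopArrangement V n) : Type :=
  {t : Fin n → ℝ // t ∈ A.dualVertices ∨ ∃ c : A.Crossing, t ∈ A.quad c}

/-- `A.Chain δ a x y ℓ`: one can go from `x` to `y` along finitely many straight segments, each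
contained in one of the parallelograms, of total length `ℓ`. -/
inductive Chain (A : LoopArrangement V n) (δ : Fin N → ℝ) (a : Fin n → ℝ) :
    A.Points → A.Points → ℝ≥0∞ → Prop
  | nil (x : A.Points) : Chain A δ a x x 0
  | cons (c : A.Crossing) (x y z : A.Points) (ℓ : ℝ≥0∞) (hx : x.1 ∈ A.quad c)
      (hy : y.1 ∈ A.quad c) (h : Chain A δ a y z ℓ) :
      Chain A δ a x z (edist (A.place δ a c x.1) (A.place δ a c y.1) + ℓ)

theorem Chain.trans {A : LoopArrangement V n} {δ : Fin N → ℝ} {a : Fin n → ℝ}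
    {x y z : A.Points} {ℓ m : ℝ≥0∞} (h : A.Chain δ a x y ℓ) (h' : A.Chain δ a y z m) :
    A.Chain δ a x z (ℓ + m) := by
  induction h with
  | nil x => simpa using h'
  | cons c x y w ℓ hx hy h ih =>
    rw [add_assoc]
    exact Chain.cons c x y z _ hx hy (ih h')

theorem Chain.symm {A : LoopArrangement V n} {δ : Fin N → ℝ} {a : Fin n → ℝ}
    {x y : A.Points} {ℓ : ℝ≥0∞} (h : A.Chain δ a x y ℓ) : A.Chain δ a y x ℓ := by
  induction h with
  | nil x => exact Chain.nil x
  | cons c x y z ℓ hx hy h ih =>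
    have h1 := ih.trans (Chain.cons c y x x 0 hy hx (Chain.nil x))
    rwa [add_zero, edist_comm, add_comm] at h1

/-- The distance on the surface glued from the parallelograms. -/
@[reducible]
def gluedMetric (A : LoopArrangement V n) (δ : Fin N → ℝ) (a : Fin n → ℝ) :
    PseudoEMetricSpace A.Points where
  edist x y := ⨅ ℓ : {ℓ : ℝ≥0∞ // A.Chain δ a x y ℓ}, ℓ.1
  edist_self x := le_antisymm (iInf_le_of_le ⟨0, Chain.nil x⟩ le_rfl) bot_le
  edist_comm x y := le_antisymm
    (le_iInf fun ℓ => iInf_le_of_le ⟨ℓ.1, ℓ.2.symm⟩ le_rfl)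
    (le_iInf fun ℓ => iInf_le_of_le ⟨ℓ.1, ℓ.2.symm⟩ le_rfl)
  edist_triangle x y z := by
    refine ENNReal.le_iInf_add_iInf fun ℓ m => ?_
    exact iInf_le_of_le ⟨_, ℓ.2.trans m.2⟩ le_rfl

/-- The surface that arises from the dual graph of `A` with the cone-deficits `δ` and the
edge-lengths `a`; the label of a labeled vertex of the sphere is given to the vertex of the dual
graph in the face that contains it. -/
def surface (A : LoopArrangement V n) (δ : Fin N → ℝ) (a : Fin n → ℝ) : LabeledSurface N where
  carrier := A.Points
  metric := A.gluedMetric δ a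
  vertex k b := ⟨A.code (V.vertex k b), Or.inl ⟨V.vertex k b, fun i => A.avoids i k b, rfl⟩⟩

end LoopArrangement

end LoopSurface

end

/-!
Why gluing the parallelograms of the dual graph gives a centrally symmetric convex polyhedral
surface.

*Angles.* By central symmetry, the angle at the corner of a parallelogram is half the sum of the
deficits `δ k` of the pairs `k⁺, k⁻` whose points lie in the two lunes adjacent to the lune of
that corner (`sepAngle`). Since the loops are pairwise non-homotopic, each of their four lunes
contains a labeled vertex (`exists_separated`): otherwise one loop could be turned into the other
through two empty lunes. So all angles lie strictly between `0` and `π`.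

*Sphere.* Sending the coordinates `t` to `∑ t k • n k`, where `n k` are the normal vectors of the
loops, identifies the glued parallelograms with the boundary of the zonotope spanned by the normal
vectors; injectivity holds because a parallelogram is the face on which the product with the
crossing point is maximal, and surjectivity because a boundary point has a supporting plane.
Radial projection gives the sphere (`nonempty_homeomorph_sphere`). The antipodal map is `t ↦ -t`.
The distance is the infimum of the lengths of broken lines, hence intrinsic.

*Local structure.* A point has a neighbourhood isometric to a cone as soon as its points have
polar coordinates in the cone for which the distance of the cone agrees with the distance in each
parallelogram (`hasConeAngle_of_rel`). Chains cannot be shorter than the cone distance, by the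
triangle inequality in the cone, unless they leave the neighbourhood, and then they are long;
conversely the geodesics of the cone are composed of segments in the parallelograms. In the
interior of a parallelogram or of an edge, one or two parallelograms are developed into the plane.
At a vertex of the dual graph, which is a face of the arrangement, the parallelograms correspond
to the corners of the face; they are listed in cyclic order (`exists_cyclicList`) and their
corners form a cone (`Fan`).

*Cone angles.* The sum of the angles at a face is the sum over `k` of `δ k / 2` times the number
of those corners of the face at which exactly one of the two loops separates `k⁺` from the face.
Around a convex spherical polygon, the sign of a linear functional changes exactly twice, unless
it is constant, which happens only if `k⁺` or `k⁻` lies in the face. Therefore the sum is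
`∑ δ k = 2 * π`, diminished by `δ k` if the face contains `k⁺` or `k⁻` (`angle_vertexFan`).

*Distinct vertices.* The labeled vertices lie in different faces by hypothesis if `N ≥ 6`. For
`N ≤ 5` this is automatic by counting (`separating_of_le_five`): two labeled vertices in the same
face would leave only `2 ^ (N - 2)` ways to divide the pairs, which is too few for `2 * N - 2`
loops if `N ≤ 4`; if `N = 5`, all the ways would occur, contrary to a linear dependency between
four vectors in space.
-/

noncomputable section

open scoped Real ENNReal RealInnerProductSpace

namespace LoopSurface

/-! ### The cross product -/

/-- Euclidean three-space. -/
abbrev E3 : Type := EuclideanSpace ℝ (Fin 3)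

/-- The cross product on Euclidean three-space. -/
def cr (u v : E3) : E3 :=
  !₂[u 1 * v 2 - u 2 * v 1, u 2 * v 0 - u 0 * v 2, u 0 * v 1 - u 1 * v 0]

theorem inner_eq_sum_three (u v : E3) : ⟪u, v⟫ = u 0 * v 0 + u 1 * v 1 + u 2 * v 2 := by
  simp [PiLp.inner_apply, Fin.sum_univ_three]; ring

theorem cr_zero (u v : E3) : cr u v 0 = u 1 * v 2 - u 2 * v 1 := by simp [cr]
theorem cr_one (u v : E3) : cr u v 1 = u 2 * v 0 - u 0 * v 2 := by simp [cr]
theorem cr_two (u v : E3) : cr u v 2 = u 0 * v 1 - u 1 * v 0 := by simp [cr]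

/-- The determinant of three vectors. -/
def det3 (u v w : E3) : ℝ := ⟪cr u v, w⟫

theorem det3_eq (u v w : E3) : det3 u v w = (u 1 * v 2 - u 2 * v 1) * w 0 +
    (u 2 * v 0 - u 0 * v 2) * w 1 + (u 0 * v 1 - u 1 * v 0) * w 2 := by
  rw [det3, inner_eq_sum_three, cr_zero, cr_one, cr_two]

theorem det3_rotate (u v w : E3) : det3 v w u = det3 u v w := by
  simp only [det3_eq]; ring

theorem det3_swap (u v w : E3) : det3 v u w = -det3 u v w := by
  simp only [det3_eq]; ring

theorem det3_self_left (u v : E3) : det3 u v u = 0 := by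
  simp only [det3_eq]; ring

theorem det3_self_right (u v : E3) : det3 u v v = 0 := by
  simp only [det3_eq]; ring

theorem inner_cr (u v w : E3) : ⟪cr u v, w⟫ = det3 u v w := rfl

/-- Lagrange's identity. -/
theorem inner_cr_cr (a b c d : E3) : ⟪cr a b, cr c d⟫ = ⟪a, c⟫ * ⟪b, d⟫ - ⟪a, d⟫ * ⟪b, c⟫ := by
  simp only [inner_eq_sum_three, cr_zero, cr_one, cr_two]; ring

theorem E3.ext' {u v : E3} (h0 : u 0 = v 0) (h1 : u 1 = v 1) (h2 : u 2 = v 2) : u = v := by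
  ext i; fin_cases i <;> assumption

theorem cr_cr (a b c : E3) : cr a (cr b c) = ⟪a, c⟫ • b - ⟪a, b⟫ • c := by
  apply E3.ext' <;>
  simp only [inner_eq_sum_three, cr_zero, cr_one, cr_two, PiLp.sub_apply, PiLp.smul_apply,
    smul_eq_mul] <;> ring

theorem cr_smul_smul (a b : ℝ) (u v : E3) : cr (a • u) (b • v) = (a * b) • cr u v := by
  apply E3.ext' <;>
  simp only [cr_zero, cr_one, cr_two, PiLp.smul_apply, smul_eq_mul] <;> ring

/-- Cramer's rule for four vectors in three-space. -/
theorem cramer (a b c d : E3) :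
    det3 b c d • a - det3 a c d • b + det3 a b d • c - det3 a b c • d = 0 := by
  apply E3.ext' <;>
  simp only [det3_eq, PiLp.sub_apply, PiLp.add_apply, PiLp.smul_apply, smul_eq_mul,
    PiLp.zero_apply] <;> ring

theorem cramer_inner (a b c d y : E3) :
    det3 b c d * ⟪y, a⟫ - det3 a c d * ⟪y, b⟫ + det3 a b d * ⟪y, c⟫ - det3 a b c * ⟪y, d⟫ = 0 := by
  simp only [det3_eq, inner_eq_sum_three]; ring

/-- A vector orthogonal to `u` and `v` is a multiple of their cross product. -/
theorem smul_eq_of_orthogonal {u v y : E3} (hu : ⟪u, y⟫ = 0) (hv : ⟪v, y⟫ = 0) :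
    ⟪cr u v, cr u v⟫ • y = ⟪cr u v, y⟫ • cr u v := by
  have h : cr (cr u v) (cr y (cr u v)) = 0 := by
    have : cr y (cr u v) = 0 := by
      rw [cr_cr, real_inner_comm, hv, real_inner_comm, hu]; simp
    rw [this]
    apply E3.ext' <;> simp [cr_zero, cr_one, cr_two]
  rw [cr_cr] at h
  exact sub_eq_zero.mp h

/-! ### Polygonal cones

A finite family `m` of vectors in general position that lies in an open half-space spans a
polyhedral cone. In the plane `⟪p, w⟫ = 1`, the vectors become points no three of which are
collinear, and their convex hull is a polygon. -/

section Polygon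

variable {I : Type*} [Fintype I]

/-- No nonzero vector is orthogonal to three members of the family. -/
def InGeneralPosition {I : Type*} (m : I → E3) : Prop :=
  ∀ i j k, i ≠ j → j ≠ k → i ≠ k → ∀ y : E3, ⟪m i, y⟫ = 0 → ⟪m j, y⟫ = 0 → ⟪m k, y⟫ = 0 → y = 0

/-- The members of the family that span extremal rays of the cone. -/
def IsExtremal {I : Type*} (m : I → E3) (i : I) : Prop :=
  ∃ y : E3, y ≠ 0 ∧ ⟪m i, y⟫ = 0 ∧ ∀ k, 0 ≤ ⟪m k, y⟫

/-- `i` and `j` span a facet of the cone, and the cone lies on the positive side of it. -/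
def IsFacet {I : Type*} (m : I → E3) (i j : I) : Prop :=
  i ≠ j ∧ ∀ k, k ≠ i → k ≠ j → 0 < det3 (m i) (m j) (m k)

/-- Three vectors with determinant zero have a common nonzero orthogonal vector. -/
theorem exists_orthogonal_of_det3_eq_zero {u v w : E3} (h : det3 u v w = 0) :
    ∃ y : E3, y ≠ 0 ∧ ⟪u, y⟫ = 0 ∧ ⟪v, y⟫ = 0 ∧ ⟪w, y⟫ = 0 := by
  let M : Matrix (Fin 3) (Fin 3) ℝ := !![u 0, u 1, u 2; v 0, v 1, v 2; w 0, w 1, w 2]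
  have hM : M.det = 0 := by
    rw [← h, det3_eq, Matrix.det_fin_three]
    simp [M]; ring
  obtain ⟨y, hy, hMy⟩ := Matrix.exists_mulVec_eq_zero_iff.mpr hM
  refine ⟨WithLp.toLp 2 y, fun h => hy ?_, ?_, ?_, ?_⟩
  · simpa using congrArg (WithLp.ofLp) h
  · have := congrFun hMy 0
    simpa [M, Matrix.mulVec, dotProduct, Fin.sum_univ_three, inner_eq_sum_three] using this
  · have := congrFun hMy 1
    simpa [M, Matrix.mulVec, dotProduct, Fin.sum_univ_three, inner_eq_sum_three] using this
  · have := congrFun hMy 2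
    simpa [M, Matrix.mulVec, dotProduct, Fin.sum_univ_three, inner_eq_sum_three] using this

theorem exists_ne_ne {I : Type*} [Fintype I] (hI : 3 ≤ Fintype.card I) (i j : I) :
    ∃ k, k ≠ i ∧ k ≠ j := by
  classical
  by_contra! h
  have h1 : Fintype.card I ≤ ({i, j} : Finset I).card := by
    rw [← Finset.card_univ]
    exact Finset.card_le_card fun x _ => by
      by_cases hx : x = i
      · simp [hx]
      · simp [h x hx]
  have := Finset.card_le_two (a := i) (b := j)
  omega

namespace InGeneralPosition

theorem det3_ne_zero {I : Type*} {m : I → E3} (hm : InGeneralPosition m) {i j k : I} (hij : i ≠ j)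
    (hjk : j ≠ k) (hik : i ≠ k) : det3 (m i) (m j) (m k) ≠ 0 := fun h => by
  obtain ⟨y, hy, h1, h2, h3⟩ := exists_orthogonal_of_det3_eq_zero h
  exact hy (hm i j k hij hjk hik y h1 h2 h3)

variable {m : I → E3}

theorem cr_ne_zero (hm : InGeneralPosition m) (hI : 3 ≤ Fintype.card I) {i j : I} (hij : i ≠ j) :
    cr (m i) (m j) ≠ 0 := by
  obtain ⟨k, hki, hkj⟩ := exists_ne_ne hI i j
  intro h
  apply hm.det3_ne_zero hij hkj.symm hki.symm
  rw [← inner_cr, h, inner_zero_left]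

theorem ne_zero (hm : InGeneralPosition m) (hI : 3 ≤ Fintype.card I) (i : I) : m i ≠ 0 := by
  obtain ⟨k, hki, -⟩ := exists_ne_ne hI i i
  intro h
  apply hm.cr_ne_zero hI hki.symm
  rw [h]; apply E3.ext' <;> simp [cr_zero, cr_one, cr_two]

/-- The products with two members of the family can be prescribed. -/
theorem exists_inner_eq (hm : InGeneralPosition m) (hI : 3 ≤ Fintype.card I) {i j : I}
    (hij : i ≠ j) (α β : ℝ) : ∃ u : E3, ⟪m i, u⟫ = α ∧ ⟪m j, u⟫ = β := by
  set w := cr (m i) (m j) with hw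
  have hw0 : ⟪w, w⟫ ≠ 0 := inner_self_ne_zero.mpr (hm.cr_ne_zero hI hij)
  have e1 : ⟪m i, cr (m j) w⟫ = ⟪w, w⟫ := by
    rw [real_inner_comm, inner_cr, ← det3_rotate, ← det3_rotate, ← inner_cr]
  have e2 : ⟪m j, cr (m j) w⟫ = 0 := by rw [real_inner_comm, inner_cr, det3_self_left]
  have e3 : ⟪m i, cr w (m i)⟫ = 0 := by rw [real_inner_comm, inner_cr, det3_self_right]
  have e4 : ⟪m j, cr w (m i)⟫ = ⟪w, w⟫ := by
    rw [real_inner_comm, inner_cr, ← det3_rotate, ← inner_cr]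
  refine ⟨(α / ⟪w, w⟫) • cr (m j) w + (β / ⟪w, w⟫) • cr w (m i), ?_, ?_⟩
  · rw [inner_add_right, inner_smul_right, inner_smul_right, e1, e3]; field_simp; ring
  · rw [inner_add_right, inner_smul_right, inner_smul_right, e2, e4]; field_simp; ring

end InGeneralPosition

/-- A point that satisfies weak inequalities can be pushed to the open side of those that are
equalities. -/
theorem exists_perturb {J : Type*} [Finite J] {m : J → E3} {y u : E3}
    (h : ∀ k, 0 < ⟪m k, y⟫ ∨ ⟪m k, y⟫ = 0 ∧ 0 < ⟪m k, u⟫) :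
    ∃ ε : ℝ, 0 < ε ∧ ∀ k, 0 < ⟪m k, y + ε • u⟫ := by
  have h1 : ∀ᶠ ε : ℝ in nhdsWithin 0 (Set.Ioi 0), ∀ k, 0 < ⟪m k, y + ε • u⟫ := by
    rw [Filter.eventually_all]
    intro k
    rcases h k with hk | ⟨hk, hk'⟩
    · have hc : Continuous fun ε : ℝ => ⟪m k, y + ε • u⟫ := by fun_prop
      have := hc.continuousAt (x := 0)
      have h2 : ∀ᶠ ε : ℝ in nhds 0, 0 < ⟪m k, y + ε • u⟫ :=
        this.eventually (lt_mem_nhds (by simpa using hk))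
      exact h2.filter_mono nhdsWithin_le_nhds
    · filter_upwards [self_mem_nhdsWithin] with ε hε
      rw [inner_add_right, inner_smul_right, hk, zero_add]
      exact mul_pos hε hk'
  obtain ⟨ε, hε, h0⟩ := (h1.and self_mem_nhdsWithin).exists
  exact ⟨ε, h0, hε⟩

section

variable {m : I → E3} {p : E3}

/-- Every functional `y`, shifted by a multiple of `p`, touches the cone at a member `i`. -/
theorem exists_touch (hI : 3 ≤ Fintype.card I) (hp : ∀ k, 0 < ⟪m k, p⟫) (y : E3) :
    ∃ i, ∀ k, 0 ≤ ⟪m k, y - (⟪m i, y⟫ / ⟪m i, p⟫) • p⟫ := by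
  have : Nonempty I := Fintype.card_pos_iff.mp (by omega)
  obtain ⟨i, hi⟩ := Finite.exists_min fun k => ⟪m k, y⟫ / ⟪m k, p⟫
  refine ⟨i, fun k => ?_⟩
  rw [inner_sub_right, inner_smul_right]
  have := (le_div_iff₀ (hp k)).mp (hi k)
  linarith

theorem inner_touch {I : Type*} {m : I → E3} {p : E3} (hp : ∀ k, 0 < ⟪m k, p⟫) (y : E3) (i : I) :
    ⟪m i, y - (⟪m i, y⟫ / ⟪m i, p⟫) • p⟫ = 0 := by
  rw [inner_sub_right, inner_smul_right, div_mul_cancel₀ _ (hp i).ne', sub_self]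

/-- There is an extremal member, and a functional that touches the cone only there. -/
theorem exists_strict_touch (hm : InGeneralPosition m) (hI : 3 ≤ Fintype.card I)
    (hp : ∀ k, 0 < ⟪m k, p⟫) :
    ∃ i, ∃ y : E3, ⟪m i, y⟫ = 0 ∧ ∀ k, k ≠ i → 0 < ⟪m k, y⟫ := by
  have : Nonempty I := Fintype.card_pos_iff.mp (by omega)
  obtain ⟨i₁⟩ := this
  obtain ⟨i₂, hi₂, -⟩ := exists_ne_ne hI i₁ i₁
  -- a functional that is not a multiple of `p`
  obtain ⟨q, hq1, hq2⟩ := hm.exists_inner_eq hI hi₂ 0 1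
  obtain ⟨i, hi⟩ := exists_touch hI hp q
  set y := q - (⟪m i, q⟫ / ⟪m i, p⟫) • p with hy
  have hyi : ⟪m i, y⟫ = 0 := inner_touch hp q i
  have hy0 : y ≠ 0 := by
    intro h0
    have e1 : ⟪m i₁, y⟫ = 0 := by rw [h0, inner_zero_right]
    have e2 : ⟪m i₂, y⟫ = 0 := by rw [h0, inner_zero_right]
    rw [hy, inner_sub_right, inner_smul_right] at e1 e2
    rw [hq1] at e2
    rw [hq2] at e1
    have : ⟪m i, q⟫ / ⟪m i, p⟫ = 0 := by
      have := hp i₂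
      by_contra h
      exact (mul_ne_zero h this.ne') (by linarith)
    rw [this] at e1
    norm_num at e1
  -- if the functional touches the cone along a facet, it can be tilted about the ray of `i`
  by_cases hj : ∃ j, j ≠ i ∧ ⟪m j, y⟫ = 0
  · obtain ⟨j, hji, hj⟩ := hj
    obtain ⟨u, hu1, hu2⟩ := hm.exists_inner_eq hI hji.symm 0 1
    have h1 : ∀ k : {k // k ≠ i}, 0 < ⟪m k, y⟫ ∨ ⟪m k, y⟫ = 0 ∧ 0 < ⟪m k, u⟫ := by
      rintro ⟨k, hk⟩
      by_cases hkj : k = j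
      · right; subst hkj; exact ⟨hj, by simp [hu2]⟩
      · left
        refine lt_of_le_of_ne (hi k) fun h => hy0 ?_
        exact hm i j k hji.symm (Ne.symm hkj) (Ne.symm hk) y hyi hj h.symm
    obtain ⟨ε, -, h2⟩ := exists_perturb (m := fun k : {k // k ≠ i} => m k) h1
    refine ⟨i, y + ε • u, ?_, fun k hk => h2 ⟨k, hk⟩⟩
    rw [inner_add_right, inner_smul_right, hyi, hu1]; simp
  · push Not at hj
    exact ⟨i, y, hyi, fun k hk => lt_of_le_of_ne (hi k) (hj k hk).symm⟩

theorem isExtremal_of_strict_touch (hI : 3 ≤ Fintype.card I) {i : I} {y : E3}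
    (hi : ⟪m i, y⟫ = 0) (h : ∀ k, k ≠ i → 0 < ⟪m k, y⟫) : IsExtremal m i := by
  refine ⟨y, fun h0 => ?_, hi, fun k => ?_⟩
  · obtain ⟨k, hk, -⟩ := exists_ne_ne hI i i
    have := h k hk
    simp [h0] at this
  · by_cases hk : k = i
    · rw [hk, hi]
    · exact (h k hk).le

/-- A functional that is nonnegative on the extremal members is nonnegative on all members:
shifted by a multiple of `p`, it touches the cone at an extremal member. -/
theorem nonneg_of_extremal (hm : InGeneralPosition m) (hI : 3 ≤ Fintype.card I)
    (hp : ∀ k, 0 < ⟪m k, p⟫) {y : E3} (hy : ∀ k, IsExtremal m k → 0 ≤ ⟪m k, y⟫) (k : I) :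
    0 ≤ ⟪m k, y⟫ := by
  obtain ⟨i, hi⟩ := exists_touch hI hp y
  have hpi := hp i
  suffices h : 0 ≤ ⟪m i, y⟫ by
    have h1 := hi k
    rw [inner_sub_right, inner_smul_right] at h1
    have : 0 ≤ ⟪m i, y⟫ / ⟪m i, p⟫ * ⟪m k, p⟫ := by have := hp k; positivity
    linarith
  by_cases h0 : y - (⟪m i, y⟫ / ⟪m i, p⟫) • p = 0
  · obtain ⟨j, z, hz, hz'⟩ := exists_strict_touch hm hI hp
    have h1 := hy j (isExtremal_of_strict_touch hI hz hz')
    rw [sub_eq_zero.mp h0, inner_smul_right] at h1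
    have h2 : 0 ≤ ⟪m i, y⟫ / ⟪m i, p⟫ := nonneg_of_mul_nonneg_left h1 (hp j)
    by_contra h3
    have := div_neg_of_neg_of_pos (not_le.mp h3) (hp i)
    linarith
  · exact hy i ⟨_, h0, inner_touch hp y i, hi⟩

/-- A functional that is positive on the extremal members is positive on all members. -/
theorem pos_of_extremal (hm : InGeneralPosition m) (hI : 3 ≤ Fintype.card I)
    (hp : ∀ k, 0 < ⟪m k, p⟫) {y : E3} (hy : ∀ k, IsExtremal m k → 0 < ⟪m k, y⟫) (k : I) :
    0 < ⟪m k, y⟫ := by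
  classical
  obtain ⟨ε, hε, h⟩ := exists_perturb (m := fun k : {k // IsExtremal m k} => m k) (y := y)
    (u := -p) fun k => Or.inl (hy k k.2)
  have h1 := nonneg_of_extremal hm hI hp (y := y + ε • -p) (fun k hk => (h ⟨k, hk⟩).le) k
  rw [inner_add_right, inner_smul_right, inner_neg_right] at h1
  have := mul_pos hε (hp k)
  linarith

end

/-- The members of a finite set can be listed in the order of an injective real key. -/
theorem exists_sorted_list {I : Type*} (S : Finset I) (i₀ : I) (key : I → ℝ)
    (hinj : Set.InjOn key S) :
    ∃ b : ℕ → I, (∀ r, r < S.card → b r ∈ S) ∧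
      (∀ r s, r < s → s < S.card → key (b r) < key (b s)) ∧ ∀ k ∈ S, ∃ r, r < S.card ∧ b r = k := by
  classical
  have hcard : (S.image key).card = S.card := Finset.card_image_of_injOn hinj
  let e := (S.image key).orderIsoOfFin hcard
  have hex : ∀ r : Fin S.card, ∃ i ∈ S, key i = e r := fun r =>
    Finset.mem_image.mp (e r).2
  choose f hf hk using hex
  refine ⟨fun r => if h : r < S.card then f ⟨r, h⟩ else i₀, fun r hr => ?_, fun r s hrs hs => ?_,
    fun k hkS => ?_⟩
  · simp only [hr, dif_pos, hf]
  · simp only [hs, hrs.trans hs, dif_pos, hk]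
    exact_mod_cast e.strictMono (show (⟨r, hrs.trans hs⟩ : Fin S.card) < ⟨s, hs⟩ from hrs)
  · obtain ⟨r, hr⟩ := e.surjective ⟨key k, Finset.mem_image_of_mem _ hkS⟩
    refine ⟨r, r.2, ?_⟩
    simp only [r.2, dif_pos]
    exact hinj (hf r) hkS (by rw [hk, hr])

variable {m : I → E3} {p : E3}

/-- A list of extremal members is ordered around the cone if it is ordered around its first
member. -/
theorem det3_pos_of_sorted {I : Type*} {m : I → E3} (hm : InGeneralPosition m) {i r s t : I}
    (h1 : 0 < det3 (m i) (m r) (m s))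
    (h2 : 0 < det3 (m i) (m s) (m t)) (h3 : 0 < det3 (m i) (m r) (m t)) (hs : IsExtremal m s) :
    0 < det3 (m r) (m s) (m t) := by
  by_contra hneg
  have hir : i ≠ r := by rintro rfl; simp [det3_eq] at h1; ring_nf at h1; simp at h1
  have hit : i ≠ t := by rintro rfl; rw [det3_self_left] at h2; exact h2.false
  have hrt : r ≠ t := by rintro rfl; rw [det3_self_right] at h3; exact h3.false
  have hrs : r ≠ s := by rintro rfl; rw [det3_self_right] at h1; exact h1.false
  have hst : s ≠ t := by rintro rfl; rw [det3_self_right] at h2; exact h2.false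
  have hlt : det3 (m r) (m s) (m t) < 0 :=
    lt_of_le_of_ne (not_lt.mp hneg) (hm.det3_ne_zero hrs hst hrt)
  obtain ⟨y, hy, hys, hyk⟩ := hs
  -- `m s` is a positive combination of `m i`, `m r` and `m t`
  have hc := cramer_inner (m i) (m r) (m s) (m t) y
  rw [real_inner_comm, real_inner_comm (m r), real_inner_comm (m s), real_inner_comm (m t),
    hys] at hc
  have a1 := mul_nonneg (neg_nonneg.mpr hlt.le) (hyk i)
  have a2 := mul_nonneg h2.le (hyk r)
  have a3 := mul_nonneg h1.le (hyk t)
  refine hy (hm i r t hir hrt hit y ?_ ?_ ?_)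
  · exact (mul_eq_zero.mp (show -det3 (m r) (m s) (m t) * ⟪m i, y⟫ = 0 by linarith)).resolve_left
      (by linarith)
  · exact (mul_eq_zero.mp (show det3 (m i) (m s) (m t) * ⟪m r, y⟫ = 0 by linarith)).resolve_left
      (by linarith)
  · exact (mul_eq_zero.mp (show det3 (m i) (m r) (m s) * ⟪m t, y⟫ = 0 by linarith)).resolve_left
      (by linarith)

/-- A list of the extremal members in cyclic order, continued periodically. -/
structure CyclicList {I : Type*} (m : I → E3) (M : ℕ) (b : ℕ → I) : Prop where
  three_le : 3 ≤ M
  periodic : ∀ r, b (r + M) = b r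
  modEq_of_eq : ∀ r s, b r = b s → r ≡ s [MOD M]
  isFacet : ∀ r, IsFacet m (b r) (b (r + 1))
  exists_of_isFacet : ∀ i j, IsFacet m i j → ∃ r, b r = i ∧ b (r + 1) = j
  det3_pos : ∀ r s t, r < s → s < t → t < M → 0 < det3 (m (b r)) (m (b s)) (m (b t))
  exists_of_isExtremal : ∀ k, IsExtremal m k → ∃ r, b r = k

/-- The extremal members can be listed in cyclic order: after a first one has been chosen, the
others are sorted by their slope as seen from it. -/
theorem exists_cyclicList (hm : InGeneralPosition m) (hI : 3 ≤ Fintype.card I)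
    (hp : ∀ k, 0 < ⟪m k, p⟫) : ∃ (M : ℕ) (b : ℕ → I), CyclicList m M b := by
  classical
  obtain ⟨i₀, y, hy, hy'⟩ := exists_strict_touch hm hI hp
  have hi₀ : IsExtremal m i₀ := isExtremal_of_strict_touch hI hy hy'
  have hy0 : 0 < ⟪y, y⟫ := by
    obtain ⟨k, hk, -⟩ := exists_ne_ne hI i₀ i₀
    refine real_inner_self_nonneg.lt_of_ne fun h => ?_
    have := hy' k hk
    simp [inner_self_eq_zero.mp h.symm] at this
  -- the slope, seen from `m i₀`
  set z := cr (m i₀) y with hz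
  let key : I → ℝ := fun k => ⟪m k, z⟫ / ⟪m k, y⟫
  have hdet : ∀ j k, j ≠ i₀ → k ≠ i₀ → ⟪y, y⟫ * det3 (m i₀) (m j) (m k) =
      ⟪m j, y⟫ * ⟪m k, y⟫ * (key k - key j) := by
    intro j k hj hk
    have h1 := inner_cr_cr y z (m j) (m k)
    have h2 : cr y z = ⟪y, y⟫ • m i₀ := by rw [hz, cr_cr, real_inner_comm (m i₀) y, hy]; simp
    rw [h2, real_inner_smul_left, real_inner_comm (cr (m j) (m k)), inner_cr, det3_rotate]
      at h1
    have := (hy' j hj).ne'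
    have := (hy' k hk).ne'
    simp only [key]
    rw [h1]
    field_simp
    rw [real_inner_comm y (m k), real_inner_comm z (m k), real_inner_comm z (m j),
      real_inner_comm y (m j)]
  have hdet_pos : ∀ j k, j ≠ i₀ → k ≠ i₀ → key j < key k → 0 < det3 (m i₀) (m j) (m k) := by
    intro j k hj hk hjk
    refine pos_of_mul_pos_right (a := ⟪y, y⟫) ?_ hy0.le
    rw [hdet j k hj hk]
    exact mul_pos (mul_pos (hy' j hj) (hy' k hk)) (sub_pos.mpr hjk)
  set S : Finset I := (Finset.univ.filter fun k => IsExtremal m k).erase i₀ with hS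
  have hSmem : ∀ k, k ∈ S ↔ k ≠ i₀ ∧ IsExtremal m k := fun k => by simp [hS]
  have hinj : Set.InjOn key S := by
    intro j hj k hk hjk
    by_contra hne
    have hj' := ((hSmem j).mp hj).1
    have hk' := ((hSmem k).mp hk).1
    have h1 := hdet j k hj' hk'
    rw [hjk, sub_self, mul_zero] at h1
    exact hm.det3_ne_zero hj'.symm hne hk'.symm ((mul_eq_zero.mp h1).resolve_left hy0.ne')
  obtain ⟨e, he1, he2, he3⟩ := exists_sorted_list S i₀ key hinj
  set M := S.card + 1 with hM
  -- one period of the list, which starts with `i₀`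
  let b₀ : ℕ → I := fun r => if r = 0 then i₀ else e (r - 1)
  have hb0 : b₀ 0 = i₀ := rfl
  have hbs : ∀ r, b₀ (r + 1) = e r := fun r => rfl
  have hbE : ∀ r, r < M → IsExtremal m (b₀ r) := by
    rintro (_ | r) hr
    · exact hi₀
    · exact ((hSmem _).mp (he1 r (by omega))).2
  have hbne : ∀ r, r < S.card → e r ≠ i₀ := fun r hr => ((hSmem _).mp (he1 r hr)).1
  have hd0 : ∀ r s, r < s → s < S.card → 0 < det3 (m i₀) (m (e r)) (m (e s)) := fun r s hrs hs =>
    hdet_pos _ _ (hbne r (hrs.trans hs)) (hbne s hs) (he2 r s hrs hs)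
  have hd : ∀ r s t, r < s → s < t → t < M → 0 < det3 (m (b₀ r)) (m (b₀ s)) (m (b₀ t)) := by
    rintro (_ | r) (_ | s) (_ | t) h1 h2 h3 <;> try omega
    · exact hd0 s t (by omega) (by omega)
    · exact det3_pos_of_sorted hm (hd0 r s (by omega) (by omega)) (hd0 s t (by omega) (by omega))
        (hd0 r t (by omega) (by omega)) (hbE (s + 1) (by omega))
  have hsurj : ∀ k, IsExtremal m k → ∃ r, r < M ∧ b₀ r = k := by
    intro k hk
    by_cases hki : k = i₀
    · exact ⟨0, by omega, hki.symm⟩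
    · obtain ⟨r, hr, hr'⟩ := he3 k ((hSmem k).mpr ⟨hki, hk⟩)
      exact ⟨r + 1, by omega, hr'⟩
  have hlt : ∀ r s, r < s → s < M → b₀ r ≠ b₀ s := by
    rintro (_ | r) (_ | s) h1 h2 <;> try omega
    · exact (hbne s (by omega)).symm
    · intro h
      have := he2 r s (by omega) (by omega)
      rw [← hbs, ← hbs, h] at this
      exact this.false
  have hbinj : ∀ r s, r < M → s < M → b₀ r = b₀ s → r = s := by
    intro r s hr hs h
    rcases lt_trichotomy r s with h1 | h1 | h1
    · exact absurd h (hlt r s h1 hs)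
    · exact h1
    · exact absurd h.symm (hlt s r h1 hr)
  have hM3 : 3 ≤ M := by
    by_contra hlt3
    -- otherwise some functional vanishes on all the extremal members
    obtain ⟨i₁, hi₁, hi₁'⟩ : ∃ i₁, i₁ ≠ i₀ ∧ ∀ k, IsExtremal m k → k = i₀ ∨ k = i₁ := by
      by_cases hc : 0 < S.card
      · refine ⟨e 0, hbne 0 hc, fun k hk => ?_⟩
        obtain ⟨r, hr, rfl⟩ := hsurj k hk
        rcases r with _ | _ | r
        · left; rfl
        · right; rfl
        · omega
      · obtain ⟨i₁, hi₁, -⟩ := exists_ne_ne hI i₀ i₀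
        refine ⟨i₁, hi₁, fun k hk => ?_⟩
        obtain ⟨r, hr, rfl⟩ := hsurj k hk
        rcases r with _ | r
        · left; rfl
        · omega
    set w := cr (m i₀) (m i₁) with hw
    have h0 : ⟪m i₀, w⟫ = 0 := by rw [real_inner_comm, inner_cr, det3_self_left]
    have h1 : ⟪m i₁, w⟫ = 0 := by rw [real_inner_comm, inner_cr, det3_self_right]
    obtain ⟨k, hk0, hk1⟩ := exists_ne_ne hI i₀ i₁
    have e1 := nonneg_of_extremal hm hI hp (y := w) (fun k hk => by
      rcases hi₁' k hk with rfl | rfl <;> simp [h0, h1]) k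
    have e2 := nonneg_of_extremal hm hI hp (y := -w) (fun k hk => by
      rcases hi₁' k hk with rfl | rfl <;> simp [h0, h1]) k
    rw [inner_neg_right] at e2
    exact hm.cr_ne_zero hI hi₁.symm (hm i₀ i₁ k hi₁.symm hk1.symm hk0.symm w h0 h1 (by linarith))
  -- the determinants with all members are positive if those with the extremal members are
  have hfacet : ∀ r s, r < M → s < M → r ≠ s →
      (∀ t, t < M → t ≠ r → t ≠ s → 0 < det3 (m (b₀ r)) (m (b₀ s)) (m (b₀ t))) →
      IsFacet m (b₀ r) (b₀ s) := by
    intro r s hr hs hrs h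
    have hne : b₀ r ≠ b₀ s := fun h' => hrs (hbinj r s hr hs h')
    refine ⟨hne, fun k hkr hks => ?_⟩
    rw [← inner_cr, real_inner_comm]
    refine (nonneg_of_extremal hm hI hp (fun k hk => ?_) k).lt_of_ne fun h0 => ?_
    · obtain ⟨t, ht, rfl⟩ := hsurj k hk
      rw [real_inner_comm, inner_cr]
      by_cases htr : t = r
      · rw [htr, det3_self_left]
      by_cases hts : t = s
      · rw [hts, det3_self_right]
      exact (h t ht htr hts).le
    · rw [real_inner_comm, inner_cr] at h0
      exact hm.det3_ne_zero hne hks.symm hkr.symm h0.symm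
  refine ⟨M, fun r => b₀ (r % M), hM3, fun r => by simp, fun r s h =>
    hbinj _ _ (Nat.mod_lt _ (by omega)) (Nat.mod_lt _ (by omega)) h, fun r => ?_, ?_, ?_, ?_⟩
  · have hr := Nat.mod_lt r (show M > 0 by omega)
    rcases Nat.lt_or_ge (r % M + 1) M with h | h
    · have h' : (r + 1) % M = r % M + 1 := by rw [Nat.add_mod, Nat.mod_eq_of_lt (show 1 < M by omega),
        Nat.mod_eq_of_lt h]
      simp only [h']
      refine hfacet _ _ hr h (by omega) fun t ht h1 h2 => ?_
      rcases Nat.lt_or_ge t (r % M) with h3 | h3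
      · rw [det3_rotate]; exact hd _ _ _ h3 (by omega) h
      · exact hd _ _ _ (by omega) (by omega) ht
    · have h1 : r % M + 1 = M := by omega
      have h' : (r + 1) % M = 0 := by rw [Nat.add_mod, Nat.mod_eq_of_lt (show 1 < M by omega), h1,
        Nat.mod_self]
      simp only [h']
      refine hfacet _ _ hr (by omega) (by omega) fun t ht h1 h2 => ?_
      rw [← det3_rotate]
      exact hd _ _ _ (by omega) (by omega) hr
  · rintro i j ⟨hij, h⟩
    have hz0 : cr (m i) (m j) ≠ 0 := hm.cr_ne_zero hI hij
    have hz1 : ∀ k, 0 ≤ ⟪m k, cr (m i) (m j)⟫ := fun k => by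
      rw [real_inner_comm, inner_cr]
      by_cases h1 : k = i
      · rw [h1, det3_self_left]
      by_cases h2 : k = j
      · rw [h2, det3_self_right]
      exact (h k h1 h2).le
    obtain ⟨r, hr, rfl⟩ := hsurj i ⟨_, hz0, by rw [real_inner_comm, inner_cr, det3_self_left], hz1⟩
    obtain ⟨s, hs, rfl⟩ := hsurj j ⟨_, hz0, by rw [real_inner_comm, inner_cr, det3_self_right], hz1⟩
    have h' : ∀ t, t < M → t ≠ r → t ≠ s → 0 < det3 (m (b₀ r)) (m (b₀ s)) (m (b₀ t)) :=
      fun t ht h1 h2 => h _ (fun h3 => h1 (hbinj _ _ ht hr h3)) (fun h3 => h2 (hbinj _ _ ht hs h3))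
    refine ⟨r, by simp [Nat.mod_eq_of_lt hr], ?_⟩
    have hrs : r ≠ s := fun h3 => hij (by rw [h3])
    rcases Nat.lt_or_ge (r + 1) M with h1 | h1
    · simp only [Nat.mod_eq_of_lt h1]
      congr 1
      by_contra hne
      rcases Nat.lt_or_ge r s with h3 | h3
      · have e1 := h' (r + 1) h1 (by omega) (by omega)
        have e2 := hd r (r + 1) s (by omega) (by omega) hs
        rw [← det3_rotate, det3_swap, ← det3_rotate, ← det3_rotate] at e1
        linarith
      · have e1 := h' (r + 1) h1 (by omega) (by omega)
        have e2 := hd s r (r + 1) (by omega) (by omega) h1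
        rw [det3_swap] at e1
        linarith
    · have h2 : r + 1 = M := by omega
      simp only [h2, Nat.mod_self]
      congr 1
      by_contra hne
      have e1 := h' 0 (by omega) (by omega) (by omega)
      have e2 := hd 0 s r (by omega) (by omega) hr
      rw [det3_swap, det3_rotate] at e1
      linarith
  · intro r s t h1 h2 h3
    simp only [Nat.mod_eq_of_lt h3, Nat.mod_eq_of_lt (h2.trans h3),
      Nat.mod_eq_of_lt (h1.trans (h2.trans h3))]
    exact hd r s t h1 h2 h3
  · intro k hk
    obtain ⟨r, hr, h⟩ := hsurj k hk
    exact ⟨r, by simp [Nat.mod_eq_of_lt hr, h]⟩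

/-- A sequence that starts and ends with positive terms, and whose signs do not alternate four
times, changes its sign twice, unless it is positive. -/
theorem sum_sign_changes_eq_two {f : ℕ → ℝ} {M : ℕ} (hf : ∀ r, f r ≠ 0) (h0 : 0 < f 0)
    (hM : f M = f 0) (halt : ∀ r s t, 0 < r → r < s → s < t → t < M →
      f r < 0 → 0 < f s → f t < 0 → False) (hneg : ∃ r, r < M ∧ f r < 0) :
    ∑ r ∈ Finset.range M, (if f r * f (r + 1) < 0 then (1 : ℝ) else 0) = 2 := by
  classical
  have hp := Nat.find_spec hneg
  have hpmin : ∀ r, r < Nat.find hneg → 0 < f r := fun r hr => by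
    have := Nat.find_min hneg hr
    have h2 : r < M := hr.trans hp.1
    exact lt_of_le_of_ne (by by_contra h; exact this ⟨h2, not_le.mp h⟩) (hf r).symm
  generalize Nat.find hneg = p at hp hpmin
  have hq : ∃ q, p < q ∧ 0 < f q := ⟨M, hp.1, hM ▸ h0⟩
  have hqM : Nat.find hq ≤ M := Nat.find_min' hq ⟨hp.1, hM ▸ h0⟩
  have hqs := Nat.find_spec hq
  have hqmin : ∀ r, p ≤ r → r < Nat.find hq → f r < 0 := fun r hpr hr => by
    rcases hpr.eq_or_lt with rfl | hpr
    · exact hp.2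
    · exact lt_of_le_of_ne (by by_contra h; exact Nat.find_min hq hr ⟨hpr, not_le.mp h⟩) (hf r)
  generalize Nat.find hq = q at hqM hqs hqmin
  have hp0 : 0 < p := Nat.pos_of_ne_zero fun h => by rw [h] at hp; linarith [hp.2]
  have hlast : ∀ r, q ≤ r → r ≤ M → 0 < f r := fun r hqr hr => by
    rcases hr.eq_or_lt with rfl | hr
    · rwa [hM]
    rcases hqr.eq_or_lt with rfl | hqr
    · exact hqs.2
    · by_contra h
      exact halt p q r hp0 hqs.1 hqr hr hp.2 hqs.2 (lt_of_le_of_ne (not_lt.mp h) (hf r))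
  have hiff : ∀ r ∈ Finset.range M, (if f r * f (r + 1) < 0 then (1 : ℝ) else 0) =
      (if r = p - 1 then 1 else 0) + (if r = q - 1 then 1 else 0) := by
    intro r hr
    have hr := Finset.mem_range.mp hr
    rcases lt_trichotomy (r + 1) p with h | h | h
    · have := mul_pos (hpmin r (by omega)) (hpmin (r + 1) h)
      rw [if_neg this.not_gt, if_neg (by omega), if_neg (by omega), add_zero]
    · have := mul_neg_of_pos_of_neg (hpmin r (by omega)) (h ▸ hp.2)
      rw [if_pos this, if_pos (by omega), if_neg (by omega), add_zero]
    · rcases lt_trichotomy (r + 1) q with h' | h' | h'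
      · have := mul_pos_of_neg_of_neg (hqmin r (by omega) (by omega)) (hqmin (r + 1) h.le h')
        rw [if_neg this.not_gt, if_neg (by omega), if_neg (by omega), add_zero]
      · have := mul_neg_of_neg_of_pos (hqmin r (by omega) (by omega)) (h' ▸ hqs.2)
        rw [if_pos this, if_neg (by omega), if_pos (by omega), zero_add]
      · have := mul_pos (hlast r (by omega) (by omega)) (hlast (r + 1) (by omega) (by omega))
        rw [if_neg this.not_gt, if_neg (by omega), if_neg (by omega), add_zero]
  rw [Finset.sum_congr rfl hiff, Finset.sum_add_distrib, Finset.sum_ite_eq', Finset.sum_ite_eq',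
    if_pos (Finset.mem_range.mpr (by omega)), if_pos (Finset.mem_range.mpr (by omega))]
  norm_num

namespace CyclicList

variable {M : ℕ} {b : ℕ → I}

theorem apply_mod {I : Type*} {m : I → E3} {M : ℕ} {b : ℕ → I} (hb : CyclicList m M b) (r : ℕ) :
    b (r % M) = b r := by
  have h : Function.Periodic b M := hb.periodic
  exact h.map_mod_nat r

/-- A functional changes its sign along the cyclic list twice, unless it has the same sign on the
whole cone. -/
theorem sum_sign_changes (hm : InGeneralPosition m) (hI : 3 ≤ Fintype.card I)
    (hp : ∀ k, 0 < ⟪m k, p⟫) (hb : CyclicList m M b) {v : E3} (hv : ∀ k, ⟪m k, v⟫ ≠ 0)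
    (hpos : ¬ ∀ k, 0 < ⟪m k, v⟫) (hneg : ¬ ∀ k, ⟪m k, v⟫ < 0) :
    ∑ r ∈ Finset.range M, (if ⟪m (b r), v⟫ * ⟪m (b (r + 1)), v⟫ < 0 then (1 : ℝ) else 0) = 2 := by
  wlog h0 : 0 < ⟪m (b 0), v⟫ generalizing v
  · have h1 : 0 < ⟪m (b 0), -v⟫ := by
      rw [inner_neg_right]
      exact neg_pos.mpr (lt_of_le_of_ne (not_lt.mp h0) (hv _))
    have := this (v := -v) (fun k => by rw [inner_neg_right]; exact neg_ne_zero.mpr (hv k))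
      (by simpa [inner_neg_right] using hneg) (by simpa [inner_neg_right] using hpos) h1
    simpa [inner_neg_right] using this
  have h3 := hb.three_le
  refine sum_sign_changes_eq_two (f := fun r => ⟪m (b r), v⟫) (fun r => hv _) h0 ?_ ?_ ?_
  · have := hb.periodic 0
    rw [zero_add] at this
    simp only [this]
  · -- four alternating signs contradict the linear relation between four consecutive members
    intro r s t hr hrs hst ht e1 e2 e3
    have hc := cramer_inner (m (b 0)) (m (b r)) (m (b s)) (m (b t)) v
    rw [real_inner_comm, real_inner_comm (m (b r)), real_inner_comm (m (b s)),
      real_inner_comm (m (b t))] at hc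
    have a1 := mul_pos (hb.det3_pos r s t hrs hst ht) h0
    have a2 := mul_neg_of_pos_of_neg (hb.det3_pos 0 s t (by omega) hst ht) e1
    have a3 := mul_pos (hb.det3_pos 0 r t hr (by omega) ht) e2
    have a4 := mul_neg_of_pos_of_neg (hb.det3_pos 0 r s hr hrs (by omega)) e3
    linarith
  · by_contra! hall
    refine hpos (pos_of_extremal hm hI hp fun k hk => ?_)
    obtain ⟨r, rfl⟩ := hb.exists_of_isExtremal k hk
    rw [← hb.apply_mod]
    exact lt_of_le_of_ne (hall _ (Nat.mod_lt _ (by omega))) (hv _).symm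

end CyclicList

end Polygon

/-! ### Distances in the Euclidean cone -/

/-- The point of the plane with polar coordinates `r` and `α`. -/
def polar (r α : ℝ) : ℂ := r * Complex.exp (α * Complex.I)

theorem polar_re (r α : ℝ) : (polar r α).re = r * Real.cos α := by
  simp [polar, Complex.exp_ofReal_mul_I_re]

theorem polar_im (r α : ℝ) : (polar r α).im = r * Real.sin α := by
  simp [polar, Complex.exp_ofReal_mul_I_im]

theorem norm_polar {r : ℝ} (hr : 0 ≤ r) (α : ℝ) : ‖polar r α‖ = r := by
  simp [polar, Complex.norm_exp_ofReal_mul_I, abs_of_nonneg hr]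

theorem norm_eq_sqrt_re_im (z : ℂ) : ‖z‖ = √(z.re ^ 2 + z.im ^ 2) := by
  rw [Complex.norm_def, Complex.normSq_apply]; congr 1; ring

/-- The law of cosines. -/
theorem norm_polar_sub_polar (r s α β : ℝ) :
    ‖polar r α - polar s β‖ = √(r ^ 2 + s ^ 2 - 2 * r * s * Real.cos (α - β)) := by
  rw [norm_eq_sqrt_re_im]
  simp only [Complex.sub_re, Complex.sub_im, polar_re, polar_im]
  congr 1
  have h1 := Real.sin_sq_add_cos_sq α
  have h2 := Real.sin_sq_add_cos_sq β
  rw [Real.cos_sub]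
  linear_combination r ^ 2 * h1 + s ^ 2 * h2

theorem coneDist_eq_norm (r s : ℝ) {α β : ℝ} (h : |α - β| ≤ π) :
    coneDist r s |α - β| = ‖polar r α - polar s β‖ := by
  rw [norm_polar_sub_polar, coneDist, min_eq_left h, Real.cos_abs]

theorem coneDist_comm (r s φ : ℝ) : coneDist r s φ = coneDist s r φ := by
  simp only [coneDist]; congr 1; ring

theorem coneDist_nonneg (r s φ : ℝ) : 0 ≤ coneDist r s φ := Real.sqrt_nonneg _

theorem coneDist_of_pi_le {r s : ℝ} (hr : 0 ≤ r) (hs : 0 ≤ s) {φ : ℝ} (h : π ≤ φ) :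
    coneDist r s φ = r + s := by
  rw [coneDist, min_eq_right h, Real.cos_pi,
    show r ^ 2 + s ^ 2 - 2 * r * s * -1 = (r + s) ^ 2 by ring, Real.sqrt_sq (by positivity)]

theorem coneDist_zero_left {s : ℝ} (hs : 0 ≤ s) (φ : ℝ) : coneDist 0 s φ = s := by
  simp [coneDist, Real.sqrt_sq hs]

theorem coneDist_zero_right {r : ℝ} (hr : 0 ≤ r) (φ : ℝ) : coneDist r 0 φ = r := by
  simp [coneDist, Real.sqrt_sq hr]

theorem coneDist_self {r : ℝ} : coneDist r r 0 = 0 := by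
  rw [coneDist, min_eq_left Real.pi_pos.le, Real.cos_zero]; ring_nf; simp

theorem coneDist_mono {r s : ℝ} (hr : 0 ≤ r) (hs : 0 ≤ s) {φ ψ : ℝ} (h0 : 0 ≤ φ) (h : φ ≤ ψ) :
    coneDist r s φ ≤ coneDist r s ψ := by
  refine Real.sqrt_le_sqrt ?_
  have h1 : min φ π ≤ min ψ π := min_le_min_right _ h
  have h2 : Real.cos (min ψ π) ≤ Real.cos (min φ π) :=
    Real.cos_le_cos_of_nonneg_of_le_pi (le_min h0 Real.pi_pos.le) (min_le_right _ _) h1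
  have := mul_le_mul_of_nonneg_left h2 (show 0 ≤ 2 * r * s by positivity)
  linarith

theorem coneDist_le_add {r s : ℝ} (hr : 0 ≤ r) (hs : 0 ≤ s) {φ : ℝ} (h0 : 0 ≤ φ) :
    coneDist r s φ ≤ r + s := by
  rw [← coneDist_of_pi_le hr hs (le_max_right φ π)]
  exact coneDist_mono hr hs h0 (le_max_left _ _)

/-- The triangle inequality in the cone. -/
theorem coneDist_triangle {r s t φ ψ χ : ℝ} (hr : 0 ≤ r) (hs : 0 ≤ s) (ht : 0 ≤ t) (hφ : 0 ≤ φ)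
    (hψ : 0 ≤ ψ) (hχ : 0 ≤ χ) (h : χ ≤ φ + ψ) :
    coneDist r t χ ≤ coneDist r s φ + coneDist s t ψ := by
  -- with angles of sum at most `π`, the three points can be placed in the plane
  have key : ∀ φ ψ : ℝ, 0 ≤ φ → 0 ≤ ψ → φ + ψ ≤ π →
      coneDist r t (φ + ψ) ≤ coneDist r s φ + coneDist s t ψ := by
    intro φ ψ hφ hψ h
    have e1 := coneDist_eq_norm r t (α := 0) (β := φ + ψ)
      (by rw [zero_sub, abs_neg, abs_of_nonneg (by positivity)]; exact h)
    have e2 := coneDist_eq_norm r s (α := 0) (β := φ)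
      (by rw [zero_sub, abs_neg, abs_of_nonneg hφ]; linarith)
    have e3 := coneDist_eq_norm s t (α := φ) (β := φ + ψ)
      (by rw [sub_add_cancel_left, abs_neg, abs_of_nonneg hψ]; linarith)
    rw [zero_sub, abs_neg, abs_of_nonneg (by positivity)] at e1
    rw [zero_sub, abs_neg, abs_of_nonneg hφ] at e2
    rw [sub_add_cancel_left, abs_neg, abs_of_nonneg hψ] at e3
    rw [e1, e2, e3]
    exact norm_sub_le_norm_sub_add_norm_sub _ _ _
  refine (coneDist_mono hr ht hχ h).trans ?_
  rcases le_total (φ + ψ) π with h1 | h1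
  · exact key φ ψ hφ hψ h1
  rw [coneDist_of_pi_le hr ht h1]
  rcases le_total φ π with h2 | h2
  · have := key φ (π - φ) hφ (by linarith) (by linarith)
    rw [coneDist_of_pi_le hr ht (by linarith)] at this
    have h3 := coneDist_mono hs ht (φ := π - φ) (ψ := ψ) (by linarith) (by linarith)
    linarith
  · rw [coneDist_of_pi_le hr hs h2]
    have h3 := coneDist_mono hs ht (φ := 0) (ψ := ψ) le_rfl hψ
    have h4 : t - s ≤ coneDist s t 0 := by
      rw [coneDist, min_eq_left Real.pi_pos.le, Real.cos_zero]
      refine Real.le_sqrt_of_sq_le (le_of_eq (by ring))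
    linarith

/-- A straight segment in a sector of angle at most `π` meets each ray of the sector. -/
theorem exists_coneDist_add {r s φ ψ : ℝ} (hr : 0 ≤ r) (hs : 0 ≤ s) (hφ : 0 ≤ φ) (hψ : 0 ≤ ψ)
    (h : φ + ψ ≤ π) : ∃ ρ : ℝ, 0 ≤ ρ ∧ ρ ≤ max r s ∧
      coneDist r ρ φ + coneDist ρ s ψ = coneDist r s (φ + ψ) := by
  by_cases h0 : r = 0
  · subst h0
    exact ⟨0, le_rfl, le_max_left _ _, by
      rw [coneDist_zero_left le_rfl, coneDist_zero_left hs, coneDist_zero_left hs, zero_add]⟩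
  by_cases h0' : s = 0
  · subst h0'
    exact ⟨0, le_rfl, le_max_right _ _, by
      rw [coneDist_zero_right le_rfl, coneDist_zero_right hr, coneDist_zero_right hr, add_zero]⟩
  rcases h.eq_or_lt with h1 | h1
  · exact ⟨0, le_rfl, le_max_of_le_left hr, by
      rw [coneDist_zero_left hs, coneDist_zero_right hr, coneDist_of_pi_le hr hs h1.ge]⟩
  rcases hφ.eq_or_lt with h2 | h2
  · subst h2
    exact ⟨r, hr, le_max_left _ _, by rw [coneDist_self, zero_add, zero_add]⟩
  have hr' : 0 < r := hr.lt_of_ne (Ne.symm h0)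
  have hs' : 0 < s := hs.lt_of_ne (Ne.symm h0')
  have s1 : 0 < r * Real.sin φ := mul_pos hr' (Real.sin_pos_of_pos_of_lt_pi h2 (by linarith))
  have s2 : 0 ≤ s * Real.sin ψ :=
    mul_nonneg hs (Real.sin_nonneg_of_nonneg_of_le_pi hψ (by linarith))
  have s3 : 0 ≤ Real.sin (φ + ψ) := Real.sin_nonneg_of_nonneg_of_le_pi (by positivity) h
  set D := r * Real.sin φ + s * Real.sin ψ with hD
  have hDpos : 0 < D := by positivity
  set ρ := r * s * Real.sin (φ + ψ) / D with hρ
  have hρ0 : 0 ≤ ρ := by positivity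
  -- the ray at angle `φ` meets the segment at distance `ρ` from the apex
  have hseg : polar ρ φ ∈ segment ℝ (polar r 0) (polar s (φ + ψ)) := by
    refine ⟨s * Real.sin ψ / D, r * Real.sin φ / D, by positivity, by positivity, ?_, ?_⟩
    · rw [← add_div, add_comm, div_self hDpos.ne']
    · have h3 := Real.sin_sq_add_cos_sq φ
      apply Complex.ext
      · simp only [Complex.add_re, Complex.smul_re, polar_re, hρ, Real.cos_zero, smul_eq_mul]
        field_simp
        rw [Real.sin_add, Real.cos_add]
        linear_combination (-Real.sin ψ) * h3
      · simp only [Complex.add_im, Complex.smul_im, polar_im, hρ, Real.sin_zero, smul_eq_mul]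
        field_simp
        ring
  have h4 := dist_add_dist_of_mem_segment hseg
  simp only [dist_eq_norm] at h4
  refine ⟨ρ, hρ0, ?_, ?_⟩
  · have h5 := (convexOn_norm (E := ℂ) convex_univ).le_max_of_mem_segment (Set.mem_univ _)
      (Set.mem_univ _) hseg
    rwa [norm_polar hρ0, norm_polar hr, norm_polar hs] at h5
  · have e1 := coneDist_eq_norm r s (α := 0) (β := φ + ψ)
      (by rw [zero_sub, abs_neg, abs_of_nonneg (by positivity)]; exact h)
    have e2 := coneDist_eq_norm r ρ (α := 0) (β := φ)
      (by rw [zero_sub, abs_neg, abs_of_nonneg hφ]; linarith)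
    have e3 := coneDist_eq_norm ρ s (α := φ) (β := φ + ψ)
      (by rw [sub_add_cancel_left, abs_neg, abs_of_nonneg hψ]; linarith)
    rw [zero_sub, abs_neg, abs_of_nonneg (by positivity)] at e1
    rw [zero_sub, abs_neg, abs_of_nonneg hφ] at e2
    rw [sub_add_cancel_left, abs_neg, abs_of_nonneg hψ] at e3
    rw [e1, e2, e3, h4]

/-- A point of the sector spanned by `1` and `exp (ω * I)`, in polar coordinates. -/
theorem exists_polar_of_sector {ω U W : ℝ} (hω0 : 0 < ω) (hωπ : ω < π) (hU : 0 ≤ U) (hW : 0 ≤ W) :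
    ∃ ρ α : ℝ, 0 ≤ ρ ∧ 0 ≤ α ∧ α ≤ ω ∧ U * Real.sin ω = ρ * Real.sin (ω - α) ∧
      W * Real.sin ω = ρ * Real.sin α := by
  have hs := Real.sin_pos_of_pos_of_lt_pi hω0 hωπ
  set z : ℂ := ⟨U + W * Real.cos ω, W * Real.sin ω⟩ with hz
  have h1 : ‖z‖ * Real.cos z.arg = U + W * Real.cos ω := Complex.norm_mul_cos_arg z
  have h2 : ‖z‖ * Real.sin z.arg = W * Real.sin ω := Complex.norm_mul_sin_arg z
  by_cases hz0 : z = 0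
  · have hW0 : W = 0 := by
      have := congrArg Complex.im hz0
      simpa [hz, hs.ne'] using this
    have hU0 : U = 0 := by
      have := congrArg Complex.re hz0
      simpa [hz, hW0] using this
    exact ⟨0, 0, le_rfl, le_rfl, hω0.le, by simp [hU0], by simp [hW0]⟩
  have harg : 0 ≤ z.arg := Complex.arg_nonneg_iff.mpr (by simp only [hz]; positivity)
  have h3 : U * Real.sin ω = ‖z‖ * Real.sin (ω - z.arg) := by
    rw [Real.sin_sub]; linear_combination Real.cos ω * h2 - Real.sin ω * h1
  refine ⟨‖z‖, z.arg, norm_nonneg _, harg, ?_, h3, h2.symm⟩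
  by_contra hlt
  have h4 : Real.sin (ω - z.arg) < 0 :=
    Real.sin_neg_of_neg_of_neg_pi_lt (by linarith) (by linarith [Complex.arg_le_pi z])
  have h5 := mul_neg_of_pos_of_neg (norm_pos_iff.mpr hz0) h4
  have : 0 ≤ U * Real.sin ω := by positivity
  linarith

/-! ### Homotopies of great circles -/

theorem inner_self_S2 (x : S2) : ⟪(x : E3), (x : E3)⟫ = 1 := by
  rw [real_inner_self_eq_norm_sq, norm_eq_of_mem_sphere, one_pow]

/-- The point of the sphere in the direction of a nonzero vector. -/
def direction (y : E3) (hy : y ≠ 0) : S2 :=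
  ⟨‖y‖⁻¹ • y, by simp [norm_smul, inv_mul_cancel₀ (norm_ne_zero_iff.mpr hy)]⟩

theorem direction_coe (y : E3) (hy : y ≠ 0) : (direction y hy : E3) = ‖y‖⁻¹ • y := rfl

/-- A unit vector orthogonal to `n` and `e`. -/
def quarterTurn (n e : E3) : E3 := ‖n‖⁻¹ • cr n e

theorem inner_quarterTurn_self {n e : E3} (hn : n ≠ 0) (he : ⟪e, e⟫ = 1) (hne : ⟪n, e⟫ = 0) :
    ⟪quarterTurn n e, quarterTurn n e⟫ = 1 := by
  rw [quarterTurn, real_inner_smul_left, real_inner_smul_right, inner_cr_cr, hne, he,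
    real_inner_self_eq_norm_sq]
  have := norm_ne_zero_iff.mpr hn
  field_simp; simp

theorem inner_quarterTurn_left (n e : E3) : ⟪n, quarterTurn n e⟫ = 0 := by
  rw [quarterTurn, real_inner_smul_right, real_inner_comm, inner_cr, det3_self_left, mul_zero]

theorem inner_quarterTurn_right (n e : E3) : ⟪e, quarterTurn n e⟫ = 0 := by
  rw [quarterTurn, real_inner_smul_right, real_inner_comm, inner_cr, det3_self_right, mul_zero]

/-- The point at the angle `z` of the great circle with normal vector `n`, starting at `e`. -/
def circlePoint (n e : E3) (z : Circle) : E3 := (z : ℂ).re • e + (z : ℂ).im • quarterTurn n e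

theorem circle_re_sq_add_im_sq (z : Circle) : (z : ℂ).re ^ 2 + (z : ℂ).im ^ 2 = 1 := by
  have := Circle.normSq_coe z
  rw [Complex.normSq_apply] at this
  linarith

theorem norm_circlePoint {n e : E3} (hn : n ≠ 0) (he : ⟪e, e⟫ = 1) (hne : ⟪n, e⟫ = 0) (z : Circle) :
    ‖circlePoint n e z‖ = 1 := by
  have h : ⟪circlePoint n e z, circlePoint n e z⟫ = 1 := by
    have h1 := inner_quarterTurn_right n e
    have h2 : ⟪quarterTurn n e, e⟫ = 0 := by rw [real_inner_comm, h1]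
    simp only [circlePoint, inner_add_left, inner_add_right, real_inner_smul_left,
      real_inner_smul_right, he, h1, h2, inner_quarterTurn_self hn he hne]
    linarith [circle_re_sq_add_im_sq z]
  rw [real_inner_self_eq_norm_sq] at h
  nlinarith [norm_nonneg (circlePoint n e z)]

theorem inner_circlePoint {n e : E3} (hne : ⟪n, e⟫ = 0) (z : Circle) :
    ⟪n, circlePoint n e z⟫ = 0 := by
  simp [circlePoint, inner_add_right, real_inner_smul_right, hne, inner_quarterTurn_left]

theorem circlePoint_injective {n e : E3} (hn : n ≠ 0) (he : ⟪e, e⟫ = 1) (hne : ⟪n, e⟫ = 0) :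
    Function.Injective (circlePoint n e) := by
  intro z w h
  have h1 := inner_quarterTurn_right n e
  have h2 : ⟪quarterTurn n e, e⟫ = 0 := by rw [real_inner_comm, h1]
  have e1 := congrArg (fun x => ⟪e, x⟫) h
  have e2 := congrArg (fun x => ⟪quarterTurn n e, x⟫) h
  simp only [circlePoint, inner_add_right, real_inner_smul_right, he, h1, h2,
    inner_quarterTurn_self hn he hne, mul_one, mul_zero, add_zero, zero_add] at e1 e2
  exact Circle.ext (Complex.ext e1 e2)

theorem exists_circlePoint_eq {n e : E3} (hn : n ≠ 0) (he : ⟪e, e⟫ = 1) (hne : ⟪n, e⟫ = 0)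
    {x : E3} (hx : ⟪x, x⟫ = 1) (hnx : ⟪n, x⟫ = 0) : ∃ z : Circle, circlePoint n e z = x := by
  set q := quarterTurn n e with hq
  have hqq : ⟪q, q⟫ = 1 := inner_quarterTurn_self hn he hne
  have h1 : ⟪e, q⟫ = 0 := inner_quarterTurn_right n e
  have h1' : ⟪q, e⟫ = 0 := by rw [real_inner_comm, h1]
  have h2 : ⟪n, q⟫ = 0 := inner_quarterTurn_left n e
  set y := x - ⟪e, x⟫ • e - ⟪q, x⟫ • q with hy
  have hny : ⟪n, y⟫ = 0 := by
    simp only [hy, inner_sub_right, real_inner_smul_right, hnx, hne, h2]; ring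
  have hey : ⟪e, y⟫ = 0 := by
    simp only [hy, inner_sub_right, real_inner_smul_right, he, h1]; ring
  have hqy : ⟪q, y⟫ = 0 := by
    simp only [hy, inner_sub_right, real_inner_smul_right, hqq, h1']; ring
  have hcr : cr n e = ‖n‖ • q := by
    rw [hq, quarterTurn, smul_smul, mul_inv_cancel₀ (norm_ne_zero_iff.mpr hn), one_smul]
  have hy0 : y = 0 := by
    have h3 := smul_eq_of_orthogonal hny hey
    rw [hcr, real_inner_smul_left, real_inner_smul_left, hqy, real_inner_smul_right, hqq] at h3
    simpa [hn] using h3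
  have hx' : x = ⟪e, x⟫ • e + ⟪q, x⟫ • q := by
    have := sub_eq_zero.mp (sub_sub x _ _ ▸ hy ▸ hy0)
    exact this
  have hnorm : ⟪e, x⟫ ^ 2 + ⟪q, x⟫ ^ 2 = 1 := by
    rw [← hx]
    nth_rewrite 4 [hx']
    simp only [inner_add_right, real_inner_smul_right, real_inner_comm x e, real_inner_comm x q]
    ring
  refine ⟨⟨⟨⟪e, x⟫, ⟪q, x⟫⟩, ?_⟩, hx'.symm⟩
  refine mem_sphere_zero_iff_norm.mpr ?_
  rw [norm_eq_sqrt_re_im]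
  simp [hnorm]

/-- Great circles that separate the labeled vertices in the same way are homotopic: turn one
into the other through the two lunes without labeled vertices. -/
theorem LabeledSphere.homotopicLoops_of_inner_mul_inner_pos {N : ℕ} (V : LabeledSphere N) {u w : S2}
    (huw : cr u w ≠ 0) (h : ∀ k b, 0 < ⟪(u : E3), V.vertex k b⟫ * ⟪(w : E3), V.vertex k b⟫) :
    V.HomotopicLoops (greatCircle u) (greatCircle w) := by
  obtain ⟨e, he_def⟩ : ∃ e : E3, e = (direction _ huw : S2) := ⟨_, rfl⟩
  have he : ⟪e, e⟫ = 1 := by rw [he_def]; exact inner_self_S2 _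
  -- all great circles of the homotopy pass through `e`; their normal vectors are `nt`
  let nt : unitInterval → E3 := fun t => (1 - (t : ℝ)) • (u : E3) + (t : ℝ) • (w : E3)
  have hnt : ∀ t, nt t ≠ 0 := by
    intro t h0
    have e1 : cr (nt t) w = (1 - (t : ℝ)) • cr u w := by
      apply E3.ext' <;> simp [nt, cr_zero, cr_one, cr_two] <;> ring
    have e2 : cr u (nt t) = (t : ℝ) • cr u w := by
      apply E3.ext' <;> simp [nt, cr_zero, cr_one, cr_two] <;> ring
    have z1 : cr 0 (w : E3) = 0 := by apply E3.ext' <;> simp [cr_zero, cr_one, cr_two]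
    have z2 : cr (u : E3) 0 = 0 := by apply E3.ext' <;> simp [cr_zero, cr_one, cr_two]
    rw [h0, z1] at e1
    rw [h0, z2] at e2
    have f1 := (smul_eq_zero.mp e1.symm).resolve_right huw
    have f2 := (smul_eq_zero.mp e2.symm).resolve_right huw
    linarith
  have hne : ∀ t, ⟪nt t, e⟫ = 0 := by
    intro t
    have z1 : ⟪(u : E3), cr u w⟫ = 0 := by rw [real_inner_comm, inner_cr, det3_self_left]
    have z2 : ⟪(w : E3), cr u w⟫ = 0 := by rw [real_inner_comm, inner_cr, det3_self_right]
    simp only [nt, he_def, direction_coe, real_inner_smul_right, inner_add_left,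
      real_inner_smul_left, z1, z2]
    ring
  have hnv : ∀ t k b, ⟪nt t, V.vertex k b⟫ ≠ 0 := by
    intro t k b h0
    simp only [nt, inner_add_left, real_inner_smul_left] at h0
    have h1 := h k b
    have t0 : (0 : ℝ) ≤ t := t.2.1
    have t1 : (t : ℝ) ≤ 1 := t.2.2
    rcases pos_and_pos_or_neg_and_neg_of_mul_pos h1 with ⟨a, c⟩ | ⟨a, c⟩
    · rcases t0.eq_or_lt with h2 | h2
      · rw [← h2] at h0; linarith
      · have := mul_pos h2 c
        have := mul_nonneg (sub_nonneg.mpr t1) a.le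
        linarith
    · rcases t0.eq_or_lt with h2 | h2
      · rw [← h2] at h0; linarith
      · have := mul_neg_of_pos_of_neg h2 c
        have := mul_nonpos_of_nonneg_of_nonpos (sub_nonneg.mpr t1) a.le
        linarith
  have hcr_cont : Continuous fun t => cr (nt t) e := by
    have hc : ∀ i, Continuous fun t => nt t i := fun i => by
      simp only [nt, PiLp.add_apply, PiLp.smul_apply, smul_eq_mul]; fun_prop
    have h0 := hc 0
    have h1 := hc 1
    have h2 := hc 2
    unfold cr
    refine (PiLp.continuous_toLp 2 _).comp (continuous_pi fun i => ?_)
    fin_cases i <;> simp <;> fun_prop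
  let H : C(unitInterval × Circle, V.Punctured) :=
    { toFun := fun x => ⟨⟨circlePoint (nt x.1) e x.2, by
          rw [mem_sphere_zero_iff_norm]; exact norm_circlePoint (hnt _) he (hne _) _⟩,
        fun k b h0 => hnv x.1 k b (by
          rw [← h0]; exact inner_circlePoint (hne _) _)⟩
      continuous_toFun := by
        refine Continuous.subtype_mk (Continuous.subtype_mk ?_ _) _
        have hnc : Continuous nt := by simp only [nt]; fun_prop
        have hq : Continuous fun t => quarterTurn (nt t) e :=
          (hnc.norm.inv₀ fun t => norm_ne_zero_iff.mpr (hnt t)).smul hcr_cont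
        have hre : Continuous fun x : unitInterval × Circle => (x.2 : ℂ).re := by fun_prop
        have him : Continuous fun x : unitInterval × Circle => (x.2 : ℂ).im := by fun_prop
        exact (hre.smul continuous_const).add (him.smul (hq.comp continuous_fst)) }
  have hinj : ∀ t, Function.Injective fun z => H (t, z) := fun t z z' hz =>
    circlePoint_injective (hnt t) he (hne t)
      (congrArg (fun x : V.Punctured => ((x : S2) : E3)) hz)
  have hrange : ∀ t, ∀ x : S2, x ∈ Set.range (fun z => ((H (t, z) : V.Punctured) : S2)) ↔
      ⟪nt t, x⟫ = 0 := by
    intro t x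
    constructor
    · rintro ⟨z, rfl⟩
      exact inner_circlePoint (hne t) z
    · intro hx
      obtain ⟨z, hz⟩ := exists_circlePoint_eq (hnt t) he (hne t) (inner_self_S2 x) hx
      exact ⟨z, Subtype.ext hz⟩
  refine ⟨⟨fun z => H (0, z), by fun_prop⟩, ⟨fun z => H (1, z), by fun_prop⟩, hinj 0, hinj 1, ?_, ?_,
    ⟨⟨H, fun _ => rfl, fun _ => rfl⟩⟩⟩
  · ext x
    refine (hrange 0 x).trans ?_
    simp [nt, greatCircle]
  · ext x
    refine (hrange 1 x).trans ?_
    simp [nt, greatCircle]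

/-! ### The angles of the parallelograms -/

/-- Half the sum of the cone-deficits of those `k` for which `k⁺` is on the positive side of one
and on the negative side of the other of the planes with normal vectors `u` and `w`; then so is
`k⁻`. It is the angle of a parallelogram at the corner on the positive sides of both loops. -/
def LabeledSphere.sepAngle {N : ℕ} (V : LabeledSphere N) (δ : Fin N → ℝ) (u w : E3) : ℝ :=
  (1 / 2) * ∑ k, if 0 < ⟪u, V.vertex k true⟫ * ⟪w, V.vertex k true⟫ then 0 else δ k

namespace LabeledSphere

variable {N : ℕ} (V : LabeledSphere N) (δ : Fin N → ℝ)

theorem vertex_false (k : Fin N) : (V.vertex k false : E3) = -(V.vertex k true : E3) := by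
  have := V.antipodal k true
  rw [Bool.not_true] at this
  rw [this]; rfl

theorem vertex_not (k : Fin N) (b : Bool) : (V.vertex k (!b) : E3) = -(V.vertex k b : E3) := by
  rw [V.antipodal]; rfl

theorem sepAngle_comm (u w : E3) : V.sepAngle δ u w = V.sepAngle δ w u := by
  simp only [sepAngle, mul_comm]

theorem sepAngle_neg_left (hsum : ∑ k, δ k = 2 * π) {u w : E3}
    (h : ∀ k, ⟪u, V.vertex k true⟫ * ⟪w, V.vertex k true⟫ ≠ 0) :
    V.sepAngle δ (-u) w = π - V.sepAngle δ u w := by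
  have h1 : V.sepAngle δ (-u) w + V.sepAngle δ u w = (1 / 2) * ∑ k, δ k := by
    rw [sepAngle, sepAngle, ← mul_add, ← Finset.sum_add_distrib]
    congr 1
    refine Finset.sum_congr rfl fun k _ => ?_
    rw [inner_neg_left, neg_mul]
    rcases lt_or_gt_of_ne (h k) with h2 | h2
    · rw [if_pos (by linarith), if_neg (by linarith), zero_add]
    · rw [if_neg (by linarith), if_pos h2, add_zero]
  rw [hsum] at h1
  linarith

theorem sepAngle_pos {δ : Fin N → ℝ} (hδ : ∀ k, 0 < δ k) {u w : E3} {k : Fin N}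
    (h : ⟪u, V.vertex k true⟫ * ⟪w, V.vertex k true⟫ < 0) : 0 < V.sepAngle δ u w := by
  refine mul_pos (by norm_num) (Finset.sum_pos' (fun i _ => ?_) ⟨k, Finset.mem_univ k, ?_⟩)
  · split_ifs
    exacts [le_rfl, (hδ i).le]
  · rw [if_neg h.not_gt]; exact hδ k

end LabeledSphere

namespace LoopArrangement

variable {N n : ℕ} {V : LabeledSphere N} (A : LoopArrangement V n)

/-- The normal vector of a loop, as a vector in three-space. -/
def nv (i : Fin n) : E3 := (A.normal i : E3)

theorem nv_def (i : Fin n) : A.nv i = (A.normal i : E3) := rfl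

theorem mem_greatCircle (i : Fin n) (x : S2) : x ∈ greatCircle (A.normal i) ↔ ⟪A.nv i, x⟫ = 0 :=
  Iff.rfl

theorem code_apply (x : S2) (i : Fin n) : A.code x i = Real.sign ⟪A.nv i, x⟫ := rfl

theorem inner_vertex_ne_zero (i : Fin n) (k : Fin N) (b : Bool) : ⟪A.nv i, V.vertex k b⟫ ≠ 0 :=
  A.avoids i k b

theorem inGeneralPosition : InGeneralPosition A.nv := by
  intro i j k hij hjk hik y hi hj hk
  by_contra hy
  have : direction y hy ∈ greatCircle (A.normal i) ∩ greatCircle (A.normal j) ∩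
      greatCircle (A.normal k) := by
    refine ⟨⟨?_, ?_⟩, ?_⟩ <;>
      rw [mem_greatCircle, direction_coe, real_inner_smul_right] <;> simp [*]
  rw [A.nonconcurrent i j k hij hjk hik] at this
  exact this

theorem greatCircle_neg (u : S2) : greatCircle (-u) = greatCircle u := by
  ext x
  simp [greatCircle]

/-- Since the loops are not homotopic, each of the four lunes of two loops contains a labeled
vertex. -/
theorem exists_separated (hn : 3 ≤ n) {i j : Fin n} (hij : i ≠ j) :
    (∃ k, ⟪A.nv i, V.vertex k true⟫ * ⟪A.nv j, V.vertex k true⟫ < 0) ∧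
      ∃ k, 0 < ⟪A.nv i, V.vertex k true⟫ * ⟪A.nv j, V.vertex k true⟫ := by
  have hcr : cr (A.nv i) (A.nv j) ≠ 0 :=
    A.inGeneralPosition.cr_ne_zero (by simpa using hn) hij
  have hne : ∀ k, ⟪A.nv i, V.vertex k true⟫ * ⟪A.nv j, V.vertex k true⟫ ≠ 0 := fun k =>
    mul_ne_zero (A.inner_vertex_ne_zero i k true) (A.inner_vertex_ne_zero j k true)
  constructor
  · by_contra! h
    refine A.nonhomotopic i j hij (V.homotopicLoops_of_inner_mul_inner_pos hcr fun k b => ?_)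
    have h1 := (h k).lt_of_ne (hne k).symm
    cases b
    · rw [V.vertex_false, inner_neg_right, inner_neg_right, neg_mul_neg]; exact h1
    · exact h1
  · by_contra! h
    refine A.nonhomotopic i j hij ?_
    rw [← greatCircle_neg (A.normal j)]
    refine V.homotopicLoops_of_inner_mul_inner_pos (u := A.normal i) (w := -A.normal j)
      (fun h0 => hcr ?_) fun k b => ?_
    · have h2 := cr_smul_smul 1 (-1) (A.normal i : E3) (A.normal j)
      rw [one_smul, neg_one_smul, one_mul] at h2
      have h3 : cr (A.normal i : E3) (-(A.normal j : E3)) = 0 := h0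
      rw [h3] at h2
      exact neg_eq_zero.mp (by rw [← neg_one_smul ℝ]; exact h2.symm)
    · have h1 := (h k).lt_of_ne (hne k)
      have e : ((-A.normal j : S2) : E3) = -(A.normal j : E3) := rfl
      rw [e, inner_neg_left, mul_neg]
      cases b
      · rw [V.vertex_false, inner_neg_right, inner_neg_right, neg_mul_neg]; exact neg_pos.mpr h1
      · exact neg_pos.mpr h1

/-- The angle of a parallelogram at the corner on the positive sides of its loops. -/
theorem cornerAngle_eq_sepAngle (δ : Fin N → ℝ) (hsum : ∑ k, δ k = 2 * π) (i j : Fin n) :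
    A.cornerAngle δ i j true true = V.sepAngle δ (A.nv i) (A.nv j) := by
  classical
  have h : (∑ v : Fin N × Bool, Set.indicator
      {v : Fin N × Bool | V.vertex v.1 v.2 ∈ A.lune i j true true} (fun v => δ v.1) v) +
      ∑ k, (if 0 < ⟪A.nv i, V.vertex k true⟫ * ⟪A.nv j, V.vertex k true⟫ then 0 else δ k) =
      2 * π := by
    rw [Fintype.sum_prod_type, ← Finset.sum_add_distrib, ← hsum]
    refine Finset.sum_congr rfl fun k _ => ?_
    have hi := A.inner_vertex_ne_zero i k true
    have hj := A.inner_vertex_ne_zero j k true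
    simp only [Fintype.sum_bool, Set.indicator_apply, Set.mem_ofPred_eq, lune, sgn, if_true,
      V.vertex_false, inner_neg_right, one_mul, ← A.nv_def]
    rcases lt_or_gt_of_ne hi with h1 | h1 <;> rcases lt_or_gt_of_ne hj with h2 | h2
    · have := mul_pos_of_neg_of_neg h1 h2
      simp [h1, h2, h1.not_gt, this]
    · have := mul_neg_of_neg_of_pos h1 h2
      simp [h1, h2, h1.not_gt, h2.not_gt, this.not_gt]
    · have := mul_neg_of_pos_of_neg h1 h2
      simp [h1, h2, h1.not_gt, h2.not_gt, this.not_gt]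
    · have := mul_pos h1 h2
      simp [h1, h2, h1.not_gt, this]
  rw [cornerAngle, LabeledSphere.sepAngle]
  linarith

/-- The angle at the corner of a parallelogram on the sides of the loops `i` and `j` that are given
by the signs `s` and `t`. -/
theorem sepAngle_sign {δ : Fin N → ℝ} (hδ : ∀ k, 0 < δ k) (hsum : ∑ k, δ k = 2 * π) (hn : 3 ≤ n)
    {i j : Fin n} (hij : i ≠ j) {s t : ℝ} (hs : s = 1 ∨ s = -1) (ht : t = 1 ∨ t = -1) :
    0 < V.sepAngle δ (s • A.nv i) (t • A.nv j) ∧ V.sepAngle δ (s • A.nv i) (t • A.nv j) < π ∧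
      Real.cos (V.sepAngle δ (s • A.nv i) (t • A.nv j)) =
        s * t * Real.cos (V.sepAngle δ (A.nv i) (A.nv j)) := by
  have hne : ∀ k, ⟪A.nv i, V.vertex k true⟫ * ⟪A.nv j, V.vertex k true⟫ ≠ 0 := fun k =>
    mul_ne_zero (A.inner_vertex_ne_zero i k true) (A.inner_vertex_ne_zero j k true)
  have e1 : V.sepAngle δ (-A.nv i) (A.nv j) = π - V.sepAngle δ (A.nv i) (A.nv j) :=
    V.sepAngle_neg_left δ hsum hne
  have e2 : V.sepAngle δ (A.nv i) (-A.nv j) = π - V.sepAngle δ (A.nv i) (A.nv j) := by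
    rw [V.sepAngle_comm, V.sepAngle_neg_left δ hsum (fun k => by rw [mul_comm]; exact hne k),
      V.sepAngle_comm]
  have e3 : V.sepAngle δ (-A.nv i) (-A.nv j) = V.sepAngle δ (A.nv i) (A.nv j) := by
    simp only [LabeledSphere.sepAngle, inner_neg_left, neg_mul_neg]
  obtain ⟨⟨k, hk⟩, l, hl⟩ := A.exists_separated hn hij
  have h1 := V.sepAngle_pos hδ hk
  have h2 : 0 < V.sepAngle δ (-A.nv i) (A.nv j) :=
    V.sepAngle_pos hδ (k := l) (by rw [inner_neg_left]; linarith)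
  rw [e1] at h2
  rcases hs with rfl | rfl <;> rcases ht with rfl | rfl <;>
    simp only [one_smul, neg_one_smul, e1, e2, e3, Real.cos_pi_sub] <;>
    refine ⟨by linarith, by linarith, by ring⟩

/-! ### Faces with at most one labeled vertex -/

theorem code_vertex_not (k : Fin N) (b : Bool) (i : Fin n) :
    A.code (V.vertex k (!b)) i = -A.code (V.vertex k b) i := by
  rw [code_apply, V.vertex_not, inner_neg_right, Real.sign_neg, code_apply]

theorem sign_eq_iff {a b : ℝ} (ha : a ≠ 0) (hb : b ≠ 0) : Real.sign a = Real.sign b ↔ 0 < a * b := by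
  rcases lt_or_gt_of_ne ha with h1 | h1 <;> rcases lt_or_gt_of_ne hb with h2 | h2
  · simp [Real.sign_of_neg, h1, h2, mul_pos_of_neg_of_neg]
  · simp only [Real.sign_of_neg h1, Real.sign_of_pos h2]
    have := mul_neg_of_neg_of_pos h1 h2
    constructor <;> intro h <;> linarith
  · simp only [Real.sign_of_neg h2, Real.sign_of_pos h1]
    have := mul_neg_of_pos_of_neg h1 h2
    constructor <;> intro h <;> linarith
  · simp [Real.sign_of_pos, h1, h2]

/-- For `N ≤ 5`, no two labeled vertices lie in the same face: otherwise the loops would divide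
`N - 1` pairs of vertices in `2 * N - 2` different ways. For `N = 5` these were all ways, but a
linear dependency between four vectors in three-space excludes one. -/
theorem separating_of_le_five (A : LoopArrangement V (2 * N - 2)) (hN : 3 ≤ N) (hN5 : N ≤ 5) :
    A.Separating := by
  classical
  rintro ⟨k, b⟩ ⟨l, c⟩ hcode
  simp only at hcode
  by_contra hne
  have hkl : k ≠ l := by
    rintro rfl
    have hbc : c = !b := by
      cases b <;> cases c <;> simp_all
    have h0 := congrFun hcode ⟨0, by omega⟩
    rw [hbc, code_vertex_not, code_apply] at h0
    have h1 : Real.sign ⟪A.nv ⟨0, by omega⟩, V.vertex k b⟫ = 0 := by linarith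
    exact A.inner_vertex_ne_zero _ k b (Real.sign_eq_zero_iff.mp h1)
  -- one vector for each pair of vertices
  let q : Fin N → E3 := fun h => if h = k then V.vertex k b else V.vertex h true
  have hq : ∀ h, q h = V.vertex h true ∨ q h = -(V.vertex h true : E3) := by
    intro h
    by_cases hh : h = k
    · subst hh
      simp only [q, if_true]
      cases b
      · right; exact V.vertex_false h
      · left; rfl
    · simp [q, hh]
  have hqne : ∀ i h, ⟪A.nv i, q h⟫ ≠ 0 := by
    intro i h
    have := A.inner_vertex_ne_zero i h true
    rcases hq h with h1 | h1 <;> rw [h1]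
    · exact this
    · rwa [inner_neg_right, neg_ne_zero]
  have hqmul : ∀ i j h, ⟪A.nv i, q h⟫ * ⟪A.nv j, q h⟫ =
      ⟪A.nv i, V.vertex h true⟫ * ⟪A.nv j, V.vertex h true⟫ := by
    intro i j h
    rcases hq h with h1 | h1 <;> rw [h1]
    rw [inner_neg_right, inner_neg_right, neg_mul_neg]
  let τ : Fin (2 * N - 2) → ({h : Fin N // h ≠ k ∧ h ≠ l} → Bool) := fun i h =>
    decide (0 < ⟪A.nv i, q h⟫ * ⟪A.nv i, q k⟫)
  have hτ : ∀ i h (hh : h ≠ k ∧ h ≠ l), τ i ⟨h, hh⟩ = true ↔ 0 < ⟪A.nv i, q h⟫ * ⟪A.nv i, q k⟫ := by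
    intro i h hh; simp [τ]
  have hl : ∀ i, 0 < ⟪A.nv i, q k⟫ * ⟪A.nv i, V.vertex l c⟫ := by
    intro i
    have h1 := congrFun hcode i
    rw [code_apply, code_apply, sign_eq_iff (A.inner_vertex_ne_zero _ _ _)
      (A.inner_vertex_ne_zero _ _ _)] at h1
    simpa [q] using h1
  have hτinj : Function.Injective τ := by
    intro i j hij
    by_contra hne
    obtain ⟨⟨h₁, hh₁⟩, h₂, hh₂⟩ := A.exists_separated (by omega) hne
    -- relative to the sides of `k`, both loops have every vertex on the same side
    have key : ∀ h, 0 < (⟪A.nv i, q k⟫ * ⟪A.nv j, q k⟫) *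
        (⟪A.nv i, V.vertex h true⟫ * ⟪A.nv j, V.vertex h true⟫) := by
      intro h
      have hki := hqne i k
      have hkj := hqne j k
      rw [← hqmul i j h]
      by_cases h1 : h = k
      · subst h1
        exact mul_self_pos.mpr (mul_ne_zero hki hkj)
      by_cases h2 : h = l
      · subst h2
        rw [hqmul i j h]
        have a1 := mul_pos (hl i) (hl j)
        cases c
        · rw [V.vertex_false, inner_neg_right, inner_neg_right] at a1
          linarith
        · linarith
      · have h3 := congrFun hij ⟨h, h1, h2⟩
        have h4 := hτ i h ⟨h1, h2⟩
        have h5 := hτ j h ⟨h1, h2⟩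
        rw [h3, h5] at h4
        have a1 := mul_ne_zero (hqne i h) hki
        have a2 := mul_ne_zero (hqne j h) hkj
        rcases lt_or_gt_of_ne a1 with a3 | a3
        · have a4 : ⟪A.nv j, q h⟫ * ⟪A.nv j, q k⟫ < 0 := by
            refine lt_of_le_of_ne ?_ a2
            by_contra hc
            have := h4.mp (not_le.mp hc)
            linarith
          linarith [mul_pos_of_neg_of_neg a3 a4]
        · linarith [mul_pos a3 (h4.mpr a3)]
    have k1 := key h₁
    have k2 := key h₂
    have := pos_of_mul_pos_left k2 hh₂.le
    have := mul_neg_of_pos_of_neg this hh₁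
    linarith
  -- the loops divide the remaining pairs in pairwise different ways
  have hcardT : Fintype.card {h : Fin N // h ≠ k ∧ h ≠ l} = N - 2 := by
    have : (Finset.univ.filter fun h : Fin N => h ≠ k ∧ h ≠ l) =
        (Finset.univ.erase k).erase l := by ext h; simp [and_comm]
    rw [Fintype.card_subtype, this, Finset.card_erase_of_mem (by simp [hkl.symm]),
      Finset.card_erase_of_mem (by simp), Finset.card_univ, Fintype.card_fin]
    omega
  have hcard := Fintype.card_le_of_injective τ hτinj
  rw [Fintype.card_fin, Fintype.card_fun, hcardT, Fintype.card_bool] at hcard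
  obtain rfl : N = 5 := by
    by_contra h5
    have : N = 3 ∨ N = 4 := by omega
    rcases this with rfl | rfl <;> norm_num at hcard
  have hbij : Function.Bijective τ := (Fintype.bijective_iff_injective_and_card τ).mpr
    ⟨hτinj, by rw [Fintype.card_fin, Fintype.card_fun, hcardT, Fintype.card_bool]; norm_num⟩
  have hdep : ¬ LinearIndependent ℝ fun h : {h : Fin 5 // h ≠ l} => q h := by
    intro h
    have h1 := h.fintype_card_le_finrank
    rw [finrank_euclideanSpace_fin, Fintype.card_subtype_compl, Fintype.card_fin,
      Fintype.card_subtype_eq] at h1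
    norm_num at h1
  obtain ⟨g, hg, h₀, hg0⟩ := Fintype.not_linearIndependent_iff.mp hdep
  let k₀ : {h : Fin 5 // h ≠ l} := ⟨k, hkl⟩
  obtain ⟨i, hi⟩ := hbij.surjective fun h => decide (0 ≤ g ⟨h, h.2.2⟩ ↔ 0 ≤ g k₀)
  -- for the loop `i`, all terms of the dependency have the same sign
  set c : ℝ := (if 0 ≤ g k₀ then 1 else -1) * ⟪A.nv i, q k⟫ with hc
  have hterm : ∀ h : {h : Fin 5 // h ≠ l}, g h ≠ 0 → 0 < g h * ⟪A.nv i, q h⟫ * c := by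
    rintro ⟨h, hhl⟩ hgh
    have hk2 : 0 < ⟪A.nv i, q k⟫ * ⟪A.nv i, q k⟫ := mul_self_pos.mpr (hqne i k)
    have hk3 : ⟪A.nv i, q h⟫ * ⟪A.nv i, q k⟫ ≠ 0 := mul_ne_zero (hqne i h) (hqne i k)
    have hiff : 0 < ⟪A.nv i, q h⟫ * ⟪A.nv i, q k⟫ ↔ (0 ≤ g ⟨h, hhl⟩ ↔ 0 ≤ g k₀) := by
      by_cases h1 : h = k
      · subst h1
        exact ⟨fun _ => Iff.rfl, fun _ => hk2⟩
      · rw [← hτ i h ⟨h1, hhl⟩, hi, decide_eq_true_iff]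
    have e : g ⟨h, hhl⟩ * ⟪A.nv i, q h⟫ * c = (g ⟨h, hhl⟩ * (if 0 ≤ g k₀ then 1 else -1)) *
        (⟪A.nv i, q h⟫ * ⟪A.nv i, q k⟫) := by rw [hc]; ring
    rw [e]
    rcases lt_or_gt_of_ne hgh with h1 | h1 <;> by_cases h2 : 0 ≤ g k₀
    · rw [if_pos h2, mul_one]
      refine mul_pos_of_neg_of_neg h1 (lt_of_le_of_ne (not_lt.mp fun h3 => ?_) hk3)
      exact h1.not_ge ((hiff.mp h3).mpr h2)
    · rw [if_neg h2]
      exact mul_pos (by linarith) (hiff.mpr ⟨fun h3 => absurd h3 h1.not_ge, fun h3 => absurd h3 h2⟩)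
    · rw [if_pos h2, mul_one]
      exact mul_pos h1 (hiff.mpr ⟨fun _ => h2, fun _ => h1.le⟩)
    · rw [if_neg h2]
      refine mul_pos_of_neg_of_neg (by linarith) (lt_of_le_of_ne (not_lt.mp fun h3 => ?_) hk3)
      exact h2 ((hiff.mp h3).mp h1.le)
  have hsum0 : ∑ h, g h * ⟪A.nv i, q h⟫ * c = 0 := by
    have := congrArg (fun x => ⟪A.nv i, x⟫ * c) hg
    simpa only [inner_sum, real_inner_smul_right, inner_zero_right, zero_mul, Finset.sum_mul]
      using this
  have hpos : 0 < ∑ h, g h * ⟪A.nv i, q h⟫ * c :=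
    Finset.sum_pos' (fun h _ => by
      by_cases h1 : g h = 0
      · simp [h1]
      · exact (hterm h h1).le) ⟨h₀, Finset.mem_univ _, hterm h₀ hg0⟩
  exact hpos.ne' hsum0

end LoopArrangement

/-! ### Variation of paths -/

theorem eVariationOn_trans_le {X : Type*} [PseudoEMetricSpace X] {x y z : X} (γ : Path x y)
    (γ' : Path y z) :
    eVariationOn (γ.trans γ') Set.univ ≤ eVariationOn γ Set.univ + eVariationOn γ' Set.univ := by
  let h : unitInterval := ⟨1 / 2, by norm_num, by norm_num⟩
  have hu : (Set.univ : Set unitInterval) = Set.Iic h ∪ Set.Ici h := Set.Iic_union_Ici.symm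
  rw [hu, eVariationOn.union (γ.trans γ') isGreatest_Iic isLeast_Ici, ← hu]
  refine add_le_add ?_ ?_
  · let φ : unitInterval → unitInterval := fun t => Set.projIcc 0 1 zero_le_one (2 * (t : ℝ))
    have hφ : Monotone φ := fun s t hst =>
      Set.monotone_projIcc _ (by have : (s : ℝ) ≤ t := hst; linarith)
    refine le_trans (le_of_eq ?_)
      (eVariationOn.comp_le_of_monotoneOn γ φ (hφ.monotoneOn (Set.Iic h)) (Set.mapsTo_univ _ _))
    refine eVariationOn.eq_of_eqOn fun t ht => ?_
    have ht' : (t : ℝ) ≤ 1 / 2 := ht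
    rw [Path.trans_apply, dif_pos ht']
    simp only [Function.comp, φ]
    congr 1
    rw [Set.projIcc_of_mem]
  · let φ : unitInterval → unitInterval := fun t => Set.projIcc 0 1 zero_le_one (2 * (t : ℝ) - 1)
    have hφ : Monotone φ := fun s t hst =>
      Set.monotone_projIcc _ (by have : (s : ℝ) ≤ t := hst; linarith)
    refine le_trans (le_of_eq ?_)
      (eVariationOn.comp_le_of_monotoneOn γ' φ (hφ.monotoneOn (Set.Ici h)) (Set.mapsTo_univ _ _))
    refine eVariationOn.eq_of_eqOn fun t ht => ?_
    have ht' : 1 / 2 ≤ (t : ℝ) := ht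
    simp only [Function.comp, φ]
    rw [Path.trans_apply]
    split_ifs with h1
    · have h2 : (t : ℝ) = 1 / 2 := le_antisymm h1 ht'
      have e1 : (⟨2 * (t : ℝ), (unitInterval.mul_pos_mem_iff zero_lt_two).2 ⟨t.2.1, h1⟩⟩ :
          unitInterval) = 1 :=
        Subtype.ext (by simp [h2])
      rw [e1, γ.target, h2]
      norm_num
    · congr 1
      rw [Set.projIcc_of_mem]

theorem eVariationOn_le_of_edist_le {X : Type*} [PseudoEMetricSpace X] {x y : X} (γ : Path x y)
    (C : NNReal) (h : ∀ s t, edist (γ s) (γ t) ≤ C * edist s t) :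
    eVariationOn γ Set.univ ≤ C := by
  have h1 : LipschitzOnWith C γ Set.univ := fun s _ t _ => h s t
  have h2 := h1.comp_eVariationOn_le (g := id) (s := Set.univ) (Set.mapsTo_univ _ _)
  have h3 : eVariationOn (id : unitInterval → unitInterval) Set.univ =
      eVariationOn (Subtype.val : unitInterval → ℝ) Set.univ := by
    unfold eVariationOn; rfl
  have h4 := MonotoneOn.eVariationOn_eq (f := (Subtype.val : unitInterval → ℝ)) (s := Set.univ)
    (fun s _ t _ hst => hst) (Set.mem_univ 0) (Set.mem_univ 1)
  rw [show Set.univ ∩ Set.Icc (0 : unitInterval) 1 = Set.univ by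
    ext t; simp [unitInterval.le_one']] at h4
  calc eVariationOn γ Set.univ ≤ C * eVariationOn (id : unitInterval → unitInterval) Set.univ := h2
    _ ≤ C * 1 := by rw [h3]; gcongr; simpa using h4.le
    _ = C := mul_one _

/-! ### The metric of the glued surface -/

theorem norm_add_mul_exp (U W ω : ℝ) : ‖(U : ℂ) + W * Complex.exp (ω * Complex.I)‖ =
    √(U ^ 2 + W ^ 2 + 2 * U * W * Real.cos ω) := by
  have h1 := Real.sin_sq_add_cos_sq ω
  rw [norm_eq_sqrt_re_im]
  congr 1
  simp only [Complex.add_re, Complex.add_im, Complex.ofReal_re, Complex.ofReal_im,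
    Complex.re_ofReal_mul, Complex.im_ofReal_mul, Complex.exp_ofReal_mul_I_re,
    Complex.exp_ofReal_mul_I_im]
  linear_combination W ^ 2 * h1

namespace LoopArrangement

variable {N n : ℕ} {V : LabeledSphere N}

/-- The hypotheses on the data that determine a surface. -/
structure Admissible (A : LoopArrangement V n) (δ : Fin N → ℝ) (a : Fin n → ℝ) : Prop where
  three_le : 3 ≤ n
  deficit_pos : ∀ k, 0 < δ k
  sum_deficit : ∑ k, δ k = 2 * π
  length_pos : ∀ i, 0 < a i

/-- The length of the vector `w` in a parallelogram dual to a crossing of the loops `i` and `j`. -/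
def len (A : LoopArrangement V n) (δ : Fin N → ℝ) (a : Fin n → ℝ) (i j : Fin n)
    (w : Fin n → ℝ) : ℝ :=
  √((w i * a i / 2) ^ 2 + (w j * a j / 2) ^ 2 +
    2 * (w i * a i / 2) * (w j * a j / 2) * Real.cos (V.sepAngle δ (A.nv i) (A.nv j)))

/-- The distance of two points of the glued surface. -/
def gdist (A : LoopArrangement V n) (δ : Fin N → ℝ) (a : Fin n → ℝ) (x y : A.Points) : ℝ≥0∞ :=
  ⨅ ℓ : {ℓ : ℝ≥0∞ // A.Chain δ a x y ℓ}, ℓ.1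

variable {A : LoopArrangement V n} {δ : Fin N → ℝ} {a : Fin n → ℝ}

theorem len_nonneg (i j : Fin n) (w : Fin n → ℝ) : 0 ≤ A.len δ a i j w := Real.sqrt_nonneg _

theorem len_comm (i j : Fin n) (w : Fin n → ℝ) : A.len δ a i j w = A.len δ a j i w := by
  rw [len, len, V.sepAngle_comm]; congr 1; ring

theorem len_smul (i j : Fin n) {r : ℝ} (hr : 0 ≤ r) (w : Fin n → ℝ) :
    A.len δ a i j (r • w) = r * A.len δ a i j w := by
  rw [len, len, ← Real.sqrt_sq hr, ← Real.sqrt_mul (sq_nonneg r), Real.sqrt_sq hr]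
  congr 1
  simp only [Pi.smul_apply, smul_eq_mul]; ring

theorem len_neg (i j : Fin n) (w : Fin n → ℝ) : A.len δ a i j (-w) = A.len δ a i j w := by
  rw [len, len]; congr 1; simp only [Pi.neg_apply]; ring

theorem len_continuous (i j : Fin n) : Continuous (A.len δ a i j) := by
  unfold len; fun_prop

theorem len_zero (i j : Fin n) : A.len δ a i j 0 = 0 := by simp [len]

theorem edist_place (h : A.Admissible δ a) (c : A.Crossing) (x y : Fin n → ℝ) :
    edist (A.place δ a c x) (A.place δ a c y) = ENNReal.ofReal (A.len δ a c.i c.j (x - y)) := by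
  rw [edist_dist, dist_eq_norm, place, place, A.cornerAngle_eq_sepAngle δ h.sum_deficit, len,
    ← norm_add_mul_exp]
  congr 2
  simp only [Pi.sub_apply]
  push_cast; ring

theorem gdist_le_of_chain {x y : A.Points} {ℓ : ℝ≥0∞} (h : A.Chain δ a x y ℓ) :
    A.gdist δ a x y ≤ ℓ := iInf_le_of_le ⟨ℓ, h⟩ le_rfl

theorem le_gdist {x y : A.Points} {r : ℝ≥0∞} (h : ∀ ℓ, A.Chain δ a x y ℓ → r ≤ ℓ) :
    r ≤ A.gdist δ a x y := le_iInf fun ℓ => h ℓ.1 ℓ.2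

theorem gdist_comm (x y : A.Points) : A.gdist δ a x y = A.gdist δ a y x :=
  (A.gluedMetric δ a).edist_comm x y

theorem gdist_triangle (x y z : A.Points) :
    A.gdist δ a x z ≤ A.gdist δ a x y + A.gdist δ a y z := (A.gluedMetric δ a).edist_triangle x y z

theorem gdist_le_len (h : A.Admissible δ a) (c : A.Crossing) {x y : A.Points} (hx : x.1 ∈ A.quad c)
    (hy : y.1 ∈ A.quad c) :
    A.gdist δ a x y ≤ ENNReal.ofReal (A.len δ a c.i c.j (x.1 - y.1)) := by
  have := gdist_le_of_chain (δ := δ) (a := a) (Chain.cons c x y y 0 hx hy (Chain.nil y))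
  rwa [add_zero, edist_place h] at this

theorem code_eq_one_or {x : S2} {k : Fin n} (h : ⟪A.nv k, x⟫ ≠ 0) :
    A.code x k = 1 ∨ A.code x k = -1 := by
  rw [code_apply]
  rcases lt_or_gt_of_ne h with h1 | h1
  · right; exact Real.sign_of_neg h1
  · left; exact Real.sign_of_pos h1

theorem Crossing.inner_i (c : A.Crossing) : ⟪A.nv c.i, c.point⟫ = 0 := c.mem_i

theorem Crossing.inner_j (c : A.Crossing) : ⟪A.nv c.j, c.point⟫ = 0 := c.mem_j

theorem Crossing.inner_ne_zero (c : A.Crossing) {k : Fin n} (hi : k ≠ c.i) (hj : k ≠ c.j) :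
    ⟪A.nv k, c.point⟫ ≠ 0 := fun h0 => by
  have h1 := A.inGeneralPosition c.i c.j k c.ne hj.symm hi.symm c.point c.inner_i c.inner_j h0
  have h2 := inner_self_S2 c.point
  rw [h1, inner_zero_left] at h2
  exact zero_ne_one h2

theorem mem_Icc_of_mem_quad {c : A.Crossing} {t : Fin n → ℝ} (ht : t ∈ A.quad c) (k : Fin n) :
    t k ∈ Set.Icc (-1 : ℝ) 1 := by
  by_cases hi : k = c.i
  · rw [hi]; exact ht.1
  by_cases hj : k = c.j
  · rw [hj]; exact ht.2.1
  rw [ht.2.2 k hi hj]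
  rcases A.code_eq_one_or (c.inner_ne_zero hi hj) with h | h <;> rw [h] <;> norm_num

theorem eq_one_or_of_mem_quad {c : A.Crossing} {t : Fin n → ℝ} (ht : t ∈ A.quad c) {k : Fin n}
    (hi : k ≠ c.i) (hj : k ≠ c.j) : t k = 1 ∨ t k = -1 := by
  rw [ht.2.2 k hi hj]
  exact A.code_eq_one_or (c.inner_ne_zero hi hj)

theorem exists_pos_forall_le {ι : Type*} [Finite ι] {f : ι → ℝ} (hf : ∀ i, 0 < f i) :
    ∃ κ : ℝ, 0 < κ ∧ ∀ i, κ ≤ f i := by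
  rcases isEmpty_or_nonempty ι with h | h
  · exact ⟨1, one_pos, fun i => isEmptyElim i⟩
  · obtain ⟨i, hi⟩ := Finite.exists_min f
    exact ⟨f i, hf i, hi⟩

theorem mul_sin_le_len (h : A.Admissible δ a) {i j : Fin n} (hij : i ≠ j) (w : Fin n → ℝ) :
    |w i| * (a i / 2 * Real.sin (V.sepAngle δ (A.nv i) (A.nv j))) ≤ A.len δ a i j w := by
  have h1 := A.sepAngle_sign h.deficit_pos h.sum_deficit h.three_le hij (Or.inl rfl) (Or.inl rfl)
  simp only [one_smul] at h1
  have h2 := Real.sin_pos_of_pos_of_lt_pi h1.1 h1.2.1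
  have h3 := Real.sin_sq_add_cos_sq (V.sepAngle δ (A.nv i) (A.nv j))
  refine Real.le_sqrt_of_sq_le ?_
  rw [mul_pow, sq_abs, mul_pow]
  generalize Real.cos (V.sepAngle δ (A.nv i) (A.nv j)) = C at *
  generalize Real.sin (V.sepAngle δ (A.nv i) (A.nv j)) = S at *
  have h4 := sq_nonneg (w j * a j / 2 + w i * a i / 2 * C)
  have : S ^ 2 = 1 - C ^ 2 := by linarith
  rw [this]
  nlinarith

/-- In each parallelogram, lengths bound the differences of coordinates. -/
theorem exists_mul_dist_le_len (h : A.Admissible δ a) : ∃ κ : ℝ, 0 < κ ∧ ∀ (c : A.Crossing)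
    (x y : Fin n → ℝ), x ∈ A.quad c → y ∈ A.quad c → κ * dist x y ≤ A.len δ a c.i c.j (x - y) := by
  obtain ⟨κ, hκ, hle⟩ := exists_pos_forall_le
    (f := fun p : {p : Fin n × Fin n // p.1 ≠ p.2} =>
      a p.1.1 / 2 * Real.sin (V.sepAngle δ (A.nv p.1.1) (A.nv p.1.2))) (fun p => by
        have h1 := A.sepAngle_sign h.deficit_pos h.sum_deficit h.three_le p.2 (Or.inl rfl)
          (Or.inl rfl)
        simp only [one_smul] at h1
        exact mul_pos (half_pos (h.length_pos _)) (Real.sin_pos_of_pos_of_lt_pi h1.1 h1.2.1))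
  refine ⟨κ, hκ, fun c x y hx hy => ?_⟩
  rw [← le_div_iff₀' hκ]
  refine (dist_pi_le_iff (div_nonneg (len_nonneg _ _ _) hκ.le)).mpr fun k => ?_
  rw [le_div_iff₀' hκ, Real.dist_eq, ← Pi.sub_apply]
  by_cases hi : k = c.i
  · subst hi
    refine le_trans ?_ (mul_sin_le_len h c.ne (x - y))
    rw [mul_comm]
    exact mul_le_mul_of_nonneg_left (hle ⟨(c.i, c.j), c.ne⟩) (abs_nonneg _)
  by_cases hj : k = c.j
  · subst hj
    rw [len_comm]
    refine le_trans ?_ (mul_sin_le_len h c.ne.symm (x - y))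
    rw [mul_comm]
    exact mul_le_mul_of_nonneg_left (hle ⟨(c.j, c.i), c.ne.symm⟩) (abs_nonneg _)
  · rw [Pi.sub_apply, hx.2.2 k hi hj, hy.2.2 k hi hj, sub_self, abs_zero, mul_zero]
    exact len_nonneg _ _ _

theorem ofReal_mul_dist_le_chain (h : A.Admissible δ a) {κ : ℝ} (hκ : 0 < κ)
    (hle : ∀ (c : A.Crossing) (x y : Fin n → ℝ), x ∈ A.quad c → y ∈ A.quad c →
      κ * dist x y ≤ A.len δ a c.i c.j (x - y)) {x y : A.Points} {ℓ : ℝ≥0∞}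
    (hc : A.Chain δ a x y ℓ) : ENNReal.ofReal (κ * dist x.1 y.1) ≤ ℓ := by
  induction hc with
  | nil x => simp
  | cons c x y z ℓ hx hy _ ih =>
    rw [edist_place h]
    refine le_trans ?_ (add_le_add (ENNReal.ofReal_le_ofReal (hle c _ _ hx hy)) ih)
    rw [← ENNReal.ofReal_add (by positivity) (by positivity), ← mul_add]
    exact ENNReal.ofReal_le_ofReal (mul_le_mul_of_nonneg_left (dist_triangle _ _ _) hκ.le)

theorem quad_convex (c : A.Crossing) : Convex ℝ (A.quad c) := by
  intro x hx y hy s t hs ht hst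
  refine ⟨convex_Icc _ _ hx.1 hy.1 hs ht hst, convex_Icc _ _ hx.2.1 hy.2.1 hs ht hst,
    fun k hi hj => ?_⟩
  simp only [Pi.add_apply, Pi.smul_apply, smul_eq_mul]
  rw [hx.2.2 k hi hj, hy.2.2 k hi hj, ← add_mul, hst, one_mul]

theorem quad_isCompact (c : A.Crossing) : IsCompact (A.quad c) := by
  have h : A.quad c = Set.pi Set.univ (fun k =>
      {s : ℝ | s ∈ Set.Icc (-1 : ℝ) 1 ∧ (k ≠ c.i → k ≠ c.j → s = A.code c.point k)}) := by
    ext t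
    simp only [Set.mem_pi, Set.mem_univ, forall_true_left]
    constructor
    · exact fun ht k => ⟨mem_Icc_of_mem_quad ht k, ht.2.2 k⟩
    · exact fun ht => ⟨(ht c.i).1, (ht c.j).1, fun k => (ht k).2⟩
  rw [h]
  refine isCompact_univ_pi fun k => ?_
  by_cases hk : k ≠ c.i ∧ k ≠ c.j
  · refine isCompact_Icc.of_isClosed_subset ?_ (fun s hs => hs.1)
    refine isClosed_Icc.inter ?_
    simp only [hk.1, hk.2, ne_eq, not_false_eq_true, forall_true_left]
    exact isClosed_singleton
  · convert isCompact_Icc (a := (-1 : ℝ)) (b := 1) using 1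
    ext s
    simp only [Set.mem_ofPred_eq, and_iff_left_iff_imp]
    exact fun _ h1 h2 => absurd ⟨h1, h2⟩ hk

/-- The points of the glued surface, with its metric. -/
abbrev Glued (A : LoopArrangement V n) (δ : Fin N → ℝ) (a : Fin n → ℝ) : Type :=
  (A.surface δ a).carrier

/-- A point of the surface, in the space with the glued metric. -/
def toGlued (δ : Fin N → ℝ) (a : Fin n → ℝ) (x : A.Points) : A.Glued δ a := x

/-- A point of a parallelogram as a point of the glued surface. -/
def ofQuad (A : LoopArrangement V n) (c : A.Crossing) (t : Fin n → ℝ) (ht : t ∈ A.quad c) :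
    A.Points :=
  ⟨t, Or.inr ⟨c, ht⟩⟩

/-- A straight segment in a parallelogram is a path of the same length. -/
theorem exists_path_of_mem_quad (h : A.Admissible δ a) (c : A.Crossing) (x y : A.Points)
    (hx : x.1 ∈ A.quad c) (hy : y.1 ∈ A.quad c) :
    ∃ γ : Path (toGlued δ a x) (toGlued δ a y),
      eVariationOn γ Set.univ ≤ ENNReal.ofReal (A.len δ a c.i c.j (x.1 - y.1)) := by
  have hmem : ∀ t : unitInterval, AffineMap.lineMap x.1 y.1 (t : ℝ) ∈ A.quad c := fun t =>
    (quad_convex c).lineMap_mem hx hy t.2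
  let f : unitInterval → A.Glued δ a := fun t => A.ofQuad c _ (hmem t)
  have hf : ∀ s t, edist (f s) (f t) ≤
      (Real.toNNReal (A.len δ a c.i c.j (x.1 - y.1)) : ℝ≥0∞) * edist s t := by
    intro s t
    refine (gdist_le_len h c (hmem s) (hmem t)).trans (le_of_eq ?_)
    have e : AffineMap.lineMap x.1 y.1 (s : ℝ) - AffineMap.lineMap x.1 y.1 (t : ℝ) =
        ((t : ℝ) - s) • (x.1 - y.1) := by
      simp only [AffineMap.lineMap_apply_module]; module
    have e2 : A.len δ a c.i c.j (((t : ℝ) - s) • (x.1 - y.1)) =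
        |(s : ℝ) - t| * A.len δ a c.i c.j (x.1 - y.1) := by
      rcases le_total (s : ℝ) t with hst | hst
      · rw [len_smul _ _ (by linarith), abs_of_nonpos (by linarith)]; ring
      · rw [← len_neg, ← neg_smul, len_smul _ _ (by linarith), abs_of_nonneg (by linarith)]; ring
    show ENNReal.ofReal (A.len δ a c.i c.j (AffineMap.lineMap x.1 y.1 (s : ℝ) -
      AffineMap.lineMap x.1 y.1 (t : ℝ))) = _
    rw [e, e2, mul_comm, ENNReal.ofReal_mul (len_nonneg _ _ _), Subtype.edist_eq, edist_dist,
      Real.dist_eq]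
    rfl
  have hcont : Continuous f := by
    refine LipschitzWith.continuous (K := Real.toNNReal (A.len δ a c.i c.j (x.1 - y.1))) hf
  refine ⟨⟨⟨f, hcont⟩, ?_, ?_⟩, ?_⟩
  · exact Subtype.ext (by simp [f, ofQuad, toGlued])
  · exact Subtype.ext (by simp [f, ofQuad, toGlued])
  · exact eVariationOn_le_of_edist_le _ _ hf

theorem exists_path_of_chain (h : A.Admissible δ a) {x y : A.Points} {ℓ : ℝ≥0∞}
    (hc : A.Chain δ a x y ℓ) :
    ∃ γ : Path (toGlued δ a x) (toGlued δ a y), eVariationOn γ Set.univ ≤ ℓ := by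
  induction hc with
  | nil x =>
    refine ⟨Path.refl (toGlued δ a x), ?_⟩
    refine (eVariationOn.constant_on ?_).le
    rintro _ ⟨s, -, rfl⟩ _ ⟨t, -, rfl⟩
    rfl
  | cons c x y z ℓ hx hy _ ih =>
    obtain ⟨γ, hγ⟩ := exists_path_of_mem_quad h c x y hx hy
    obtain ⟨γ', hγ'⟩ := ih
    rw [edist_place h]
    exact ⟨γ.trans γ', (eVariationOn_trans_le γ γ').trans (add_le_add hγ hγ')⟩

theorem isLengthSpace (h : A.Admissible δ a) : IsLengthSpace (A.Glued δ a) := by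
  intro x y
  refine le_antisymm (le_iInf fun γ => ?_) (le_iInf fun ℓ => ?_)
  · have := eVariationOn.edist_le γ (Set.mem_univ 0) (Set.mem_univ 1)
    rwa [γ.source, γ.target] at this
  · obtain ⟨γ, hγ⟩ := exists_path_of_chain h ℓ.2
    exact iInf_le_of_le γ hγ

/-! ### The quadrilaterals around a point -/

theorem sign_mul_of_pos {r : ℝ} (hr : 0 < r) (s : ℝ) : Real.sign (r * s) = Real.sign s := by
  rcases lt_trichotomy s 0 with h | h | h
  · rw [Real.sign_of_neg h, Real.sign_of_neg (mul_neg_of_pos_of_neg hr h)]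
  · rw [h, mul_zero]
  · rw [Real.sign_of_pos h, Real.sign_of_pos (mul_pos hr h)]

theorem eq_sign_iff {s r : ℝ} (hs : s = 1 ∨ s = -1) : s = Real.sign r ↔ 0 < s * r := by
  rcases lt_trichotomy r 0 with h | h | h
  · rw [Real.sign_of_neg h]
    rcases hs with rfl | rfl
    · norm_num; exact h.le
    · simpa using h
  · subst h
    rcases hs with rfl | rfl <;> simp
  · rw [Real.sign_of_pos h]
    rcases hs with rfl | rfl
    · simpa using h
    · norm_num; exact h.le

theorem code_direction {y : E3} (hy : y ≠ 0) (k : Fin n) :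
    A.code (direction y hy) k = Real.sign ⟪A.nv k, y⟫ := by
  rw [code_apply, direction_coe, real_inner_smul_right,
    sign_mul_of_pos (inv_pos.mpr (norm_pos_iff.mpr hy))]

/-- The crossing of two loops in a given direction. -/
def mkCrossing (A : LoopArrangement V n) {i j : Fin n} (hij : i ≠ j) {y : E3} (hy : y ≠ 0)
    (hi : ⟪A.nv i, y⟫ = 0) (hj : ⟪A.nv j, y⟫ = 0) : A.Crossing where
  point := direction y hy
  i := i
  j := j
  ne := hij
  mem_i := by rw [mem_greatCircle, direction_coe, real_inner_smul_right, hi, mul_zero]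
  mem_j := by rw [mem_greatCircle, direction_coe, real_inner_smul_right, hj, mul_zero]

/-- The same crossing with the two loops interchanged. -/
def Crossing.swap (c : A.Crossing) : A.Crossing := ⟨c.point, c.j, c.i, c.ne.symm, c.mem_j, c.mem_i⟩

theorem quad_swap (c : A.Crossing) : A.quad c.swap = A.quad c := by
  ext t
  constructor
  · exact fun h => ⟨h.2.1, h.1, fun k hi hj => h.2.2 k hj hi⟩
  · exact fun h => ⟨h.2.1, h.1, fun k hi hj => h.2.2 k hj hi⟩

/-- The vector `x` agrees with the signs of the loops at `c`, except for the two loops through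
`c`. -/
def Matches (x : Fin n → ℝ) (c : A.Crossing) : Prop :=
  ∀ k, k ≠ c.i → k ≠ c.j → x k = A.code c.point k

theorem Matches.mem_quad {x : Fin n → ℝ} {c : A.Crossing} (h : Matches x c) {t : Fin n → ℝ}
    (hi : t c.i ∈ Set.Icc (-1 : ℝ) 1) (hj : t c.j ∈ Set.Icc (-1 : ℝ) 1)
    (hk : ∀ k, k ≠ c.i → k ≠ c.j → t k = x k) : t ∈ A.quad c :=
  ⟨hi, hj, fun k h1 h2 => (hk k h1 h2).trans (h k h1 h2)⟩

theorem Matches.apply_eq {x : Fin n → ℝ} {c : A.Crossing} (h : Matches x c) {t : Fin n → ℝ}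
    (ht : t ∈ A.quad c) {k : Fin n} (h1 : k ≠ c.i) (h2 : k ≠ c.j) : t k = x k :=
  (ht.2.2 k h1 h2).trans (h k h1 h2).symm

theorem matches_of_mem {x : Fin n → ℝ} {c : A.Crossing} (h : x ∈ A.quad c) : Matches x c := h.2.2

theorem Matches.pos {x : Fin n → ℝ} {c : A.Crossing} (h : Matches x c) {k : Fin n}
    (hk : x k = 1 ∨ x k = -1) (hi : k ≠ c.i) (hj : k ≠ c.j) : 0 < x k * ⟪A.nv k, c.point⟫ :=
  (eq_sign_iff hk).mp (h k hi hj)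

theorem Matches.swap {x : Fin n → ℝ} {c : A.Crossing} (h : Matches x c) : Matches x c.swap :=
  fun k hi hj => h k hj hi

/-- The normal vectors on the sides of the loops that are given by the signs `x`. -/
def signedNormal (A : LoopArrangement V n) (x : Fin n → ℝ) (k : Fin n) : E3 := x k • A.nv k

theorem inner_signedNormal (x : Fin n → ℝ) (k : Fin n) (y : E3) :
    ⟪A.signedNormal x k, y⟫ = x k * ⟪A.nv k, y⟫ := real_inner_smul_left _ _ _

theorem inGeneralPosition_smul {I : Type*} {m : I → E3} (hm : InGeneralPosition m) {x : I → ℝ}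
    (hx : ∀ k, x k ≠ 0) : InGeneralPosition fun k => x k • m k := by
  intro i j k hij hjk hik y hi hj hk
  simp only [real_inner_smul_left, mul_eq_zero, hx, false_or] at hi hj hk
  exact hm i j k hij hjk hik y hi hj hk

theorem inGeneralPosition_signedNormal {x : Fin n → ℝ} (hx : ∀ k, x k = 1 ∨ x k = -1) :
    InGeneralPosition (A.signedNormal x) :=
  inGeneralPosition_smul A.inGeneralPosition fun k => by
    rcases hx k with h | h <;> rw [h] <;> norm_num

/-- A facet of the cone over a face of the arrangement gives a corner of the face. -/
theorem exists_matches_of_isFacet {x : Fin n → ℝ} (hn : 3 ≤ n) (hx : ∀ k, x k = 1 ∨ x k = -1)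
    {i j : Fin n} (h : IsFacet (A.signedNormal x) i j) :
    ∃ c : A.Crossing, c.i = i ∧ c.j = j ∧ Matches x c := by
  have hy := (inGeneralPosition_signedNormal (A := A) hx).cr_ne_zero (by simpa using hn) h.1
  have key : ∀ k, x k * ⟪A.nv k, cr (A.signedNormal x i) (A.signedNormal x j)⟫ =
      det3 (A.signedNormal x i) (A.signedNormal x j) (A.signedNormal x k) := fun k => by
    rw [← inner_signedNormal, real_inner_comm, inner_cr]
  have hne : ∀ k, x k ≠ 0 := fun k => by rcases hx k with h | h <;> rw [h] <;> norm_num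
  refine ⟨A.mkCrossing h.1 hy ?_ ?_, rfl, rfl, fun k hi hj => ?_⟩
  · have := key i
    rw [det3_self_left] at this
    exact (mul_eq_zero.mp this).resolve_left (hne i)
  · have := key j
    rw [det3_self_right] at this
    exact (mul_eq_zero.mp this).resolve_left (hne j)
  · refine Eq.trans ?_ (code_direction hy k).symm
    rw [eq_sign_iff (hx k), key]
    exact h.2 k hi hj

/-- Every corner of a face of the arrangement is given by a facet. -/
theorem isFacet_of_matches {x : Fin n → ℝ} (hn : 3 ≤ n) (hx : ∀ k, x k = 1 ∨ x k = -1)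
    {c : A.Crossing} (h : Matches x c) :
    IsFacet (A.signedNormal x) c.i c.j ∨ IsFacet (A.signedNormal x) c.j c.i := by
  have hm := inGeneralPosition_signedNormal (A := A) hx
  have hy := hm.cr_ne_zero (by simpa using hn) c.ne
  have h1 : ⟪A.signedNormal x c.i, c.point⟫ = 0 := by
    rw [inner_signedNormal, c.inner_i, mul_zero]
  have h2 : ⟪A.signedNormal x c.j, c.point⟫ = 0 := by
    rw [inner_signedNormal, c.inner_j, mul_zero]
  have h3 := smul_eq_of_orthogonal h1 h2
  set w := cr (A.signedNormal x c.i) (A.signedNormal x c.j) with hw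
  have hww : 0 < ⟪w, w⟫ := real_inner_self_pos.mpr hy
  have h4 : ∀ k, k ≠ c.i → k ≠ c.j → 0 < ⟪w, c.point⟫ *
      det3 (A.signedNormal x c.i) (A.signedNormal x c.j) (A.signedNormal x k) := by
    intro k hi hj
    have h5 := h.pos (hx k) hi hj
    rw [← inner_signedNormal] at h5
    have h6 := congrArg (fun y => ⟪A.signedNormal x k, y⟫) h3
    simp only [real_inner_smul_right] at h6
    rw [← inner_cr, ← hw, real_inner_comm (A.signedNormal x k) w, ← h6]
    exact mul_pos hww h5
  rcases lt_trichotomy ⟪w, (c.point : E3)⟫ 0 with h5 | h5 | h5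
  · right
    refine ⟨c.ne.symm, fun k hj hi => ?_⟩
    rw [det3_swap]
    have := h4 k hi hj
    by_contra h6
    have := mul_nonpos_of_nonpos_of_nonneg h5.le (by linarith : 0 ≤
      det3 (A.signedNormal x c.i) (A.signedNormal x c.j) (A.signedNormal x k))
    linarith
  · obtain ⟨k, hi, hj⟩ := exists_ne_ne (I := Fin n) (by simpa using hn) c.i c.j
    have := h4 k hi hj
    rw [h5, zero_mul] at this
    exact absurd this (lt_irrefl _)
  · left
    exact ⟨c.ne, fun k hi hj => pos_of_mul_pos_right (h4 k hi hj) h5.le⟩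

theorem exists_eq_smul_add_smul {u p z q : E3} (hD : det3 u p z ≠ 0) (h : det3 p z q = 0) :
    ∃ α β : ℝ, q = α • p + β • z := by
  have h2 := cramer u p z q
  rw [h, zero_smul, zero_sub] at h2
  refine ⟨-(det3 u z q) / det3 u p z, det3 u p q / det3 u p z, ?_⟩
  have h4 : det3 u p z • q = (-(det3 u z q)) • p + det3 u p q • z := by
    refine (sub_eq_zero.mp (Eq.trans ?_ h2)).symm
    module
  have h5 := congrArg (fun y => (det3 u p z)⁻¹ • y) h4
  simp only [smul_add, smul_smul, inv_mul_cancel₀ hD, one_smul] at h5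
  rw [div_eq_inv_mul, div_eq_inv_mul, ← h5]

/-- An arc of the loop `i` ends at two crossings, one on each side. -/
theorem exists_ends_of_arc (hn : 3 ≤ n) {x : Fin n → ℝ} {i : Fin n}
    (hx : ∀ k, k ≠ i → x k = 1 ∨ x k = -1) {p : E3} (hpi : ⟪A.nv i, p⟫ = 0)
    (hp : ∀ k, k ≠ i → 0 < x k * ⟪A.nv k, p⟫) :
    ∃ c d : A.Crossing, c.i = i ∧ d.i = i ∧ c.j ≠ d.j ∧ Matches x c ∧ Matches x d ∧
      ∀ e : A.Crossing, e.i = i → Matches x e → e.j = c.j ∨ e.j = d.j := by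
  have hcard : 3 ≤ Fintype.card (Fin n) := by simpa using hn
  have hne : ∀ k, k ≠ i → x k ≠ 0 := fun k hk => by
    rcases hx k hk with h | h <;> rw [h] <;> norm_num
  obtain ⟨k₀, hk₀, -⟩ := exists_ne_ne hcard i i
  set z := cr (A.nv i) p with hz
  have hzi : ⟪A.nv i, z⟫ = 0 := by rw [real_inner_comm, inner_cr, det3_self_left]
  -- the position along the loop at which the line spanned by `z` crosses the loop `k`
  let key : Fin n → ℝ := fun k => (x k * ⟪A.nv k, z⟫) / (x k * ⟪A.nv k, p⟫)
  have hkey : ∀ k, k ≠ i → x k * ⟪A.nv k, z⟫ = key k * (x k * ⟪A.nv k, p⟫) := fun k hk =>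
    (div_mul_cancel₀ _ (hp k hk).ne').symm
  have hkey' : ∀ k, k ≠ i → ⟪A.nv k, z⟫ = key k * ⟪A.nv k, p⟫ := fun k hk =>
    mul_left_cancel₀ (hne k hk) (by rw [hkey k hk]; ring)
  have hp0 : p ≠ 0 := fun h => by
    have := hp k₀ hk₀
    rw [h, inner_zero_right, mul_zero] at this
    exact this.false
  have hni : A.nv i ≠ 0 := A.inGeneralPosition.ne_zero hcard i
  have hz_p : ∀ lam : ℝ, z - lam • p ≠ 0 := by
    intro lam h
    have h1 : ⟪z, p⟫ = 0 := by rw [hz, inner_cr, det3_self_right]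
    have h2 := congrArg (fun y => ⟪z, y⟫) h
    simp only [inner_sub_right, real_inner_smul_right, h1, inner_zero_right, mul_zero,
      sub_zero] at h2
    rw [hz, inner_cr_cr, hpi] at h2
    have := mul_pos (real_inner_self_pos.mpr hni) (real_inner_self_pos.mpr hp0)
    linarith
  have hinj : ∀ j k, j ≠ i → k ≠ i → key j = key k → j = k := by
    intro j k hj hk hjk
    by_contra hne'
    refine hz_p (key j) (A.inGeneralPosition i j k hj.symm hne' hk.symm _ ?_ ?_ ?_)
    · rw [inner_sub_right, real_inner_smul_right, hzi, hpi]; simp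
    · rw [inner_sub_right, real_inner_smul_right, hkey' j hj, sub_self]
    · rw [inner_sub_right, real_inner_smul_right, hkey' k hk, hjk, sub_self]
  have hnonempty : Nonempty {k : Fin n // k ≠ i} := ⟨⟨k₀, hk₀⟩⟩
  obtain ⟨⟨j₁, hj₁⟩, hmin⟩ := Finite.exists_min fun k : {k : Fin n // k ≠ i} => key k
  obtain ⟨⟨j₂, hj₂⟩, hmax⟩ := Finite.exists_max fun k : {k : Fin n // k ≠ i} => key k
  have hmin' : ∀ k, k ≠ i → k ≠ j₁ → key j₁ < key k := fun k hk hk' =>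
    (hmin ⟨k, hk⟩).lt_of_ne fun h => hk' (hinj j₁ k hj₁ hk h).symm
  have hmax' : ∀ k, k ≠ i → k ≠ j₂ → key k < key j₂ := fun k hk hk' =>
    (hmax ⟨k, hk⟩).lt_of_ne fun h => hk' (hinj k j₂ hk hj₂ h)
  have hj₁₂ : j₁ ≠ j₂ := by
    rintro rfl
    obtain ⟨k, hk, hk'⟩ := exists_ne_ne hcard i j₁
    exact lt_asymm (hmin' k hk hk') (hmax' k hk hk')
  refine ⟨A.mkCrossing hj₁.symm (hz_p (key j₁)) ?_ ?_, A.mkCrossing hj₂.symm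
    (neg_ne_zero.mpr (hz_p (key j₂))) ?_ ?_, rfl, rfl, hj₁₂, ?_, ?_, ?_⟩
  · rw [inner_sub_right, real_inner_smul_right, hzi, hpi]; simp
  · rw [inner_sub_right, real_inner_smul_right, hkey' j₁ hj₁, sub_self]
  · rw [inner_neg_right, inner_sub_right, real_inner_smul_right, hzi, hpi]; simp
  · rw [inner_neg_right, inner_sub_right, real_inner_smul_right, hkey' j₂ hj₂, sub_self, neg_zero]
  · intro k (hk : k ≠ i) (hk' : k ≠ j₁)
    refine Eq.trans ?_ (code_direction (hz_p (key j₁)) k).symm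
    rw [eq_sign_iff (hx k hk), inner_sub_right, real_inner_smul_right, hkey' k hk]
    have := mul_pos (sub_pos.mpr (hmin' k hk hk')) (hp k hk)
    linarith
  · intro k (hk : k ≠ i) (hk' : k ≠ j₂)
    refine Eq.trans ?_ (code_direction (neg_ne_zero.mpr (hz_p (key j₂))) k).symm
    rw [eq_sign_iff (hx k hk), inner_neg_right, inner_sub_right, real_inner_smul_right,
      hkey' k hk]
    have := mul_pos (sub_pos.mpr (hmax' k hk hk')) (hp k hk)
    linarith
  · rintro e rfl he
    show e.j = j₁ ∨ e.j = j₂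
    have hej : e.j ≠ e.i := e.ne.symm
    -- the crossing point, in the basis `p`, `z` of the plane of the loop
    obtain ⟨α, β, hαβ⟩ : ∃ α β : ℝ, (e.point : E3) = α • p + β • z := by
      refine exists_eq_smul_add_smul (u := A.nv e.i) ?_ ?_
      · rw [← inner_cr, ← hz]
        have hz0 : z ≠ 0 := by simpa using hz_p 0
        exact (real_inner_self_pos.mpr hz0).ne'
      · have e1 : cr p z = ⟪p, p⟫ • A.nv e.i := by
          rw [hz, cr_cr, real_inner_comm (A.nv e.i) p, hpi, zero_smul, sub_zero]
        rw [← inner_cr, e1, real_inner_smul_left, e.inner_i, mul_zero]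
    have hval : ∀ k, k ≠ e.i → x k * ⟪A.nv k, e.point⟫ =
        (α + β * key k) * (x k * ⟪A.nv k, p⟫) := by
      intro k hk
      rw [hαβ, inner_add_right, real_inner_smul_right, real_inner_smul_right, hkey' k hk]; ring
    have hj0 : α + β * key e.j = 0 := by
      have := hval e.j hej
      rw [e.inner_j, mul_zero] at this
      exact (mul_eq_zero.mp this.symm).resolve_right (hp _ hej).ne'
    have hpos : ∀ k, k ≠ e.i → k ≠ e.j → 0 < β * (key k - key e.j) := by
      intro k hk hk'
      have h1 := he.pos (hx k hk) hk hk'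
      rw [hval k hk] at h1
      have h2 := pos_of_mul_pos_left h1 (hp k hk).le
      linarith
    by_contra! hcon
    have h1 := hpos j₁ hj₁ hcon.1.symm
    have h2 := hpos j₂ hj₂ hcon.2.symm
    have h3 := hmin' e.j hej hcon.1
    have h4 := hmax' e.j hej hcon.2
    rcases lt_or_ge 0 β with hβ | hβ
    · have := mul_neg_of_pos_of_neg hβ (sub_neg.mpr h3); linarith
    · have := mul_nonpos_of_nonpos_of_nonneg hβ (sub_pos.mpr h4).le; linarith

/-- A vector on the prescribed sides of all loops: the crossing point, moved into the face. -/
theorem exists_interior_of_vertex (hn : 3 ≤ n) {x : Fin n → ℝ} {c : A.Crossing} (hc : Matches x c)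
    (hx : ∀ k, x k = 1 ∨ x k = -1) : ∃ p : E3, ∀ k, 0 < ⟪A.signedNormal x k, p⟫ := by
  obtain ⟨u, hu1, hu2⟩ := (inGeneralPosition_signedNormal (A := A) hx).exists_inner_eq
    (by simpa using hn) c.ne 1 1
  obtain ⟨ε, -, h⟩ := exists_perturb (m := A.signedNormal x) (y := c.point) (u := u) fun k => by
    by_cases hi : k = c.i
    · right
      rw [hi, inner_signedNormal, c.inner_i, mul_zero, hu1]
      exact ⟨rfl, one_pos⟩
    by_cases hj : k = c.j
    · right
      rw [hj, inner_signedNormal, c.inner_j, mul_zero, hu2]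
      exact ⟨rfl, one_pos⟩
    · left
      rw [inner_signedNormal]
      exact (eq_sign_iff (hx k)).mp (hc k hi hj)
  exact ⟨_, h⟩

/-- A vector on a loop and on the prescribed sides of the other loops: the crossing point, moved
along the loop. -/
theorem exists_interior_of_edge (hn : 3 ≤ n) {x : Fin n → ℝ} {c : A.Crossing} (hc : Matches x c)
    (hx : ∀ k, k ≠ c.i → x k = 1 ∨ x k = -1) :
    ∃ p : E3, ⟪A.nv c.i, p⟫ = 0 ∧ ∀ k, k ≠ c.i → 0 < x k * ⟪A.nv k, p⟫ := by
  obtain ⟨u, hu1, hu2⟩ := A.inGeneralPosition.exists_inner_eq (by simpa using hn) c.ne 0 (x c.j)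
  obtain ⟨ε, -, h⟩ := exists_perturb (m := fun k : {k : Fin n // k ≠ c.i} => A.signedNormal x k)
    (y := c.point) (u := u) fun k => by
    by_cases hj : k.1 = c.j
    · right
      rw [hj, inner_signedNormal, inner_signedNormal, c.inner_j, mul_zero, hu2]
      refine ⟨rfl, ?_⟩
      rcases hx c.j c.ne.symm with h | h <;> rw [h] <;> norm_num
    · left
      rw [inner_signedNormal]
      exact (eq_sign_iff (hx k k.2)).mp (hc k k.2 hj)
  refine ⟨_, ?_, fun k hk => by have := h ⟨k, hk⟩; rwa [inner_signedNormal] at this⟩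
  rw [inner_add_right, real_inner_smul_right, c.inner_i, hu1]; simp

/-- Every point of the surface lies in a parallelogram, since every face of the arrangement has a
corner. -/
theorem exists_mem_quad (hn : 3 ≤ n) (x : A.Points) : ∃ c : A.Crossing, x.1 ∈ A.quad c := by
  rcases x.2 with ⟨q, hq, hxq⟩ | h
  · have hx : ∀ k, x.1 k = 1 ∨ x.1 k = -1 := fun k => by
      rw [hxq]; exact code_eq_one_or (hq k)
    obtain ⟨M, b, hb⟩ := exists_cyclicList (inGeneralPosition_signedNormal (A := A) hx)
      (by simpa using hn) (p := q) fun k => by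
        rw [inner_signedNormal, ← eq_sign_iff (hx k), hxq]; rfl
    obtain ⟨c, -, -, hc⟩ := exists_matches_of_isFacet hn hx (hb.isFacet 0)
    refine ⟨c, hc.mem_quad ?_ ?_ fun k _ _ => rfl⟩
    · rcases hx c.i with h | h <;> rw [h] <;> norm_num
    · rcases hx c.j with h | h <;> rw [h] <;> norm_num
  · exact h

/-! ### The surface is a sphere -/

/-- The linear map that carries the cube `[-1, 1] ^ n` to the zonotope spanned by the normal
vectors. -/
def zonotopeMap (A : LoopArrangement V n) : (Fin n → ℝ) →ₗ[ℝ] E3 := Fintype.linearCombination ℝ A.nv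

theorem zonotopeMap_apply (t : Fin n → ℝ) : A.zonotopeMap t = ∑ k, t k • A.nv k :=
  Fintype.linearCombination_apply _ _ _

theorem inner_zonotopeMap (y : E3) (t : Fin n → ℝ) :
    ⟪y, A.zonotopeMap t⟫ = ∑ k, t k * ⟪A.nv k, y⟫ := by
  rw [zonotopeMap_apply, inner_sum]
  exact Finset.sum_congr rfl fun k _ => by rw [real_inner_smul_right, real_inner_comm]

theorem mul_le_mul_sign {s r : ℝ} (hs : s ∈ Set.Icc (-1 : ℝ) 1) : s * r ≤ Real.sign r * r := by
  rcases lt_trichotomy r 0 with h | h | h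
  · rw [Real.sign_of_neg h]; nlinarith [hs.1, hs.2]
  · simp [h]
  · rw [Real.sign_of_pos h]; nlinarith [hs.1, hs.2]

theorem eq_sign_of_mul_sign_le {s r : ℝ} (hr : r ≠ 0) (hs : s ∈ Set.Icc (-1 : ℝ) 1)
    (h : Real.sign r * r ≤ s * r) : s = Real.sign r := by
  rcases lt_or_gt_of_ne hr with h1 | h1
  · rw [Real.sign_of_neg h1] at *; nlinarith [hs.1, hs.2]
  · rw [Real.sign_of_pos h1] at *; nlinarith [hs.1, hs.2]

/-- The parallelogram of the zonotope that is the image of a quadrilateral lies in the plane on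
which the product with the crossing point is maximal. -/
theorem mul_le_of_mem_quad {c : A.Crossing} {t : Fin n → ℝ} (ht : t ∈ A.quad c) {s : Fin n → ℝ}
    (hs : ∀ k, s k ∈ Set.Icc (-1 : ℝ) 1) (k : Fin n) :
    s k * ⟪A.nv k, c.point⟫ ≤ t k * ⟪A.nv k, c.point⟫ := by
  by_cases hi : k = c.i
  · rw [hi, c.inner_i, mul_zero, mul_zero]
  by_cases hj : k = c.j
  · rw [hj, c.inner_j, mul_zero, mul_zero]
  rw [ht.2.2 k hi hj, code_apply]
  exact mul_le_mul_sign (hs k)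

theorem inner_zonotopeMap_pos (hn : 3 ≤ n) {c : A.Crossing} {t : Fin n → ℝ} (ht : t ∈ A.quad c) :
    0 < ⟪(c.point : E3), A.zonotopeMap t⟫ := by
  obtain ⟨k, hi, hj⟩ := exists_ne_ne (I := Fin n) (by simpa using hn) c.i c.j
  rw [inner_zonotopeMap]
  refine Finset.sum_pos' (fun k _ => ?_) ⟨k, Finset.mem_univ k, ?_⟩
  · have := mul_le_of_mem_quad ht (s := 0) (fun k => by simp) k
    simpa using this
  · exact (matches_of_mem ht).pos (eq_one_or_of_mem_quad ht hi hj) hi hj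

/-- A point of the zonotope that lies in the plane of a parallelogram lies in the parallelogram, and
its coordinates are unique. -/
theorem eq_of_zonotopeMap_eq (hn : 3 ≤ n) {c : A.Crossing} {t s : Fin n → ℝ} (ht : t ∈ A.quad c)
    (hs : ∀ k, s k ∈ Set.Icc (-1 : ℝ) 1) (h : A.zonotopeMap s = A.zonotopeMap t) : s = t := by
  have hle := fun k (_ : k ∈ Finset.univ) => mul_le_of_mem_quad ht hs k
  have hsum := congrArg (fun z => ⟪(c.point : E3), z⟫) h
  simp only [inner_zonotopeMap] at hsum
  have heq := (Finset.sum_eq_sum_iff_of_le hle).mp hsum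
  have hk : ∀ k, k ≠ c.i → k ≠ c.j → s k - t k = 0 := fun k hi hj =>
    sub_eq_zero.mpr (mul_right_cancel₀ (c.inner_ne_zero hi hj) (heq k (Finset.mem_univ k)))
  have hdiff : A.zonotopeMap (s - t) = 0 := by rw [map_sub, h, sub_self]
  have hij : ∀ u : E3, (s c.i - t c.i) * ⟪A.nv c.i, u⟫ + (s c.j - t c.j) * ⟪A.nv c.j, u⟫ = 0 := by
    intro u
    have h1 := inner_zonotopeMap (A := A) u (s - t)
    rw [hdiff, inner_zero_right, Finset.sum_eq_add c.i c.j c.ne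
      (fun k _ hk' => by rw [Pi.sub_apply, hk k hk'.1 hk'.2, zero_mul]) (by simp) (by simp)] at h1
    exact h1.symm
  have hcard : 3 ≤ Fintype.card (Fin n) := by simpa using hn
  obtain ⟨u, hu1, hu2⟩ := A.inGeneralPosition.exists_inner_eq hcard c.ne 1 0
  obtain ⟨v, hv1, hv2⟩ := A.inGeneralPosition.exists_inner_eq hcard c.ne 0 1
  have h1 := hij u
  have h2 := hij v
  rw [hu1, hu2] at h1
  rw [hv1, hv2] at h2
  funext k
  by_cases hi : k = c.i
  · rw [hi]; linarith
  by_cases hj : k = c.j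
  · rw [hj]; linarith
  linarith [hk k hi hj]

theorem zonotopeMap_ne_zero (hn : 3 ≤ n) (x : A.Points) : A.zonotopeMap x.1 ≠ 0 := by
  obtain ⟨c, hc⟩ := exists_mem_quad hn x
  intro h
  have := inner_zonotopeMap_pos hn hc
  rw [h, inner_zero_right] at this
  exact this.false

/-- The radial projection of the boundary of the zonotope to the sphere. -/
def toSphere (A : LoopArrangement V n) (hn : 3 ≤ n) (x : A.Points) : S2 :=
  direction (A.zonotopeMap x.1) (zonotopeMap_ne_zero hn x)

theorem toSphere_injective (hn : 3 ≤ n) : Function.Injective (A.toSphere hn) := by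
  -- the boundary of the zonotope meets each ray only once
  have key : ∀ (x y : A.Points) (r : ℝ), 1 ≤ r → A.zonotopeMap x.1 = r • A.zonotopeMap y.1 →
      x = y := by
    intro x y r hr h
    obtain ⟨c, hc⟩ := exists_mem_quad hn y
    obtain ⟨d, hd⟩ := exists_mem_quad hn x
    have h1 := inner_zonotopeMap_pos hn hc
    have h2 : ⟪(c.point : E3), A.zonotopeMap x.1⟫ ≤ ⟪(c.point : E3), A.zonotopeMap y.1⟫ := by
      rw [inner_zonotopeMap, inner_zonotopeMap]
      exact Finset.sum_le_sum fun k _ => mul_le_of_mem_quad hc (mem_Icc_of_mem_quad hd) k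
    rw [h, real_inner_smul_right] at h2
    have hr1 : r = 1 := le_antisymm (by nlinarith) hr
    rw [hr1, one_smul] at h
    exact Subtype.ext (eq_of_zonotopeMap_eq hn hc (mem_Icc_of_mem_quad hd) h)
  intro x y hxy
  have hx := norm_pos_iff.mpr (zonotopeMap_ne_zero hn x)
  have hy := norm_pos_iff.mpr (zonotopeMap_ne_zero hn y)
  have h : ‖A.zonotopeMap x.1‖⁻¹ • A.zonotopeMap x.1 = ‖A.zonotopeMap y.1‖⁻¹ • A.zonotopeMap y.1 :=
    congrArg Subtype.val hxy
  rcases le_total ‖A.zonotopeMap y.1‖ ‖A.zonotopeMap x.1‖ with hle | hle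
  · refine key x y (‖A.zonotopeMap x.1‖ * ‖A.zonotopeMap y.1‖⁻¹) ?_ ?_
    · rw [← div_eq_mul_inv]; exact (one_le_div hy).mpr hle
    · rw [mul_smul, ← h, smul_smul, mul_inv_cancel₀ hx.ne', one_smul]
  · refine (key y x (‖A.zonotopeMap y.1‖ * ‖A.zonotopeMap x.1‖⁻¹) ?_ ?_).symm
    · rw [← div_eq_mul_inv]; exact (one_le_div hx).mpr hle
    · rw [mul_smul, h, smul_smul, mul_inv_cancel₀ hy.ne', one_smul]

theorem zonotopeMap_surjective (hn : 3 ≤ n) : Function.Surjective A.zonotopeMap := by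
  have hcard : 3 ≤ Fintype.card (Fin n) := by simpa using hn
  let i : Fin n := ⟨0, by omega⟩
  obtain ⟨j, hj, -⟩ := exists_ne_ne hcard i i
  obtain ⟨k, hki, hkj⟩ := exists_ne_ne hcard i j
  have hD := A.inGeneralPosition.det3_ne_zero hj.symm hkj.symm hki.symm
  intro v
  have h := cramer (A.nv i) (A.nv j) (A.nv k) v
  have hsingle : ∀ l r, A.zonotopeMap (Pi.single l r) = r • A.nv l := fun l r =>
    Fintype.linearCombination_apply_single ℝ A.nv l r
  refine ⟨(det3 (A.nv i) (A.nv j) (A.nv k))⁻¹ • (Pi.single i (det3 (A.nv j) (A.nv k) v) -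
    Pi.single j (det3 (A.nv i) (A.nv k) v) + Pi.single k (det3 (A.nv i) (A.nv j) v)), ?_⟩
  rw [map_smul, map_add, map_sub, hsingle, hsingle, hsingle, sub_eq_zero.mp h, smul_smul,
    inv_mul_cancel₀ hD, one_smul]

/-- The coordinates of a point at which a linear functional takes its maximum on the zonotope are
those of a point of the surface. -/
theorem mem_points_of_isMaxOn (hn : 3 ≤ n) {t : Fin n → ℝ} (ht : ∀ k, t k ∈ Set.Icc (-1 : ℝ) 1)
    {y : E3} (hy : y ≠ 0) (hmax : ∀ k, ⟪A.nv k, y⟫ ≠ 0 → t k = Real.sign ⟪A.nv k, y⟫) :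
    t ∈ A.dualVertices ∨ ∃ c : A.Crossing, t ∈ A.quad c := by
  by_cases h0 : ∃ i, ⟪A.nv i, y⟫ = 0
  · obtain ⟨i, hi⟩ := h0
    right
    by_cases h1 : ∃ j, j ≠ i ∧ ⟪A.nv j, y⟫ = 0
    · obtain ⟨j, hji, hj⟩ := h1
      refine ⟨A.mkCrossing hji.symm hy hi hj, ht _, ht _, fun k (hki : k ≠ i) (hkj : k ≠ j) => ?_⟩
      refine (hmax k fun hk => hy ?_).trans (code_direction hy k).symm
      exact A.inGeneralPosition i j k hji.symm hkj.symm hki.symm y hi hj hk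
    · push Not at h1
      have hx : ∀ k, k ≠ i → t k = 1 ∨ t k = -1 := fun k hk => by
        rw [hmax k (h1 k hk)]
        rcases lt_or_gt_of_ne (h1 k hk) with h | h
        · right; exact Real.sign_of_neg h
        · left; exact Real.sign_of_pos h
      obtain ⟨c, -, -, -, -, hc, -, -⟩ := exists_ends_of_arc hn hx hi fun k hk =>
        (eq_sign_iff (hx k hk)).mp (hmax k (h1 k hk))
      exact ⟨c, hc.mem_quad (ht _) (ht _) fun _ _ _ => rfl⟩
  · push Not at h0
    left
    refine ⟨direction y hy, fun i hi => h0 i ?_, funext fun k =>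
      (hmax k (h0 k)).trans (code_direction hy k).symm⟩
    rw [mem_greatCircle, direction_coe, real_inner_smul_right] at hi
    exact (mul_eq_zero.mp hi).resolve_left (inv_ne_zero (norm_ne_zero_iff.mpr hy))

/-- Every ray meets the boundary of the zonotope, and a supporting plane there determines the
coordinates that are not free. -/
theorem toSphere_surjective (hn : 3 ≤ n) : Function.Surjective (A.toSphere hn) := by
  intro u
  set B : Set (Fin n → ℝ) := Set.pi Set.univ fun _ => Set.Icc (-1 : ℝ) 1 with hB
  set K : Set E3 := A.zonotopeMap '' B with hK
  have hcont : Continuous A.zonotopeMap := A.zonotopeMap.continuous_of_finiteDimensional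
  have hKc : IsCompact K := (isCompact_univ_pi fun _ => isCompact_Icc).image hcont
  have hKconv : Convex ℝ K := (convex_pi fun _ _ => convex_Icc _ _).linear_image _
  -- contractions of points of the zonotope lie in the interior
  have hint : ∀ t ∈ B, ∀ r : ℝ, 0 ≤ r → r < 1 → r • A.zonotopeMap t ∈ interior K := by
    intro t ht r hr0 hr1
    have hopen : IsOpen (A.zonotopeMap '' (Set.pi Set.univ fun _ => Set.Ioo (-1 : ℝ) 1)) :=
      A.zonotopeMap.isOpenMap_of_finiteDimensional (zonotopeMap_surjective hn) _
        (isOpen_set_pi Set.finite_univ fun _ _ => isOpen_Ioo)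
    refine interior_maximal (Set.image_mono (Set.pi_mono fun _ _ => Set.Ioo_subset_Icc_self)) hopen
      ⟨r • t, fun k _ => ?_, map_smul _ _ _⟩
    have h1 := (ht k trivial).1
    have h2 := (ht k trivial).2
    rw [Pi.smul_apply, smul_eq_mul]
    constructor <;> nlinarith
  have h0B : (0 : Fin n → ℝ) ∈ B := fun k _ => by simp
  have h0int : (0 : E3) ∈ interior K := by
    have := hint 0 h0B 0 le_rfl one_pos
    rwa [zero_smul] at this
  -- the last point of the zonotope on the ray
  have hline : Continuous fun r : ℝ => r • (u : E3) := by fun_prop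
  have hnorm : ‖(u : E3)‖ = 1 := norm_eq_of_mem_sphere u
  have hScomp : IsCompact ((fun r : ℝ => r • (u : E3)) ⁻¹' K) := by
    refine Metric.isCompact_of_isClosed_isBounded (hKc.isClosed.preimage hline) ?_
    obtain ⟨R, hR⟩ := hKc.isBounded.exists_norm_le
    refine isBounded_iff_forall_norm_le.mpr ⟨R, fun r hr => ?_⟩
    have := hR _ hr
    rwa [norm_smul, hnorm, mul_one] at this
  obtain ⟨r, hrK, hrmax⟩ := hScomp.exists_isGreatest
    ⟨0, by simpa using interior_subset h0int⟩
  have hrint : r • (u : E3) ∉ interior K := by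
    intro h
    have h1 : ∀ᶠ s in nhds r, s • (u : E3) ∈ interior K :=
      hline.continuousAt.eventually (isOpen_interior.mem_nhds h)
    obtain ⟨s, hs, hs'⟩ := ((h1.filter_mono nhdsWithin_le_nhds).and
      (self_mem_nhdsWithin : Set.Ioi r ∈ nhdsWithin r (Set.Ioi r))).exists
    have hsK : s • (u : E3) ∈ K := interior_subset hs
    exact absurd (hrmax hsK) (not_le.mpr hs')
  obtain ⟨f, hf⟩ := geometric_hahn_banach_open_point hKconv.interior isOpen_interior hrint
  have hfpos : 0 < f (r • (u : E3)) := by simpa using hf 0 h0int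
  -- `f` takes its maximum on the zonotope at the boundary point
  have hfle : ∀ t ∈ B, f (A.zonotopeMap t) ≤ f (r • (u : E3)) := by
    intro t ht
    by_contra! hlt
    have hpos := hfpos.trans hlt
    have h1 := hf _ (hint t ht (f (r • (u : E3)) / f (A.zonotopeMap t)) (by positivity)
      ((div_lt_one hpos).mpr hlt))
    rw [map_smul, smul_eq_mul, div_mul_cancel₀ _ hpos.ne'] at h1
    exact h1.false
  set y : E3 := (InnerProductSpace.toDual ℝ E3).symm f with hy
  have hfy : ∀ z, f z = ⟪y, z⟫ := fun z => by
    rw [hy, InnerProductSpace.toDual_symm_apply]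
  have hy0 : y ≠ 0 := fun h => by
    rw [hfy, h, inner_zero_left] at hfpos
    exact hfpos.false
  obtain ⟨t, ht, htr⟩ := hrK
  simp only at htr
  have htk : ∀ k, ⟪A.nv k, y⟫ ≠ 0 → t k = Real.sign ⟪A.nv k, y⟫ := by
    intro k hk
    set s := Function.update t k (Real.sign ⟪A.nv k, y⟫) with hs
    have hsB : s ∈ B := by
      intro l _
      by_cases hl : l = k
      · subst hl
        rw [hs, Function.update_self]
        rcases lt_or_gt_of_ne hk with h | h
        · rw [Real.sign_of_neg h]; norm_num
        · rw [Real.sign_of_pos h]; norm_num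
      · rw [hs, Function.update_of_ne hl]; exact ht l trivial
    have h1 := hfle s hsB
    rw [← htr, hfy, hfy, inner_zonotopeMap, inner_zonotopeMap, ← sub_nonpos,
      ← Finset.sum_sub_distrib, Finset.sum_eq_single k] at h1
    · refine eq_sign_of_mul_sign_le hk (ht k trivial) ?_
      rw [hs, Function.update_self] at h1
      linarith
    · intro l _ hl
      rw [hs, Function.update_of_ne hl, sub_self]
    · simp
  have hr0 : 0 < r := by
    rw [map_smul, smul_eq_mul] at hfpos
    by_contra hneg
    have h0 : (0 : ℝ) ≤ r := hrmax (by simpa using interior_subset h0int)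
    have : r = 0 := le_antisymm (not_lt.mp hneg) h0
    rw [this, zero_mul] at hfpos
    exact hfpos.false
  refine ⟨⟨t, mem_points_of_isMaxOn hn (fun k => ht k trivial) hy0 htk⟩, Subtype.ext ?_⟩
  show ‖A.zonotopeMap t‖⁻¹ • A.zonotopeMap t = u
  rw [htr, norm_smul, hnorm, smul_smul, Real.norm_of_nonneg hr0.le,
    mul_one, inv_mul_cancel₀ hr0.ne', one_smul]

/-- A point of the glued surface, without its metric. -/
def ofGlued (x : A.Glued δ a) : A.Points := x

/-- The coordinates are continuous on the glued surface. -/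
theorem continuous_coords (h : A.Admissible δ a) :
    Continuous fun x : A.Glued δ a => (ofGlued x).1 := by
  obtain ⟨κ, hκ, hle⟩ := exists_mul_dist_le_len h
  refine LipschitzWith.continuous (K := (Real.toNNReal κ)⁻¹) fun x y => ?_
  have h1 : ENNReal.ofReal (κ * dist (ofGlued x).1 (ofGlued y).1) ≤ edist x y :=
    le_gdist fun ℓ hc => ofReal_mul_dist_le_chain h hκ hle hc
  rw [ENNReal.ofReal_mul hκ.le, ← edist_dist] at h1
  rw [ENNReal.coe_inv (Real.toNNReal_pos.mpr hκ).ne']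
  exact (ENNReal.mul_le_iff_le_inv (ENNReal.ofReal_pos.mpr hκ).ne' ENNReal.ofReal_ne_top).mp h1

/-- There are only finitely many quadrilaterals. -/
theorem finite_range_quad : (Set.range fun c : A.Crossing => A.quad c).Finite := by
  have hC : (Set.pi Set.univ fun _ : Fin n => ({-1, 0, 1} : Set ℝ)).Finite :=
    Set.Finite.pi fun _ => Set.toFinite _
  refine ((Set.toFinite (Set.univ : Set (Fin n × Fin n))).prod hC |>.image fun q =>
    {t : Fin n → ℝ | t q.1.1 ∈ Set.Icc (-1 : ℝ) 1 ∧ t q.1.2 ∈ Set.Icc (-1 : ℝ) 1 ∧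
      ∀ k, k ≠ q.1.1 → k ≠ q.1.2 → t k = q.2 k}).subset ?_
  rintro _ ⟨c, rfl⟩
  refine ⟨((c.i, c.j), A.code c.point), ⟨trivial, fun k _ => ?_⟩, rfl⟩
  rcases Real.sign_apply_eq ⟪A.nv k, c.point⟫ with h | h | h <;> simp [code_apply, h]

/-- The surface is the union of finitely many compact parallelograms. -/
theorem compactSpace_glued (h : A.Admissible δ a) : CompactSpace (A.Glued δ a) := by
  have hU : (Set.univ : Set (A.Glued δ a)) =
      ⋃ Q ∈ Set.range fun c : A.Crossing => A.quad c, {x | (ofGlued x).1 ∈ Q} := by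
    refine (Set.eq_univ_of_forall fun x => ?_).symm
    obtain ⟨c, hc⟩ := exists_mem_quad h.three_le (ofGlued x)
    exact Set.mem_biUnion (Set.mem_range_self c) hc
  refine ⟨?_⟩
  rw [hU]
  refine finite_range_quad.isCompact_biUnion ?_
  rintro _ ⟨c, rfl⟩
  have : CompactSpace (A.quad c) := isCompact_iff_compactSpace.mp (quad_isCompact c)
  let f : A.quad c → A.Glued δ a := fun t => A.ofQuad c t t.2
  have hf : Continuous f := by
    refine continuous_iff_continuousAt.mpr fun t => EMetric.tendsto_nhds.mpr fun ε hε => ?_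
    have h1 : Continuous fun s : A.quad c => ENNReal.ofReal (A.len δ a c.i c.j (s.1 - t.1)) :=
      ENNReal.continuous_ofReal.comp ((len_continuous _ _).comp (by fun_prop))
    have h2 := h1.continuousAt (x := t)
    have h3 : ∀ᶠ s in nhds t, ENNReal.ofReal (A.len δ a c.i c.j (s.1 - t.1)) < ε :=
      h2.eventually (gt_mem_nhds (by simpa [len_zero] using hε))
    filter_upwards [h3] with s hs
    exact (gdist_le_len h c s.2 t.2).trans_lt hs
  have himage : {x : A.Glued δ a | (ofGlued x).1 ∈ A.quad c} = Set.range f := by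
    ext x
    constructor
    · intro hx
      exact ⟨⟨(ofGlued x).1, hx⟩, rfl⟩
    · rintro ⟨t, rfl⟩
      exact t.2
  rw [himage]
  exact isCompact_range hf

theorem nonempty_homeomorph_sphere (h : A.Admissible δ a) : Nonempty (A.Glued δ a ≃ₜ S2) := by
  have := compactSpace_glued h
  have hn := h.three_le
  let e : A.Glued δ a ≃ S2 := Equiv.ofBijective (A.toSphere hn)
    ⟨toSphere_injective hn, toSphere_surjective hn⟩
  have he : Continuous e := by
    refine Continuous.subtype_mk ?_ _
    have h1 : Continuous fun x : A.Glued δ a => A.zonotopeMap (ofGlued x).1 :=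
      A.zonotopeMap.continuous_of_finiteDimensional.comp (continuous_coords h)
    exact (h1.norm.inv₀ fun x => norm_ne_zero_iff.mpr (zonotopeMap_ne_zero hn x)).smul h1
  exact ⟨he.homeoOfEquivCompactToT2⟩

/-! ### The antipodal map -/

theorem code_neg (x : S2) : A.code (-x) = -A.code x := by
  funext i
  have e : ((-x : S2) : E3) = -(x : E3) := rfl
  rw [code_apply, e, inner_neg_right, Real.sign_neg, Pi.neg_apply, code_apply]

theorem neg_mem_greatCircle {u x : S2} (h : x ∈ greatCircle u) : -x ∈ greatCircle u := by
  have e : ((-x : S2) : E3) = -(x : E3) := rfl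
  simp only [greatCircle, Set.mem_ofPred_eq] at h ⊢
  rw [e, inner_neg_right, h, neg_zero]

/-- The antipodal crossing. -/
def Crossing.antipode (c : A.Crossing) : A.Crossing :=
  ⟨-c.point, c.i, c.j, c.ne, neg_mem_greatCircle c.mem_i, neg_mem_greatCircle c.mem_j⟩

theorem neg_mem_quad {c : A.Crossing} {t : Fin n → ℝ} (ht : t ∈ A.quad c) :
    -t ∈ A.quad c.antipode := by
  refine ⟨?_, ?_, fun k hi hj => ?_⟩
  · have h := ht.1
    exact ⟨neg_le_neg h.2, (neg_le_neg h.1).trans_eq (neg_neg 1)⟩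
  · have h := ht.2.1
    exact ⟨neg_le_neg h.2, (neg_le_neg h.1).trans_eq (neg_neg 1)⟩
  · rw [Pi.neg_apply, ht.2.2 k hi hj]
    exact (congrFun (code_neg c.point) k).symm

/-- The antipodal map of the surface. -/
def antipode (x : A.Points) : A.Points :=
  ⟨-x.1, by
    rcases x.2 with ⟨q, hq, hx⟩ | ⟨c, hc⟩
    · refine Or.inl ⟨-q, fun i hi => hq i ?_, by rw [hx, code_neg]⟩
      simpa using neg_mem_greatCircle hi
    · exact Or.inr ⟨_, neg_mem_quad hc⟩⟩

theorem antipode_antipode (x : A.Points) : antipode (antipode x) = x :=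
  Subtype.ext (neg_neg _)

theorem Chain.antipode (h : A.Admissible δ a) {x y : A.Points} {ℓ : ℝ≥0∞} (hc : A.Chain δ a x y ℓ) :
    A.Chain δ a (LoopArrangement.antipode x) (LoopArrangement.antipode y) ℓ := by
  induction hc with
  | nil x => exact Chain.nil _
  | cons c x y z ℓ hx hy _ ih =>
    have := Chain.cons c.antipode (LoopArrangement.antipode x) (LoopArrangement.antipode y) _ ℓ
      (neg_mem_quad hx) (neg_mem_quad hy) ih
    rw [edist_place h] at this ⊢
    have e : -x.1 - -y.1 = -(x.1 - y.1) := by abel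
    have e2 : A.len δ a c.antipode.i c.antipode.j (-x.1 - -y.1) =
        A.len δ a c.i c.j (x.1 - y.1) := by rw [e, len_neg]; rfl
    rwa [show A.len δ a c.antipode.i c.antipode.j ((LoopArrangement.antipode x).1 -
      (LoopArrangement.antipode y).1) = A.len δ a c.i c.j (x.1 - y.1) from e2] at this

theorem gdist_antipode (h : A.Admissible δ a) (x y : A.Points) :
    A.gdist δ a (antipode x) (antipode y) = A.gdist δ a x y := by
  refine le_antisymm (le_gdist fun ℓ hc => gdist_le_of_chain (hc.antipode h))
    (le_gdist fun ℓ hc => gdist_le_of_chain ?_)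
  have := hc.antipode h
  rwa [antipode_antipode, antipode_antipode] at this

/-- The antipodal map as an isometry of the glued surface. -/
def antipodeEquiv (h : A.Admissible δ a) : A.Glued δ a ≃ᵢ A.Glued δ a where
  toFun := antipode (A := A)
  invFun := antipode (A := A)
  left_inv := antipode_antipode
  right_inv := antipode_antipode
  isometry_toFun := gdist_antipode h

theorem antipode_ne (hn : 3 ≤ n) (x : A.Points) : antipode x ≠ x := by
  intro h
  obtain ⟨c, hc⟩ := exists_mem_quad hn x
  obtain ⟨k, hi, hj⟩ := exists_ne_ne (I := Fin n) (by simpa using hn) c.i c.j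
  have h1 : -x.1 k = x.1 k := congrFun (congrArg Subtype.val h) k
  rcases eq_one_or_of_mem_quad hc hi hj with h2 | h2 <;> rw [h2] at h1 <;> norm_num at h1

/-! ### Cone neighbourhoods -/

theorem eq_of_gdist_eq_zero (h : A.Admissible δ a) {x y : A.Points} (hxy : A.gdist δ a x y = 0) :
    x = y := by
  obtain ⟨κ, hκ, hle⟩ := exists_mul_dist_le_len h
  have h1 : ENNReal.ofReal (κ * dist x.1 y.1) ≤ A.gdist δ a x y :=
    le_gdist fun ℓ hc => ofReal_mul_dist_le_chain h hκ hle hc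
  rw [hxy, nonpos_iff_eq_zero, ENNReal.ofReal_eq_zero] at h1
  have h2 : dist x.1 y.1 ≤ 0 := by
    by_contra hneg
    have := mul_pos hκ (not_le.mp hneg)
    linarith
  exact Subtype.ext (dist_le_zero.mp h2)

theorem coneDist_congr_left {θ r r' s : ℝ} {α α' β : AddCircle θ} (hs : 0 ≤ s)
    (h : r = r' ∧ (r = 0 ∨ α = α')) : coneDist r s ‖α - β‖ = coneDist r' s ‖α' - β‖ := by
  obtain ⟨rfl, rfl | rfl⟩ := h
  · rw [coneDist_zero_left hs, coneDist_zero_left hs]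
  · rfl

/-- Let `D` be a pseudodistance on the neighbourhood of radius `η` of `x` that is bounded by the
length in each parallelogram. Then a chain from `y` to `z` either stays in the neighbourhood, and
has at least the length `D y z`, or is long enough to leave the neighbourhood. -/
theorem ofReal_le_chain_or (h : A.Admissible δ a) {κ : ℝ} (hκ : 0 < κ)
    (hle : ∀ (c : A.Crossing) (x y : Fin n → ℝ), x ∈ A.quad c → y ∈ A.quad c →
      κ * dist x y ≤ A.len δ a c.i c.j (x - y)) {x : A.Points} {η : ℝ} {D : A.Points → A.Points → ℝ}
    (hD0 : ∀ y, D y y = 0) (hDtri : ∀ y z w, dist y.1 x.1 < η → dist z.1 x.1 < η →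
      dist w.1 x.1 < η → D y w ≤ D y z + D z w)
    (hDnonneg : ∀ y z, 0 ≤ D y z)
    (hDle : ∀ (c : A.Crossing) (y z : A.Points), y.1 ∈ A.quad c → z.1 ∈ A.quad c →
      dist y.1 x.1 < η → dist z.1 x.1 < η → D y z ≤ A.len δ a c.i c.j (y.1 - z.1))
    {y z : A.Points} {ℓ : ℝ≥0∞} (hc : A.Chain δ a y z ℓ) (hy : dist y.1 x.1 < η) :
    (dist z.1 x.1 < η ∧ ENNReal.ofReal (D y z) ≤ ℓ) ∨
      ENNReal.ofReal (κ * η) ≤ ℓ + ENNReal.ofReal (κ * dist y.1 x.1) := by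
  induction hc with
  | nil y => exact Or.inl ⟨hy, by rw [hD0]; simp⟩
  | cons c y y' z ℓ hyc hy'c _ ih =>
    rw [edist_place h]
    have hlen := hle c _ _ hyc hy'c
    have hstep : ENNReal.ofReal (κ * dist y'.1 x.1) ≤
        ENNReal.ofReal (A.len δ a c.i c.j (y.1 - y'.1)) + ENNReal.ofReal (κ * dist y.1 x.1) := by
      rw [← ENNReal.ofReal_add (len_nonneg _ _ _) (by positivity)]
      refine ENNReal.ofReal_le_ofReal ?_
      have := mul_le_mul_of_nonneg_left (dist_triangle_left y'.1 x.1 y.1) hκ.le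
      linarith
    rcases lt_or_ge (dist y'.1 x.1) η with hy' | hy'
    · rcases ih hy' with ⟨h1, h2⟩ | h2
      · left
        refine ⟨h1, (ENNReal.ofReal_le_ofReal (hDtri y y' z hy hy' h1)).trans ?_⟩
        rw [ENNReal.ofReal_add (hDnonneg _ _) (hDnonneg _ _)]
        exact add_le_add (ENNReal.ofReal_le_ofReal (hDle c y y' hyc hy'c hy hy')) h2
      · right
        refine h2.trans ((add_le_add le_rfl hstep).trans (le_of_eq ?_))
        rw [← add_assoc, add_comm ℓ]
    · right
      refine (ENNReal.ofReal_le_ofReal (mul_le_mul_of_nonneg_left hy' hκ.le)).trans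
        (hstep.trans ?_)
      gcongr
      exact le_self_add

/-- A neighbourhood of `x` is isometric to a cone of angle `θ` if its points have polar coordinates
in the cone, given as a relation `R`, such that the cone distance agrees with the distance in each
parallelogram, and such that the geodesics of the cone are realized by chains. -/
theorem hasConeAngle_of_rel (h : A.Admissible δ a) {x : A.Points} {θ η ε₀ : ℝ} (hθ : 0 < θ)
    (hη : 0 < η) (hε₀ : 0 < ε₀) (R : A.Points → ℝ → AddCircle θ → Prop)
    (hR0 : ∀ α, R x 0 α)
    (huniq : ∀ y r r' α α', R y r α → R y r' α' → r = r' ∧ (r = 0 ∨ α = α'))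
    (hcoord : ∀ y : A.Points, dist y.1 x.1 < η → ∃ r α, 0 ≤ r ∧ R y r α)
    (hlocal : ∀ (c : A.Crossing) (y z : A.Points), y.1 ∈ A.quad c → z.1 ∈ A.quad c →
      dist y.1 x.1 < η → dist z.1 x.1 < η → ∃ r α s β, R y r α ∧ R z s β ∧
        coneDist r s ‖α - β‖ ≤ A.len δ a c.i c.j (y.1 - z.1))
    (honto : ∀ r α, 0 ≤ r → r < ε₀ → ∃ y : A.Points, dist y.1 x.1 < η ∧ R y r α)
    (hupper : ∀ y z r s α β, 0 ≤ r → 0 ≤ s → r < ε₀ → s < ε₀ → R y r α → R z s β →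
      A.gdist δ a y z ≤ ENNReal.ofReal (coneDist r s ‖α - β‖)) :
    HasConeAngle (toGlued δ a x) θ := by
  classical
  obtain ⟨κ, hκ, hle⟩ := exists_mul_dist_le_len h
  choose! ρ A₀ hρ hRρ using hcoord
  set D : A.Points → A.Points → ℝ := fun y z => coneDist (ρ y) (ρ z) ‖A₀ y - A₀ z‖ with hD
  have hxη : dist x.1 x.1 < η := by rwa [dist_self]
  have hρx : ρ x = 0 := (huniq x _ _ _ 0 (hRρ x hxη) (hR0 0)).1
  -- the cone distance does not depend on the choice of coordinates
  have hDeq : ∀ y z r s α β, dist y.1 x.1 < η → dist z.1 x.1 < η → R y r α → R z s β →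
      D y z = coneDist r s ‖α - β‖ := by
    intro y z r s α β hy hz h1 h2
    have e1 := huniq y _ _ _ _ (hRρ y hy) h1
    have e2 := huniq z _ _ _ _ (hRρ z hz) h2
    have hr : 0 ≤ r := e1.1 ▸ hρ y hy
    simp only [hD]
    rw [coneDist_congr_left (hρ z hz) e1, coneDist_comm, norm_sub_rev, coneDist_congr_left hr e2,
      coneDist_comm, norm_sub_rev]
  have hchain : ∀ {y z : A.Points} {ℓ : ℝ≥0∞}, A.Chain δ a y z ℓ → dist y.1 x.1 < η →
      (dist z.1 x.1 < η ∧ ENNReal.ofReal (D y z) ≤ ℓ) ∨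
      ENNReal.ofReal (κ * η) ≤ ℓ + ENNReal.ofReal (κ * dist y.1 x.1) := by
    intro y z ℓ hc hy
    refine ofReal_le_chain_or h hκ hle (D := D) (fun y => ?_) (fun y z w hy hz hw => ?_)
      (fun y z => coneDist_nonneg _ _ _) (fun c y z hyc hzc hy hz => ?_) hc hy
    · simp only [hD, sub_self, norm_zero, coneDist_self]
    · refine coneDist_triangle (hρ y hy) (hρ z hz) (hρ w hw) (norm_nonneg _) (norm_nonneg _)
        (norm_nonneg _) ?_
      rw [← sub_add_sub_cancel (A₀ y) (A₀ z) (A₀ w)]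
      exact norm_add_le _ _
    · obtain ⟨r, α, s, β, h1, h2, h3⟩ := hlocal c y z hyc hzc hy hz
      rwa [hDeq y z r s α β hy hz h1 h2]
  have hκdist : ∀ y z : A.Points, ENNReal.ofReal (κ * dist y.1 z.1) ≤ A.gdist δ a y z := fun y z =>
    le_gdist fun ℓ hc => ofReal_mul_dist_le_chain h hκ hle hc
  set ε := min ε₀ (κ * η / 3) with hε
  have hκη : 0 < κ * η := mul_pos hκ hη
  have hεpos : 0 < ε := lt_min hε₀ (by positivity)
  have hε0 : ∀ {r}, r < ε → r < ε₀ := fun hr => hr.trans_le (min_le_left _ _)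
  have hε3 : 3 * ε ≤ κ * η := by
    have := min_le_right ε₀ (κ * η / 3)
    linarith
  -- a chain that starts close to `x` and leaves the neighbourhood is long
  have hlong : ∀ {ℓ : ℝ≥0∞} {d : ℝ}, d ≤ ε → 0 ≤ d →
      ENNReal.ofReal (κ * η) ≤ ℓ + ENNReal.ofReal d → ENNReal.ofReal (2 * ε) ≤ ℓ := by
    intro ℓ d hd hd0 hl
    have h1 : ENNReal.ofReal (2 * ε) + ENNReal.ofReal d ≤ ℓ + ENNReal.ofReal d := by
      refine le_trans ?_ hl
      rw [← ENNReal.ofReal_add (by positivity) hd0]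
      exact ENNReal.ofReal_le_ofReal (by linarith)
    exact (ENNReal.add_le_add_iff_right ENNReal.ofReal_ne_top).mp h1
  have hgx : ∀ y r α, 0 ≤ r → r < ε₀ → R y r α → A.gdist δ a y x ≤ ENNReal.ofReal r := by
    intro y r α hr hr' hy
    have := hupper y x r 0 α 0 hr le_rfl hr' hε₀ hy (hR0 0)
    rwa [coneDist_zero_right hr] at this
  let Φ : ℝ → AddCircle θ → A.Points := fun r α =>
    if hr : 0 ≤ r ∧ r < ε₀ then (honto r α hr.1 hr.2).choose else x
  have hΦ : ∀ r α, 0 ≤ r → r < ε₀ → dist (Φ r α).1 x.1 < η ∧ R (Φ r α) r α := by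
    intro r α hr hr'
    simp only [Φ, dif_pos (And.intro hr hr')]
    exact (honto r α hr hr').choose_spec
  refine ⟨hθ, ε, hεpos, Φ, fun α => ?_, ?_, ?_⟩
  · have h0 := hgx _ 0 α le_rfl hε₀ (hΦ 0 α le_rfl hε₀).2
    rw [ENNReal.ofReal_zero] at h0
    exact eq_of_gdist_eq_zero h (le_antisymm h0 bot_le)
  · rintro r ⟨hr0, hr⟩ s ⟨hs0, hs⟩ α β
    obtain ⟨hy, hRy⟩ := hΦ r α hr0 (hε0 hr)
    obtain ⟨hz, hRz⟩ := hΦ s β hs0 (hε0 hs)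
    refine le_antisymm (hupper _ _ r s α β hr0 hs0 (hε0 hr) (hε0 hs) hRy hRz)
      (le_gdist fun ℓ hc => ?_)
    rcases hchain hc hy with ⟨-, h1⟩ | h1
    · rwa [hDeq _ _ r s α β hy hz hRy hRz] at h1
    · have h2 := (hκdist (Φ r α) x).trans (hgx _ r α hr0 (hε0 hr) hRy)
      have h3 := (ENNReal.ofReal_le_ofReal_iff hr0).mp h2
      refine le_trans (ENNReal.ofReal_le_ofReal ?_) (hlong (by linarith) (by positivity) h1)
      have := coneDist_le_add hr0 hs0 (norm_nonneg (α - β))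
      linarith
  · intro y hyx
    have hyx' : A.gdist δ a y x < ENNReal.ofReal ε := hyx
    have h1 := (hκdist y x).trans_lt hyx'
    have h2 := (ENNReal.ofReal_lt_ofReal_iff hεpos).mp h1
    have hy : dist y.1 x.1 < η := by
      by_contra hneg
      have := mul_le_mul_of_nonneg_left (not_lt.mp hneg) hκ.le
      linarith
    have hρε : ρ y < ε := by
      by_contra hneg
      refine absurd hyx' (not_lt.mpr (le_gdist fun ℓ hc => ?_))
      rcases hchain hc hy with ⟨-, h3⟩ | h3
      · refine (ENNReal.ofReal_le_ofReal (not_lt.mp hneg)).trans ?_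
        simp only [hD, hρx] at h3
        rwa [coneDist_zero_right (hρ y hy)] at h3
      · exact (ENNReal.ofReal_le_ofReal (by linarith)).trans (hlong h2.le (by positivity) h3)
    refine ⟨ρ y, ⟨hρ y hy, hρε⟩, A₀ y, ?_⟩
    have h4 := hΦ (ρ y) (A₀ y) (hρ y hy) (hε0 hρε)
    have h5 := hupper _ _ _ _ _ _ (hρ y hy) (hρ y hy) (hε0 hρε) (hε0 hρε) h4.2 (hRρ y hy)
    rw [sub_self, norm_zero, coneDist_self, ENNReal.ofReal_zero] at h5
    exact eq_of_gdist_eq_zero h (le_antisymm h5 bot_le)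

theorem coneDist_addCircle_two_pi (r s α β : ℝ) :
    coneDist r s ‖(α : AddCircle (2 * π)) - (β : AddCircle (2 * π))‖ =
      ‖polar r α - polar s β‖ := by
  rw [norm_polar_sub_polar, coneDist, ← AddCircle.coe_sub]
  have h1 : ‖((α - β : ℝ) : AddCircle (2 * π))‖ ≤ π := by
    have := AddCircle.norm_le_half_period (2 * π) (x := ((α - β : ℝ) : AddCircle (2 * π)))
      (by positivity)
    rwa [abs_of_pos (by positivity), mul_div_cancel_left₀ _ two_ne_zero] at this
  rw [min_eq_left h1, AddCircle.norm_eq, Real.cos_abs, Real.cos_sub_int_mul_two_pi]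

theorem polar_eq_polar {r α β : ℝ} (hr : r ≠ 0) (h : polar r α = polar r β) :
    (α : AddCircle (2 * π)) = β := by
  rw [polar, polar] at h
  have h1 := mul_left_cancel₀ (Complex.ofReal_ne_zero.mpr hr) h
  obtain ⟨k, hk⟩ := Complex.exp_eq_exp_iff_exists_int.mp h1
  have h2 : α = β + k * (2 * π) := by
    have := congrArg Complex.im hk
    simpa [mul_assoc] using this
  rw [h2, AddCircle.coe_add]
  have : (((k : ℝ) * (2 * π) : ℝ) : AddCircle (2 * π)) = 0 := by
    exact (AddCircle.coe_eq_zero_iff _).mpr ⟨k, zsmul_eq_mul _ _⟩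
  rw [this, add_zero]

/-- A neighbourhood of `x` is flat if it can be developed into the plane. -/
theorem hasConeAngle_two_pi_of_dev (h : A.Admissible δ a) {x : A.Points} {η ε₀ : ℝ}
    (hη : 0 < η) (hε₀ : 0 < ε₀) (dev : A.Points → ℂ) (hx : dev x = 0)
    (hlocal : ∀ (c : A.Crossing) (y z : A.Points), y.1 ∈ A.quad c → z.1 ∈ A.quad c →
      dist y.1 x.1 < η → dist z.1 x.1 < η → ‖dev y - dev z‖ ≤ A.len δ a c.i c.j (y.1 - z.1))
    (honto : ∀ w : ℂ, ‖w‖ < ε₀ → ∃ y : A.Points, dist y.1 x.1 < η ∧ dev y = w)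
    (hupper : ∀ y z : A.Points, dist y.1 x.1 < η → dist z.1 x.1 < η → ‖dev y‖ < ε₀ →
      ‖dev z‖ < ε₀ → A.gdist δ a y z ≤ ENNReal.ofReal ‖dev y - dev z‖) :
    HasConeAngle (toGlued δ a x) (2 * π) := by
  have hxη : dist x.1 x.1 < η := by rwa [dist_self]
  have hpolar : ∀ w : ℂ, polar ‖w‖ w.arg = w := fun w => by
    rw [polar, Complex.norm_mul_exp_arg_mul_I]
  refine hasConeAngle_of_rel h Real.two_pi_pos hη hε₀ (fun y r α => 0 ≤ r ∧ dist y.1 x.1 < η ∧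
    ∃ t : ℝ, (t : AddCircle (2 * π)) = α ∧ dev y = polar r t) ?_ ?_ ?_ ?_ ?_ ?_
  · intro α
    obtain ⟨t, rfl⟩ := QuotientAddGroup.mk_surjective α
    exact ⟨le_rfl, hxη, t, rfl, by rw [hx, polar]; simp⟩
  · rintro y r r' α α' ⟨hr, -, t, rfl, e⟩ ⟨hr', -, t', rfl, e'⟩
    have h1 : r = r' := by rw [← norm_polar hr t, ← e, e', norm_polar hr']
    subst h1
    refine ⟨rfl, or_iff_not_imp_left.mpr fun h0 => polar_eq_polar h0 (e ▸ e')⟩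
  · intro y hy
    exact ⟨‖dev y‖, (dev y).arg, norm_nonneg _, norm_nonneg _, hy, _, rfl, (hpolar _).symm⟩
  · intro c y z hyc hzc hy hz
    refine ⟨‖dev y‖, (dev y).arg, ‖dev z‖, (dev z).arg, ⟨norm_nonneg _, hy, _, rfl, (hpolar _).symm⟩,
      ⟨norm_nonneg _, hz, _, rfl, (hpolar _).symm⟩, ?_⟩
    rw [coneDist_addCircle_two_pi, hpolar, hpolar]
    exact hlocal c y z hyc hzc hy hz
  · intro r α hr hr'
    obtain ⟨t, rfl⟩ := QuotientAddGroup.mk_surjective α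
    obtain ⟨y, hy, hw⟩ := honto (polar r t) (by rwa [norm_polar hr])
    exact ⟨y, hy, hr, hy, t, rfl, hw⟩
  · rintro y z r s α β hr hs hr' hs' ⟨-, hy, t, rfl, e⟩ ⟨-, hz, t', rfl, e'⟩
    rw [coneDist_addCircle_two_pi, ← e, ← e']
    exact hupper y z hy hz (by rwa [e, norm_polar hr]) (by rwa [e', norm_polar hs])

/-! ### Points in the interior of parallelograms and edges -/

/-- The length of a vector in a parallelogram bounds both of its coordinates. -/
theorem exists_mul_abs_le_len (h : A.Admissible δ a) : ∃ κ : ℝ, 0 < κ ∧ ∀ (i j : Fin n), i ≠ j →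
    ∀ w : Fin n → ℝ, κ * |w i| ≤ A.len δ a i j w ∧ κ * |w j| ≤ A.len δ a i j w := by
  obtain ⟨κ, hκ, hle⟩ := exists_pos_forall_le
    (f := fun p : {p : Fin n × Fin n // p.1 ≠ p.2} =>
      a p.1.1 / 2 * Real.sin (V.sepAngle δ (A.nv p.1.1) (A.nv p.1.2))) (fun p => by
        have h1 := A.sepAngle_sign h.deficit_pos h.sum_deficit h.three_le p.2 (Or.inl rfl)
          (Or.inl rfl)
        simp only [one_smul] at h1
        exact mul_pos (half_pos (h.length_pos _)) (Real.sin_pos_of_pos_of_lt_pi h1.1 h1.2.1))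
  have key : ∀ (i j : Fin n), i ≠ j → ∀ w : Fin n → ℝ, κ * |w i| ≤ A.len δ a i j w := by
    intro i j hij w
    refine le_trans ?_ (mul_sin_le_len h hij w)
    rw [mul_comm]
    exact mul_le_mul_of_nonneg_left (hle ⟨(i, j), hij⟩) (abs_nonneg _)
  exact ⟨κ, hκ, fun i j hij w => ⟨key i j hij w, len_comm (A := A) i j w ▸ key j i hij.symm w⟩⟩

/-- Close to `x`, only those parallelograms are met that contain `x`. -/
theorem exists_forall_matches (hn : 3 ≤ n) (x : A.Points) : ∃ η : ℝ, 0 < η ∧ η ≤ 1 ∧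
    (∀ k, x.1 k = 1 ∨ x.1 k = -1 ∨ η ≤ 1 - |x.1 k|) ∧
    ∀ (e : A.Crossing) (y : Fin n → ℝ), y ∈ A.quad e → dist y x.1 < η → Matches x.1 e := by
  classical
  obtain ⟨c, hc⟩ := exists_mem_quad hn x
  obtain ⟨η, hη, hle⟩ := exists_pos_forall_le
    (f := fun k => if x.1 k = 1 ∨ x.1 k = -1 then (1 : ℝ) else 1 - |x.1 k|) (fun k => by
      split_ifs with h
      · exact one_pos
      · push Not at h
        have h1 := mem_Icc_of_mem_quad hc k
        rw [sub_pos, abs_lt]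
        exact ⟨h1.1.lt_of_ne h.2.symm, h1.2.lt_of_ne h.1⟩)
  refine ⟨min η 1, lt_min hη one_pos, min_le_right _ _, fun k => ?_, fun e y hy hyx k hi hj => ?_⟩
  · have h1 := hle k
    split_ifs at h1 with h2
    · exact h2.elim Or.inl fun h => Or.inr (Or.inl h)
    · exact Or.inr (Or.inr ((min_le_left _ _).trans h1))
  · rw [← hy.2.2 k hi hj]
    have h0 := (dist_le_pi_dist y x.1 k).trans_lt hyx
    rw [Real.dist_eq] at h0
    have h1 := h0.trans_le ((min_le_left _ _).trans (hle k))
    have h2 := h0.trans_le (min_le_right η 1)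
    have h3 := eq_one_or_of_mem_quad hy hi hj
    split_ifs at h1 with h4
    · rw [abs_lt] at h2
      rcases h3 with h3 | h3 <;> rcases h4 with h4 | h4 <;> rw [h3, h4] at h2 ⊢ <;> norm_num at h2
    · exfalso
      have h5 := abs_sub_abs_le_abs_sub (y k) (x.1 k)
      have h6 : |y k| = 1 := by rcases h3 with h3 | h3 <;> rw [h3] <;> norm_num
      linarith

/-- A point of a parallelogram with prescribed coordinates. -/
theorem exists_point {x : Fin n → ℝ} {c : A.Crossing} (hc : Matches x c) {r s η : ℝ} (hη : 0 < η)
    (hr : r ∈ Set.Icc (-1 : ℝ) 1) (hs : s ∈ Set.Icc (-1 : ℝ) 1) (hrx : |r - x c.i| < η)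
    (hsx : |s - x c.j| < η) : ∃ y : A.Points, y.1 ∈ A.quad c ∧ y.1 c.i = r ∧ y.1 c.j = s ∧
      (∀ k, k ≠ c.i → k ≠ c.j → y.1 k = x k) ∧ dist y.1 x < η := by
  classical
  let t : Fin n → ℝ := fun k => if k = c.i then r else if k = c.j then s else x k
  have hti : t c.i = r := by simp [t]
  have htj : t c.j = s := by simp [t, c.ne.symm]
  have htk : ∀ k, k ≠ c.i → k ≠ c.j → t k = x k := fun k hi hj => by simp [t, hi, hj]
  have htq : t ∈ A.quad c := hc.mem_quad (by rwa [hti]) (by rwa [htj]) htk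
  refine ⟨A.ofQuad c t htq, htq, hti, htj, htk, (dist_pi_lt_iff hη).mpr fun k => ?_⟩
  show dist (t k) (x k) < η
  by_cases hi : k = c.i
  · rw [hi, hti]; exact hrx
  by_cases hj : k = c.j
  · rw [hj, htj]; exact hsx
  rw [htk k hi hj, dist_self]; exact hη

theorem norm_place_sub (h : A.Admissible δ a) (c : A.Crossing) (x y : Fin n → ℝ) :
    ‖A.place δ a c x - A.place δ a c y‖ = A.len δ a c.i c.j (x - y) := by
  have := edist_place h c x y
  rw [edist_dist, dist_eq_norm] at this
  exact (ENNReal.ofReal_eq_ofReal_iff (norm_nonneg _) (len_nonneg _ _ _)).mp this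

/-- Every complex number is a combination of `1` and `exp (ω * I)`. -/
theorem exists_add_mul_exp {ω : ℝ} (hω : Real.sin ω ≠ 0) (w : ℂ) :
    (((w.re - w.im / Real.sin ω * Real.cos ω : ℝ) : ℂ) +
      ((w.im / Real.sin ω : ℝ) : ℂ) * Complex.exp (ω * Complex.I)) = w := by
  apply Complex.ext
  · rw [Complex.add_re, Complex.ofReal_re, Complex.re_ofReal_mul, Complex.exp_ofReal_mul_I_re]
    ring
  · rw [Complex.add_im, Complex.ofReal_im, Complex.im_ofReal_mul, Complex.exp_ofReal_mul_I_im]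
    field_simp; ring

theorem sin_sepAngle_pos (h : A.Admissible δ a) {i j : Fin n} (hij : i ≠ j) :
    0 < Real.sin (V.sepAngle δ (A.nv i) (A.nv j)) := by
  have h1 := A.sepAngle_sign h.deficit_pos h.sum_deficit h.three_le hij (Or.inl rfl) (Or.inl rfl)
  simp only [one_smul] at h1
  exact Real.sin_pos_of_pos_of_lt_pi h1.1 h1.2.1

/-- The surface is flat in the interior of a parallelogram. -/
theorem hasConeAngle_of_mem_interior (h : A.Admissible δ a) {x : A.Points} {c : A.Crossing}
    (hc : x.1 ∈ A.quad c) (hi : x.1 c.i ∈ Set.Ioo (-1 : ℝ) 1) (hj : x.1 c.j ∈ Set.Ioo (-1 : ℝ) 1) :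
    HasConeAngle (toGlued δ a x) (2 * π) := by
  obtain ⟨η, hη, -, hηx, hmatch⟩ := exists_forall_matches h.three_le x
  obtain ⟨κ, hκ, hκle⟩ := exists_mul_abs_le_len h
  have hηk : ∀ k, x.1 k ∈ Set.Ioo (-1 : ℝ) 1 → η ≤ 1 - |x.1 k| := fun k hk => by
    rcases hηx k with h1 | h1 | h1
    · exact absurd h1 hk.2.ne
    · exact absurd h1 hk.1.ne'
    · exact h1
  have hmem : ∀ k (r : ℝ), x.1 k ∈ Set.Ioo (-1 : ℝ) 1 → |r - x.1 k| < η →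
      r ∈ Set.Icc (-1 : ℝ) 1 := by
    intro k r hk hr
    rw [Set.mem_Icc, ← abs_le]
    have := abs_sub_abs_le_abs_sub r (x.1 k)
    linarith [hηk k hk]
  -- a parallelogram close to `x` is dual to a crossing of the same loops
  have hfree : ∀ e : A.Crossing, Matches x.1 e → ∀ k, x.1 k ∈ Set.Ioo (-1 : ℝ) 1 →
      k = e.i ∨ k = e.j := by
    intro e he k hk
    by_contra! hne
    have h1 := he k hne.1 hne.2
    rcases code_eq_one_or (e.inner_ne_zero hne.1 hne.2) with h2 | h2 <;> rw [h2] at h1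
    · exact hk.2.ne h1
    · exact hk.1.ne' h1
  have hquad : ∀ (e : A.Crossing) (y : A.Points), y.1 ∈ A.quad e → dist y.1 x.1 < η →
      y.1 ∈ A.quad c ∧ ∀ w, A.len δ a e.i e.j w = A.len δ a c.i c.j w := by
    intro e y hy hyx
    have he := hmatch e _ hy hyx
    have hk : ∀ k, k ≠ e.i → k ≠ e.j → y.1 k = x.1 k := fun k h1 h2 => he.apply_eq hy h1 h2
    have hmc : Matches x.1 c := matches_of_mem hc
    rcases hfree e he _ hi with h1 | h1 <;> rcases hfree e he _ hj with h2 | h2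
    · exact absurd (h1.trans h2.symm) c.ne
    · refine ⟨hmc.mem_quad (h1 ▸ hy.1) (h2 ▸ hy.2.1) (by rw [h1, h2]; exact hk), fun w => ?_⟩
      rw [h1, h2]
    · refine ⟨hmc.mem_quad (h1 ▸ hy.2.1) (h2 ▸ hy.1)
        (by rw [h1, h2]; exact fun k a b => hk k b a), fun w => ?_⟩
      rw [h1, h2, len_comm]
    · exact absurd (h1.trans h2.symm) c.ne
  refine hasConeAngle_two_pi_of_dev h hη (mul_pos hκ hη)
    (fun y => A.place δ a c y.1 - A.place δ a c x.1) (sub_self _) ?_ ?_ ?_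
  · intro e y z hy hz hyx hzx
    rw [sub_sub_sub_cancel_right, norm_place_sub h, (hquad e y hy hyx).2]
  · intro w hw
    have hsin := sin_sepAngle_pos h c.ne
    set ω := V.sepAngle δ (A.nv c.i) (A.nv c.j) with hω
    have hai := h.length_pos c.i
    have haj := h.length_pos c.j
    set r := x.1 c.i + 2 / a c.i * (w.re - w.im / Real.sin ω * Real.cos ω) with hr
    set s := x.1 c.j + 2 / a c.j * (w.im / Real.sin ω) with hs
    have hplace : ∀ y : Fin n → ℝ, y c.i = r → y c.j = s →
        A.place δ a c y - A.place δ a c x.1 = w := by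
      intro y h1 h2
      rw [← exists_add_mul_exp hsin.ne' w, place, place, A.cornerAngle_eq_sepAngle δ h.sum_deficit,
        h1, h2, ← hω]
      have e1 : r * a c.i / 2 = x.1 c.i * a c.i / 2 + (w.re - w.im / Real.sin ω * Real.cos ω) := by
        rw [hr]; field_simp
      have e2 : s * a c.j / 2 = x.1 c.j * a c.j / 2 + w.im / Real.sin ω := by
        rw [hs]; field_simp
      rw [e1, e2]
      push_cast; ring
    have hbound : |r - x.1 c.i| < η ∧ |s - x.1 c.j| < η := by
      let y : Fin n → ℝ := Function.update (Function.update x.1 c.i r) c.j s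
      have hyi : y c.i = r := by simp [y, c.ne]
      have hyj : y c.j = s := by simp [y]
      have h1 := hκle c.i c.j c.ne (y - x.1)
      rw [← norm_place_sub h, hplace y hyi hyj, Pi.sub_apply, Pi.sub_apply, hyi, hyj] at h1
      exact ⟨lt_of_mul_lt_mul_left (h1.1.trans_lt hw) hκ.le,
        lt_of_mul_lt_mul_left (h1.2.trans_lt hw) hκ.le⟩
    obtain ⟨y, -, hyi, hyj, -, hyx⟩ := exists_point (matches_of_mem hc) hη (hmem _ r hi hbound.1)
      (hmem _ s hj hbound.2) hbound.1 hbound.2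
    exact ⟨y, hyx, hplace _ hyi hyj⟩
  · intro y z hyx hzx _ _
    obtain ⟨e, he⟩ := exists_mem_quad h.three_le y
    obtain ⟨e', he'⟩ := exists_mem_quad h.three_le z
    rw [sub_sub_sub_cancel_right, norm_place_sub h]
    exact gdist_le_len h c (hquad e y he hyx).1 (hquad e' z he' hzx).1

/-- The half-plane coordinates `U + W * exp (ω * I)` of a parallelogram at an edge transverse to
the loop `i`: here `W` is the distance from the edge, measured along the other edges. -/
theorem len_eq_norm_of_edge (h : A.Admissible δ a) {i j : Fin n} (hij : i ≠ j) {s : ℝ}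
    (hs : s = 1 ∨ s = -1) (w : Fin n → ℝ) (σ : ℝ) (hσ : σ = 1 ∨ σ = -1) :
    A.len δ a i j w = ‖(((w i * a i / 2 : ℝ) : ℂ) + ((-s * w j * a j / 2 : ℝ) : ℂ) *
      Complex.exp (((σ * V.sepAngle δ (A.nv i) (-s • A.nv j) : ℝ) : ℂ) * Complex.I))‖ := by
  have h1 := A.sepAngle_sign h.deficit_pos h.sum_deficit h.three_le hij (Or.inl rfl)
    (t := -s) (by rcases hs with rfl | rfl <;> simp)
  rw [one_smul] at h1
  have h2 : s ^ 2 = 1 := by rcases hs with rfl | rfl <;> norm_num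
  have h3 : Real.cos (σ * V.sepAngle δ (A.nv i) (-s • A.nv j)) =
      Real.cos (V.sepAngle δ (A.nv i) (-s • A.nv j)) := by
    rcases hσ with rfl | rfl
    · rw [one_mul]
    · rw [neg_one_mul, Real.cos_neg]
  rw [norm_add_mul_exp, h3, h1.2.2, len]
  congr 1
  linear_combination (-(w j * a j / 2) ^ 2 - 2 * (w i * a i / 2) * (w j * a j / 2) *
    Real.cos (V.sepAngle δ (A.nv i) (A.nv j))) * h2

/-- A segment from the upper to the lower half-plane meets the real axis. -/
theorem exists_mem_segment_im_eq_zero {u v : ℂ} (hu : 0 ≤ u.im) (hv : v.im ≤ 0) :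
    ∃ w ∈ segment ℝ u v, w.im = 0 := by
  refine ⟨AffineMap.lineMap u v (u.im / (u.im - v.im)), ?_, ?_⟩
  · refine (convex_segment u v).lineMap_mem (left_mem_segment ℝ u v) (right_mem_segment ℝ u v)
      ⟨div_nonneg hu (by linarith), div_le_one_of_le₀ (by linarith) (by linarith)⟩
  · rw [AffineMap.lineMap_apply_module]
    simp only [Complex.add_im, Complex.smul_im, smul_eq_mul]
    rcases eq_or_ne (u.im - v.im) 0 with h | h
    · have : u.im = 0 := by linarith
      have h2 : v.im = 0 := by linarith
      rw [this, h2]; ring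
    · field_simp; ring

/-- The surface is flat in the interior of an edge of the dual graph: two half-disks are glued. -/
theorem hasConeAngle_of_mem_edge (h : A.Admissible δ a) {x : A.Points} {c₀ : A.Crossing}
    (hc₀ : x.1 ∈ A.quad c₀) (hi : x.1 c₀.i ∈ Set.Ioo (-1 : ℝ) 1)
    (hk : ∀ k, k ≠ c₀.i → x.1 k = 1 ∨ x.1 k = -1) :
    HasConeAngle (toGlued δ a x) (2 * π) := by
  obtain ⟨p, hp1, hp2⟩ := exists_interior_of_edge h.three_le (matches_of_mem hc₀) hk
  obtain ⟨c, d, hci, hdi, hcd, hc, hd, hends⟩ := exists_ends_of_arc h.three_le hk hp1 hp2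
  generalize c₀.i = i at hi hk hp1 hp2 hci hdi hends
  clear hc₀
  obtain ⟨η, hη, hη1, hηx, hmatch⟩ := exists_forall_matches h.three_le x
  obtain ⟨κ, hκ, hκle⟩ := exists_mul_abs_le_len h
  have hηi : η ≤ 1 - |x.1 i| := by
    rcases hηx i with h1 | h1 | h1
    · exact absurd h1 hi.2.ne
    · exact absurd h1 hi.1.ne'
    · exact h1
  have hcj : c.j ≠ i := fun e => c.ne (hci.trans e.symm)
  have hdj : d.j ≠ i := fun e => d.ne (hdi.trans e.symm)
  -- a parallelogram close to `x` is one of the two on the sides of the edge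
  have hquad : ∀ (e : A.Crossing) (y : A.Points), y.1 ∈ A.quad e → dist y.1 x.1 < η →
      (y.1 ∈ A.quad c ∧ (∀ z : A.Points, z.1 ∈ A.quad e → dist z.1 x.1 < η → z.1 ∈ A.quad c) ∧
        ∀ w, A.len δ a e.i e.j w = A.len δ a i c.j w) ∨
      (y.1 ∈ A.quad d ∧ (∀ z : A.Points, z.1 ∈ A.quad e → dist z.1 x.1 < η → z.1 ∈ A.quad d) ∧
        ∀ w, A.len δ a e.i e.j w = A.len δ a i d.j w) := by
    have key : ∀ e : A.Crossing, e.i = i → Matches x.1 e → ∀ f : A.Crossing, f.i = i →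
        Matches x.1 f → e.j = f.j → (∀ z : A.Points, z.1 ∈ A.quad e → z.1 ∈ A.quad f) ∧
          ∀ w, A.len δ a e.i e.j w = A.len δ a i f.j w := by
      intro e hei he f hfi hf hef
      refine ⟨fun z hz => hf.mem_quad ?_ ?_ ?_, fun w => by rw [hei, hef]⟩
      · rw [hfi, ← hei]; exact hz.1
      · rw [← hef]; exact hz.2.1
      · rw [hfi, ← hei, ← hef]; exact fun k h1 h2 => he.apply_eq hz h1 h2
    have main : ∀ e : A.Crossing, e.i = i → Matches x.1 e →
        ((∀ z : A.Points, z.1 ∈ A.quad e → z.1 ∈ A.quad c) ∧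
          ∀ w, A.len δ a e.i e.j w = A.len δ a i c.j w) ∨
        ((∀ z : A.Points, z.1 ∈ A.quad e → z.1 ∈ A.quad d) ∧
          ∀ w, A.len δ a e.i e.j w = A.len δ a i d.j w) := by
      intro e hei he
      rcases hends e hei he with h1 | h1
      · exact Or.inl (key e hei he c hci hc h1)
      · exact Or.inr (key e hei he d hdi hd h1)
    intro e y hy hyx
    have he := hmatch e _ hy hyx
    by_cases h1 : e.i = i
    · rcases main e h1 he with h2 | h2
      · exact Or.inl ⟨h2.1 y hy, fun z hz _ => h2.1 z hz, h2.2⟩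
      · exact Or.inr ⟨h2.1 y hy, fun z hz _ => h2.1 z hz, h2.2⟩
    by_cases h2 : e.j = i
    · have h3 : ∀ w, A.len δ a e.i e.j w = A.len δ a e.swap.i e.swap.j w := fun w => len_comm _ _ _
      rcases main e.swap h2 he.swap with h4 | h4 <;> rw [quad_swap] at h4
      · exact Or.inl ⟨h4.1 y hy, fun z hz _ => h4.1 z hz, fun w => (h3 w).trans (h4.2 w)⟩
      · exact Or.inr ⟨h4.1 y hy, fun z hz _ => h4.1 z hz, fun w => (h3 w).trans (h4.2 w)⟩
    · exfalso
      have h3 := he i (Ne.symm h1) (Ne.symm h2)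
      rcases code_eq_one_or (e.inner_ne_zero (Ne.symm h1) (Ne.symm h2)) with h4 | h4 <;>
        rw [h4] at h3
      · exact hi.2.ne h3
      · exact hi.1.ne' h3
  -- the development: one parallelogram into the upper, the other into the lower half-plane
  let term : Fin n → ℝ → (Fin n → ℝ) → ℂ := fun j σ y =>
    ((-x.1 j * (y j - x.1 j) * a j / 2 : ℝ) : ℂ) *
    Complex.exp (((σ * V.sepAngle δ (A.nv i) (-x.1 j • A.nv j) : ℝ) : ℂ) * Complex.I)
  let dev : (Fin n → ℝ) → ℂ := fun y => (((y i - x.1 i) * a i / 2 : ℝ) : ℂ) + term c.j 1 y +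
    term d.j (-1) y
  have hterm : ∀ j σ (y : Fin n → ℝ), y j = x.1 j → term j σ y = 0 := fun j σ y hy => by
    simp [term, hy]
  have hdevc : ∀ y : Fin n → ℝ, y d.j = x.1 d.j →
      dev y = (((y i - x.1 i) * a i / 2 : ℝ) : ℂ) + term c.j 1 y := fun y hy => by
    simp only [dev, hterm d.j _ y hy, add_zero]
  have hdevd : ∀ y : Fin n → ℝ, y c.j = x.1 c.j →
      dev y = (((y i - x.1 i) * a i / 2 : ℝ) : ℂ) + term d.j (-1) y := fun y hy => by
    simp only [dev, hterm c.j _ y hy, add_zero]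
  have hnorm : ∀ j, j ≠ i → ∀ σ : ℝ, (σ = 1 ∨ σ = -1) → ∀ y z : Fin n → ℝ,
      ‖((((y i - x.1 i) * a i / 2 : ℝ) : ℂ) + term j σ y) -
        ((((z i - x.1 i) * a i / 2 : ℝ) : ℂ) + term j σ z)‖ = A.len δ a i j (y - z) := by
    intro j hj σ hσ y z
    rw [len_eq_norm_of_edge h hj.symm (hk j hj) _ σ hσ]
    congr 1
    simp only [term, Pi.sub_apply]
    push_cast; ring
  have hyc : ∀ y : Fin n → ℝ, y ∈ A.quad c → y d.j = x.1 d.j := fun y hy =>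
    hc.apply_eq hy (by rw [hci]; exact hdj) hcd.symm
  have hyd : ∀ y : Fin n → ℝ, y ∈ A.quad d → y c.j = x.1 c.j := fun y hy =>
    hd.apply_eq hy (by rw [hdi]; exact hcj) hcd
  have hnormc : ∀ y z : Fin n → ℝ, y ∈ A.quad c → z ∈ A.quad c →
      ‖dev y - dev z‖ = A.len δ a i c.j (y - z) := fun y z hy hz => by
    rw [hdevc y (hyc y hy), hdevc z (hyc z hz), hnorm c.j hcj 1 (Or.inl rfl)]
  have hnormd : ∀ y z : Fin n → ℝ, y ∈ A.quad d → z ∈ A.quad d →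
      ‖dev y - dev z‖ = A.len δ a i d.j (y - z) := fun y z hy hz => by
    rw [hdevd y (hyd y hy), hdevd z (hyd z hz), hnorm d.j hdj (-1) (Or.inr rfl)]
  have hsin : ∀ j, j ≠ i → 0 < Real.sin (V.sepAngle δ (A.nv i) (-x.1 j • A.nv j)) := by
    intro j hj
    have h1 := A.sepAngle_sign h.deficit_pos h.sum_deficit h.three_le hj.symm (Or.inl rfl)
      (t := -x.1 j) (by rcases hk j hj with h1 | h1 <;> rw [h1] <;> simp)
    rw [one_smul] at h1
    exact Real.sin_pos_of_pos_of_lt_pi h1.1 h1.2.1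
  have hsq : ∀ j, j ≠ i → x.1 j * x.1 j = 1 := fun j hj => by
    rcases hk j hj with h1 | h1 <;> rw [h1] <;> norm_num
  -- every point of the closed half-plane close to the origin is attained
  have honto : ∀ f : A.Crossing, f.i = i → f.j ≠ i → Matches x.1 f → ∀ σ : ℝ, (σ = 1 ∨ σ = -1) →
      ∀ w : ℂ, ‖w‖ < κ * η → 0 ≤ σ * w.im → ∃ y : A.Points, y.1 ∈ A.quad f ∧
        dist y.1 x.1 < η ∧ (((y.1 i - x.1 i) * a i / 2 : ℝ) : ℂ) + term f.j σ y.1 = w ∧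
        (w.im = 0 → y.1 f.j = x.1 f.j) := by
    intro f hfi hfj hf σ hσ w hw him
    set ω := V.sepAngle δ (A.nv i) (-x.1 f.j • A.nv f.j) with hω
    have hs := hsin f.j hfj
    rw [← hω] at hs
    have hσσ : σ * σ = 1 := by rcases hσ with rfl | rfl <;> norm_num
    have hsinσ : Real.sin (σ * ω) = σ * Real.sin ω := by
      rcases hσ with rfl | rfl
      · rw [one_mul, one_mul]
      · rw [neg_one_mul, Real.sin_neg, neg_one_mul]
    have hsσ0 : Real.sin (σ * ω) ≠ 0 := by
      rw [hsinσ]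
      rcases hσ with rfl | rfl
      · simpa using hs.ne'
      · simpa using hs.ne'
    have hai := h.length_pos i
    have haj := h.length_pos f.j
    set W := w.im / Real.sin (σ * ω) with hW
    have hW0 : 0 ≤ W := by
      have : W = σ * w.im / Real.sin ω := by
        rw [hW, hsinσ, div_eq_div_iff (hsinσ ▸ hsσ0) hs.ne']
        linear_combination (- w.im * Real.sin ω) * hσσ
      rw [this]; positivity
    set r := x.1 i + 2 / a i * (w.re - W * Real.cos (σ * ω)) with hr
    set s := x.1 f.j - x.1 f.j * (2 / a f.j * W) with hs'
    have hval : ∀ y : Fin n → ℝ, y i = r → y f.j = s →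
        (((y i - x.1 i) * a i / 2 : ℝ) : ℂ) + term f.j σ y = w := by
      intro y h1 h2
      rw [← exists_add_mul_exp hsσ0 w]
      simp only [term]
      rw [h1, h2, ← hω, ← hW]
      have e1 : (r - x.1 i) * a i / 2 = w.re - W * Real.cos (σ * ω) := by
        rw [hr]; field_simp; ring
      have e2 : -x.1 f.j * (s - x.1 f.j) * a f.j / 2 = W := by
        rw [hs']
        have h3 := hsq f.j hfj
        have : -x.1 f.j * (x.1 f.j - x.1 f.j * (2 / a f.j * W) - x.1 f.j) * a f.j / 2 =
            (x.1 f.j * x.1 f.j) * W := by field_simp; ring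
        rw [this, h3, one_mul]
      rw [e1, e2]
    have hbound : |r - x.1 i| < η ∧ |s - x.1 f.j| < η := by
      let y : Fin n → ℝ := Function.update (Function.update x.1 i r) f.j s
      have hyi : y i = r := by simp [y, hfj.symm]
      have hyj : y f.j = s := by simp [y]
      have h1 := hκle i f.j hfj.symm (y - x.1)
      have h2 := hnorm f.j hfj σ hσ y x.1
      rw [hval y hyi hyj, hterm f.j σ x.1 rfl, sub_self] at h2
      simp only [zero_mul, zero_div, Complex.ofReal_zero, add_zero, sub_zero] at h2
      rw [← h2, Pi.sub_apply, Pi.sub_apply, hyi, hyj] at h1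
      exact ⟨lt_of_mul_lt_mul_left (h1.1.trans_lt hw) hκ.le,
        lt_of_mul_lt_mul_left (h1.2.trans_lt hw) hκ.le⟩
    have hr1 : r ∈ Set.Icc (-1 : ℝ) 1 := by
      rw [Set.mem_Icc, ← abs_le]
      have := abs_sub_abs_le_abs_sub r (x.1 i)
      linarith [hbound.1]
    have hs1 : s ∈ Set.Icc (-1 : ℝ) 1 := by
      have h0 : 0 ≤ 2 / a f.j * W := by positivity
      have h1 : |2 / a f.j * W| < 1 := by
        have h2 := hbound.2.trans_le hη1
        have h3 : s - x.1 f.j = -x.1 f.j * (2 / a f.j * W) := by rw [hs']; ring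
        rw [h3, abs_mul, abs_neg] at h2
        rcases hk f.j hfj with h4 | h4 <;> rw [h4] at h2 <;> simpa using h2
      rw [abs_of_nonneg h0] at h1
      rw [hs']
      rcases hk f.j hfj with h4 | h4 <;> rw [h4] <;> constructor <;> linarith
    obtain ⟨y, hyq, hyi, hyj, -, hyx⟩ := exists_point hf hη hr1 hs1 (by rw [hfi]; exact hbound.1)
      hbound.2
    rw [hfi] at hyi
    refine ⟨y, hyq, hyx, hval _ hyi hyj, fun h0 => ?_⟩
    rw [hyj, hs', hW, h0]; simp
  have hontoc : ∀ w : ℂ, ‖w‖ < κ * η → 0 ≤ w.im → ∃ y : A.Points, y.1 ∈ A.quad c ∧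
      dist y.1 x.1 < η ∧ dev y.1 = w ∧ (w.im = 0 → y.1 ∈ A.quad d) := by
    intro w hw him
    obtain ⟨y, h1, h2, h3, h4⟩ := honto c hci hcj hc 1 (Or.inl rfl) w hw (by rwa [one_mul])
    refine ⟨y, h1, h2, (hdevc _ (hyc _ h1)).trans h3,
      fun h0 => hd.mem_quad ?_ ?_ fun k hk1 hk2 => ?_⟩
    · rw [hdi, ← hci]; exact h1.1
    · exact mem_Icc_of_mem_quad h1 _
    · by_cases hkc : k = c.j
      · rw [hkc]; exact h4 h0
      · exact hc.apply_eq h1 (by rw [hci, ← hdi]; exact hk1) hkc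
  have hontod : ∀ w : ℂ, ‖w‖ < κ * η → w.im ≤ 0 → ∃ y : A.Points, y.1 ∈ A.quad d ∧
      dist y.1 x.1 < η ∧ dev y.1 = w := by
    intro w hw him
    obtain ⟨y, h1, h2, h3, -⟩ := honto d hdi hdj hd (-1) (Or.inr rfl) w hw (by linarith)
    exact ⟨y, h1, h2, (hdevd _ (hyd _ h1)).trans h3⟩
  have himc : ∀ y : Fin n → ℝ, y ∈ A.quad c → 0 ≤ (dev y).im := by
    intro y hy
    rw [hdevc y (hyc y hy)]
    simp only [term, Complex.add_im, Complex.ofReal_im, Complex.im_ofReal_mul,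
      Complex.exp_ofReal_mul_I_im, one_mul, zero_add]
    have h1 := mem_Icc_of_mem_quad hy c.j
    have h2 := h.length_pos c.j
    refine mul_nonneg (div_nonneg (mul_nonneg ?_ h2.le) zero_le_two) (hsin c.j hcj).le
    rcases hk c.j hcj with h3 | h3 <;> rw [h3] <;> linarith [h1.1, h1.2]
  have himd : ∀ y : Fin n → ℝ, y ∈ A.quad d → (dev y).im ≤ 0 := by
    intro y hy
    rw [hdevd y (hyd y hy)]
    simp only [term, Complex.add_im, Complex.ofReal_im, Complex.im_ofReal_mul,
      Complex.exp_ofReal_mul_I_im, neg_one_mul, zero_add, Real.sin_neg, mul_neg]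
    have h1 := mem_Icc_of_mem_quad hy d.j
    have h2 := h.length_pos d.j
    refine neg_nonpos.mpr (mul_nonneg (div_nonneg (mul_nonneg ?_ h2.le) zero_le_two)
      (hsin d.j hdj).le)
    rcases hk d.j hdj with h3 | h3 <;> rw [h3] <;> linarith [h1.1, h1.2]
  have hgc : ∀ y z : A.Points, y.1 ∈ A.quad c → z.1 ∈ A.quad c →
      A.gdist δ a y z ≤ ENNReal.ofReal ‖dev y.1 - dev z.1‖ := fun y z hy hz => by
    rw [hnormc _ _ hy hz, ← hci]; exact gdist_le_len h c hy hz
  have hgd : ∀ y z : A.Points, y.1 ∈ A.quad d → z.1 ∈ A.quad d →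
      A.gdist δ a y z ≤ ENNReal.ofReal ‖dev y.1 - dev z.1‖ := fun y z hy hz => by
    rw [hnormd _ _ hy hz, ← hdi]; exact gdist_le_len h d hy hz
  -- a segment between the two half-planes crosses the edge, whose points lie in both parallelograms
  have hmixed : ∀ y z : A.Points, y.1 ∈ A.quad c → z.1 ∈ A.quad d → ‖dev y.1‖ < κ * η →
      ‖dev z.1‖ < κ * η → A.gdist δ a y z ≤ ENNReal.ofReal ‖dev y.1 - dev z.1‖ := by
    intro y z hy hz hyn hzn
    obtain ⟨w, hw, hw0⟩ := exists_mem_segment_im_eq_zero (himc _ hy) (himd _ hz)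
    have hwn : ‖w‖ < κ * η := by
      have := (convex_ball (0 : ℂ) (κ * η)).segment_subset (mem_ball_zero_iff.mpr hyn)
        (mem_ball_zero_iff.mpr hzn) hw
      exact mem_ball_zero_iff.mp this
    obtain ⟨v, hv1, -, hv2, hv3⟩ := hontoc w hwn hw0.ge
    refine (gdist_triangle y v z).trans ((add_le_add (hgc y v hy hv1) (hgd v z (hv3 hw0) hz)).trans
      (le_of_eq ?_))
    rw [← ENNReal.ofReal_add (norm_nonneg _) (norm_nonneg _), hv2]
    have := dist_add_dist_of_mem_segment hw
    simp only [dist_eq_norm] at this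
    rw [this]
  refine hasConeAngle_two_pi_of_dev h hη (mul_pos hκ hη) (fun y => dev y.1) ?_ ?_ ?_ ?_
  · simp [dev, term]
  · intro e y z hy hz hyx hzx
    rcases hquad e y hy hyx with ⟨h1, h2, h3⟩ | ⟨h1, h2, h3⟩
    · rw [h3, hnormc _ _ h1 (h2 z hz hzx)]
    · rw [h3, hnormd _ _ h1 (h2 z hz hzx)]
  · intro w hw
    rcases le_total 0 w.im with h0 | h0
    · obtain ⟨y, -, h1, h2, -⟩ := hontoc w hw h0
      exact ⟨y, h1, h2⟩
    · obtain ⟨y, -, h1, h2⟩ := hontod w hw h0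
      exact ⟨y, h1, h2⟩
  · intro y z hyx hzx hyn hzn
    obtain ⟨e, he⟩ := exists_mem_quad h.three_le y
    obtain ⟨f, hf⟩ := exists_mem_quad h.three_le z
    rcases hquad e y he hyx with ⟨h1, -, -⟩ | ⟨h1, -, -⟩ <;>
      rcases hquad f z hf hzx with ⟨h2, -, -⟩ | ⟨h2, -, -⟩
    · exact hgc y z h1 h2
    · exact hmixed y z h1 h2 hyn hzn
    · rw [gdist_comm, norm_sub_rev]; exact hmixed z y h2 h1 hzn hyn
    · exact hgd y z h1 h2

end LoopArrangement

/-! ### Sectors that form a cone -/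

/-- Planar sectors of angles `ω 0, ω 1, …, ω (M - 1)` that are glued cyclically to a cone; the ray
between the sectors `r - 1` and `r` is labeled `b r`. The indices are continued periodically. -/
structure Fan (I : Type*) where
  M : ℕ
  b : ℕ → I
  ω : ℕ → ℝ
  three_le : 3 ≤ M
  periodic : ∀ r, b (r + M) = b r
  modEq_of_eq : ∀ r s, b r = b s → r ≡ s [MOD M]
  ω_periodic : ∀ r, ω (r + M) = ω r
  ω_pos : ∀ r, 0 < ω r
  ω_lt : ∀ r, ω r < π

namespace Fan

variable {I : Type*} (F : Fan I)

/-- The angle at which the sector `r` begins. -/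
def start (r : ℕ) : ℝ := ∑ q ∈ Finset.range r, F.ω q

/-- The angle of the cone. -/
def angle : ℝ := F.start F.M

/-- The vector `u` gives the oblique coordinates, with respect to the two rays that bound the sector
`r`, of the point of this sector with polar coordinates `ρ` and `t`. -/
structure Sector (u : I → ℝ) (ρ : ℝ) (r : ℕ) (t : ℝ) : Prop where
  nonneg : 0 ≤ ρ
  zero_le : 0 ≤ t
  le : t ≤ F.ω r
  left : u (F.b r) * Real.sin (F.ω r) = ρ * Real.sin (F.ω r - t)
  right : u (F.b (r + 1)) * Real.sin (F.ω r) = ρ * Real.sin t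
  other : ∀ k, k ≠ F.b r → k ≠ F.b (r + 1) → u k = 0

theorem start_zero : F.start 0 = 0 := rfl

theorem start_succ (r : ℕ) : F.start (r + 1) = F.start r + F.ω r := Finset.sum_range_succ _ _

theorem start_strictMono : StrictMono F.start :=
  strictMono_nat_of_lt_succ fun r => by rw [start_succ]; linarith [F.ω_pos r]

theorem angle_pos : 0 < F.angle := by
  have h := F.start_strictMono (show 0 < F.M by have := F.three_le; omega)
  rwa [start_zero] at h

theorem start_add_M (r : ℕ) : F.start (r + F.M) = F.start r + F.angle := by
  induction r with
  | zero => rw [zero_add, start_zero, zero_add, angle]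
  | succ r ih => rw [start_succ, show r + 1 + F.M = r + F.M + 1 by ring, start_succ, ih,
      F.ω_periodic]; ring

theorem b_add_mul (r j : ℕ) : F.b (r + j * F.M) = F.b r := by
  induction j with
  | zero => simp
  | succ j ih => rw [show r + (j + 1) * F.M = r + j * F.M + F.M by ring, F.periodic, ih]

theorem ω_add_mul (r j : ℕ) : F.ω (r + j * F.M) = F.ω r := by
  induction j with
  | zero => simp
  | succ j ih => rw [show r + (j + 1) * F.M = r + j * F.M + F.M by ring, F.ω_periodic, ih]

theorem start_add_mul (r j : ℕ) : F.start (r + j * F.M) = F.start r + j * F.angle := by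
  induction j with
  | zero => simp
  | succ j ih =>
    rw [show r + (j + 1) * F.M = r + j * F.M + F.M by ring, start_add_M, ih]; push_cast; ring

theorem eq_add_mul {r s M : ℕ} (h : r ≡ s [MOD M]) (hrs : r ≤ s) : ∃ j, s = r + j * M := by
  obtain ⟨j, hj⟩ := (Nat.modEq_iff_dvd' hrs).mp h
  exact ⟨j, by rw [mul_comm, ← hj]; omega⟩

theorem coe_start {r s : ℕ} (h : r ≡ s [MOD F.M]) :
    (F.start r : AddCircle F.angle) = F.start s ∧ F.ω r = F.ω s := by
  wlog hrs : r ≤ s generalizing r s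
  · have := this h.symm (not_le.mp hrs).le
    exact ⟨this.1.symm, this.2.symm⟩
  obtain ⟨j, rfl⟩ := eq_add_mul h hrs
  refine ⟨?_, (F.ω_add_mul r j).symm⟩
  rw [start_add_mul, AddCircle.coe_add]
  have : ((j * F.angle : ℝ) : AddCircle F.angle) = 0 :=
    (AddCircle.coe_eq_zero_iff _).mpr ⟨j, by simp⟩
  rw [this, add_zero]

theorem sin_ω_pos (r : ℕ) : 0 < Real.sin (F.ω r) :=
  Real.sin_pos_of_pos_of_lt_pi (F.ω_pos r) (F.ω_lt r)

theorem not_modEq_add_two (r : ℕ) : ¬ r ≡ r + 2 [MOD F.M] := fun h => by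
  have h1 := (Nat.modEq_iff_dvd' (by omega)).mp h
  have h2 := Nat.le_of_dvd (by omega) h1
  have := F.three_le
  omega

theorem b_ne_succ (r : ℕ) : F.b r ≠ F.b (r + 1) := fun h => by
  have h1 := (Nat.modEq_iff_dvd' (by omega)).mp (F.modEq_of_eq _ _ h)
  have h2 := Nat.le_of_dvd (by omega) h1
  have := F.three_le
  omega

/-- Every angle lies in some sector. -/
theorem exists_start_add {α : ℝ} (hα : 0 ≤ α) : ∃ r t, 0 ≤ t ∧ t ≤ F.ω r ∧ F.start r + t = α := by
  have hex : ∃ r, α < F.start (r + 1) := by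
    obtain ⟨j, hj⟩ := exists_nat_gt (α / F.angle)
    refine ⟨0 + j * F.M, ((div_lt_iff₀ F.angle_pos).mp hj).trans ?_⟩
    have h1 := F.start_add_mul 0 j
    rw [start_zero] at h1
    rw [start_succ, h1, zero_add]
    linarith [F.ω_pos (0 + j * F.M)]
  classical
  have hlt := Nat.find_spec hex
  have hle : F.start (Nat.find hex) ≤ α := by
    rcases h : Nat.find hex with _ | r
    · rwa [start_zero]
    · exact not_lt.mp (Nat.find_min hex (by omega))
  rw [start_succ] at hlt
  exact ⟨Nat.find hex, α - F.start (Nat.find hex), by linarith, by linarith, by ring⟩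

variable {F}

namespace Sector

variable {u v : I → ℝ} {ρ ρ' t t' : ℝ} {r r' : ℕ}

theorem polar_eq (h : F.Sector u ρ r t) : (u (F.b r) : ℂ) + (u (F.b (r + 1)) : ℂ) *
    Complex.exp (F.ω r * Complex.I) = polar ρ t := by
  have hs := F.sin_ω_pos r
  have h1 := h.left
  have h2 := h.right
  rw [Real.sin_sub] at h1
  apply Complex.ext
  · rw [polar_re, Complex.add_re, Complex.ofReal_re, Complex.re_ofReal_mul,
      Complex.exp_ofReal_mul_I_re]
    refine mul_right_cancel₀ hs.ne' ?_
    linear_combination h1 + Real.cos (F.ω r) * h2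
  · rw [polar_im, Complex.add_im, Complex.ofReal_im, Complex.im_ofReal_mul,
      Complex.exp_ofReal_mul_I_im]
    linear_combination h2

theorem shift (h : F.Sector u ρ r t) (j : ℕ) : F.Sector u ρ (r + j * F.M) t := by
  have e : F.b (r + j * F.M + 1) = F.b (r + 1) := by
    rw [show r + j * F.M + 1 = r + 1 + j * F.M by ring, b_add_mul]
  refine ⟨h.nonneg, h.zero_le, ?_, ?_, ?_, fun k h1 h2 => h.other k ?_ ?_⟩
  · rw [ω_add_mul]; exact h.le
  · rw [ω_add_mul, b_add_mul]; exact h.left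
  · rw [ω_add_mul, e]; exact h.right
  · rwa [b_add_mul] at h1
  · rwa [e] at h2

theorem congr (h : F.Sector u ρ r t) (hv : F.Sector v ρ r t) : u = v := by
  funext k
  have hs := (F.sin_ω_pos r).ne'
  by_cases h1 : k = F.b r
  · rw [h1]; exact mul_right_cancel₀ hs (h.left.trans hv.left.symm)
  by_cases h2 : k = F.b (r + 1)
  · rw [h2]; exact mul_right_cancel₀ hs (h.right.trans hv.right.symm)
  rw [h.other k h1 h2, hv.other k h1 h2]

/-- The last ray of a sector is the first ray of the next sector. -/
theorem next (h : F.Sector u ρ r (F.ω r)) : F.Sector u ρ (r + 1) 0 := by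
  have hs := (F.sin_ω_pos r).ne'
  have hu : u (F.b (r + 1)) = ρ := mul_right_cancel₀ hs h.right
  have hu0 : u (F.b r) = 0 := by
    have := h.left
    rw [sub_self, Real.sin_zero, mul_zero] at this
    exact (mul_eq_zero.mp this).resolve_right hs
  have hk : ∀ k, k ≠ F.b (r + 1) → u k = 0 := fun k hk => by
    by_cases h1 : k = F.b r
    · rw [h1, hu0]
    · exact h.other k h1 hk
  refine ⟨h.nonneg, le_rfl, (F.ω_pos _).le, ?_, ?_, fun k h1 _ => hk k h1⟩
  · rw [hu, sub_zero]
  · rw [hk _ (F.b_ne_succ (r + 1)).symm, Real.sin_zero]; ring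

theorem apply_nonneg (h : F.Sector u ρ r t) (k : I) : 0 ≤ u k := by
  have hs := F.sin_ω_pos r
  have h1 := h.le
  have h2 := h.zero_le
  have h3 := F.ω_lt r
  by_cases hk : k = F.b r
  · rw [hk]
    refine nonneg_of_mul_nonneg_left (h.left ▸ mul_nonneg h.nonneg ?_) hs
    exact Real.sin_nonneg_of_nonneg_of_le_pi (by linarith) (by linarith)
  by_cases hk' : k = F.b (r + 1)
  · rw [hk']
    refine nonneg_of_mul_nonneg_left (h.right ▸ mul_nonneg h.nonneg ?_) hs
    exact Real.sin_nonneg_of_nonneg_of_le_pi h2 (by linarith)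
  · rw [h.other k hk hk']

theorem eq_norm (h : F.Sector u ρ r t) : ρ = ‖(u (F.b r) : ℂ) + (u (F.b (r + 1)) : ℂ) *
    Complex.exp (F.ω r * Complex.I)‖ := by
  rw [h.polar_eq, norm_polar h.nonneg]

theorem eq_zero_of_zero (h : F.Sector u 0 r t) : u = 0 := by
  have hs := (F.sin_ω_pos r).ne'
  funext k
  rw [Pi.zero_apply]
  by_cases h1 : k = F.b r
  · have := h.left
    rw [zero_mul] at this
    rw [h1]; exact (mul_eq_zero.mp this).resolve_right hs
  by_cases h2 : k = F.b (r + 1)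
  · have := h.right
    rw [zero_mul] at this
    rw [h2]; exact (mul_eq_zero.mp this).resolve_right hs
  exact h.other k h1 h2

theorem last (h : F.Sector u ρ r t) (hρ : ρ ≠ 0) (hu : u (F.b r) = 0) :
    t = F.ω r ∧ u (F.b (r + 1)) = ρ := by
  have h1 := h.left
  rw [hu, zero_mul] at h1
  have h2 := (mul_eq_zero.mp h1.symm).resolve_left hρ
  have h3 : t = F.ω r := by
    by_contra hne
    have := h.le.lt_of_ne hne
    exact (Real.sin_pos_of_pos_of_lt_pi (by linarith)
      (by linarith [h.zero_le, F.ω_lt r])).ne' h2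
  have h4 := h.right
  rw [h3] at h4
  exact ⟨h3, mul_right_cancel₀ (F.sin_ω_pos r).ne' h4⟩

theorem first (h : F.Sector u ρ r t) (hρ : ρ ≠ 0) (hu : u (F.b (r + 1)) = 0) :
    t = 0 ∧ u (F.b r) = ρ := by
  have h1 := h.right
  rw [hu, zero_mul] at h1
  have h2 := (mul_eq_zero.mp h1.symm).resolve_left hρ
  have h3 : t = 0 := by
    by_contra hne
    exact (Real.sin_pos_of_pos_of_lt_pi (h.zero_le.lt_of_ne (Ne.symm hne))
      (by linarith [h.le, F.ω_lt r])).ne' h2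
  have h4 := h.left
  rw [h3, sub_zero] at h4
  exact ⟨h3, mul_right_cancel₀ (F.sin_ω_pos r).ne' h4⟩

/-- Uniqueness of polar coordinates on the common ray of two consecutive sectors. -/
theorem unique_of_next (h : F.Sector u ρ r t) (h' : F.Sector u ρ' r' t') (hr : r' ≡ r + 1 [MOD F.M])
    (hb : F.b (r + 1) = F.b r') (hu : u (F.b (r + 1)) ≠ 0) : ρ = ρ' ∧
      ((F.start r + t : ℝ) : AddCircle F.angle) = ((F.start r' + t' : ℝ) : AddCircle F.angle) := by
  have hne : F.b r ≠ F.b (r' + 1) := fun e =>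
    F.not_modEq_add_two r ((F.modEq_of_eq _ _ e).trans (hr.add_right 1))
  have hu0 : u (F.b r) = 0 := h'.other _ (hb ▸ F.b_ne_succ r) hne
  have hu1 : u (F.b (r' + 1)) = 0 := h.other _ hne.symm (hb ▸ (F.b_ne_succ r').symm)
  have hρ : ρ ≠ 0 := by
    rintro rfl
    exact hu (congrFun h.eq_zero_of_zero _)
  have hρ' : ρ' ≠ 0 := by
    rintro rfl
    exact hu (congrFun h'.eq_zero_of_zero _)
  obtain ⟨ht, e⟩ := h.last hρ hu0
  obtain ⟨ht', e'⟩ := h'.first hρ' hu1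
  refine ⟨by rw [← e, ← e', hb], ?_⟩
  rw [ht, ht', add_zero, ← start_succ]
  exact (F.coe_start hr).1.symm

/-- Within a planar sector, the direction of a point other than the apex is unique. -/
theorem angle_unique {ρ ω t t' : ℝ} (hρ : 0 < ρ) (ht : 0 ≤ t) (ht' : 0 ≤ t') (h : t ≤ ω)
    (h' : t' ≤ ω) (hω : ω < π) (he : polar ρ t = polar ρ t') : t = t' := by
  have key : ∀ s : ℝ, 0 ≤ s → s ≤ ω → (polar ρ s).arg = s := fun s hs hs' => by
    rw [polar, Complex.exp_mul_I]
    exact_mod_cast Complex.arg_mul_cos_add_sin_mul_I hρ ⟨by linarith, by linarith⟩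
  rw [← key t ht h, he, key t' ht' h']

/-- The polar coordinates of a point of the cone are unique. -/
theorem unique (h : F.Sector u ρ r t) (h' : F.Sector u ρ' r' t') : ρ = ρ' ∧
    (ρ = 0 ∨
      ((F.start r + t : ℝ) : AddCircle F.angle) = ((F.start r' + t' : ℝ) : AddCircle F.angle)) := by
  by_cases hr : r ≡ r' [MOD F.M]
  · obtain ⟨hs, hω⟩ := F.coe_start hr
    have hper : ∀ r s : ℕ, r ≡ s [MOD F.M] → F.b r = F.b s := fun r s hrs => by
      have hp : Function.Periodic F.b F.M := F.periodic
      rw [← hp.map_mod_nat r, ← hp.map_mod_nat s, hrs]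
    have e := h.polar_eq
    rw [hper _ _ hr, hper _ _ (hr.add_right 1), hω, h'.polar_eq] at e
    have hρ : ρ = ρ' := by rw [← norm_polar h.nonneg t, ← e, norm_polar h'.nonneg]
    subst hρ
    refine ⟨rfl, or_iff_not_imp_left.mpr fun h0 => ?_⟩
    have := angle_unique (h.nonneg.lt_of_ne (Ne.symm h0)) h.zero_le h'.zero_le h.le (hω ▸ h'.le)
      (F.ω_lt r) e.symm
    rw [AddCircle.coe_add, AddCircle.coe_add, hs, this]
  by_cases h1 : u (F.b (r + 1)) = 0
  · by_cases h0 : u (F.b r) = 0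
    · have e := h.eq_norm
      rw [h0, h1] at e
      simp only [Complex.ofReal_zero, zero_mul, add_zero, norm_zero] at e
      subst e
      have e' := h'.eq_norm
      rw [h.eq_zero_of_zero] at e'
      simp only [Pi.zero_apply, Complex.ofReal_zero, zero_mul, add_zero, norm_zero] at e'
      exact ⟨e'.symm, Or.inl rfl⟩
    · have hb : F.b (r' + 1) = F.b r := by
        by_contra hne
        refine h0 (h'.other _ (fun e => hr (F.modEq_of_eq _ _ e)) (Ne.symm hne))
      have := h'.unique_of_next h (F.modEq_of_eq _ _ hb).symm hb (hb ▸ h0)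
      exact ⟨this.1.symm, Or.inr this.2.symm⟩
  · have hb : F.b (r + 1) = F.b r' := by
      by_contra hne
      refine h1 (h'.other _ hne fun e => hr ?_)
      exact Nat.ModEq.add_right_cancel' 1 (F.modEq_of_eq _ _ e)
    have := h.unique_of_next h' (F.modEq_of_eq _ _ hb).symm hb h1
    exact ⟨this.1, Or.inr this.2⟩

theorem coneDist_eq (h : F.Sector u ρ r t) (h' : F.Sector v ρ' r t') : coneDist ρ ρ' |t - t'| =
    ‖((u (F.b r) - v (F.b r) : ℝ) : ℂ) + ((u (F.b (r + 1)) - v (F.b (r + 1)) : ℝ) : ℂ) *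
      Complex.exp (F.ω r * Complex.I)‖ := by
  have h1 := h.le
  have h2 := h'.le
  have h3 := h.zero_le
  have h4 := h'.zero_le
  have h5 := F.ω_lt r
  rw [coneDist_eq_norm _ _ (abs_le.mpr ⟨by linarith, by linarith⟩), ← h.polar_eq, ← h'.polar_eq]
  congr 1
  push_cast; ring

end Sector

theorem exists_sector (F : Fan I) {ρ t : ℝ} {r : ℕ} (hρ : 0 ≤ ρ) (ht : 0 ≤ t) (ht' : t ≤ F.ω r) :
    ∃ u, F.Sector u ρ r t := by
  classical
  have hs := F.sin_ω_pos r
  refine ⟨fun k => if k = F.b r then ρ * Real.sin (F.ω r - t) / Real.sin (F.ω r) else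
    if k = F.b (r + 1) then ρ * Real.sin t / Real.sin (F.ω r) else 0,
    ⟨hρ, ht, ht', ?_, ?_, fun k hk hk' => ?_⟩⟩
  · rw [if_pos rfl]; field_simp
  · rw [if_neg (F.b_ne_succ r).symm, if_pos rfl]; field_simp
  · rw [if_neg hk, if_neg hk']

/-- A distance on the points of a cone, given as `g` on oblique coordinates, that is bounded by the
planar distance in each sector, is bounded by the distance in the cone, since the geodesics of the
cone are composed of segments in the sectors. Here the geodesic does not pass through the apex. -/
theorem le_coneDist_of_le (F : Fan I) {ε : ℝ} {g : (I → ℝ) → (I → ℝ) → ℝ≥0∞}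
    (htri : ∀ u v w, g u w ≤ g u v + g v w)
    (hloc : ∀ u v ρ s r t t', ρ < ε → s < ε → F.Sector u ρ r t → F.Sector v s r t' →
      g u v ≤ ENNReal.ofReal (coneDist ρ s |t - t'|))
    {u v : I → ℝ} {ρ s t t' : ℝ} {r r' : ℕ} (hρ : ρ < ε) (hs : s < ε)
    (hu : F.Sector u ρ r t) (hv : F.Sector v s r' t') (h0 : F.start r + t ≤ F.start r' + t')
    (hπ : F.start r' + t' - (F.start r + t) ≤ π) :
    g u v ≤ ENNReal.ofReal (coneDist ρ s (F.start r' + t' - (F.start r + t))) := by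
  rcases lt_or_ge r' r with hr | hr
  · -- only the common ray of two consecutive sectors is possible
    have h1 : F.start (r' + 1) ≤ F.start r := F.start_strictMono.monotone hr
    have h2 := F.start_succ r'
    have h3 : t = 0 := le_antisymm (by linarith [hv.le]) hu.zero_le
    have h4 : t' = F.ω r' := le_antisymm hv.le (by linarith [hu.zero_le])
    have h5 : r = r' + 1 := F.start_strictMono.injective (by linarith)
    subst h3 h4 h5
    have := hloc u v ρ s _ _ _ hρ hs hu hv.next
    rw [sub_self, abs_zero] at this
    rwa [h2, add_zero, sub_self]
  obtain ⟨d, rfl⟩ := Nat.exists_eq_add_of_le hr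
  clear hr
  induction d generalizing r u ρ t with
  | zero =>
    rw [add_zero] at hv h0 hπ ⊢
    have := hloc u v ρ s r t t' hρ hs hu hv
    rwa [abs_sub_comm, abs_of_nonneg (by linarith),
      show t' - t = F.start r + t' - (F.start r + t) by ring] at this
  | succ d ih =>
    have e : r + (d + 1) = r + 1 + d := by ring
    rw [e] at hv h0 hπ ⊢
    have h1 : F.start (r + 1) ≤ F.start (r + 1 + d) := F.start_strictMono.monotone (by omega)
    have h2 := F.start_succ r
    have h3 := hu.le
    have h4 := hv.zero_le
    obtain ⟨σ, hσ0, hσ, hadd⟩ := exists_coneDist_add hu.nonneg hv.nonneg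
      (φ := F.ω r - t) (ψ := F.start (r + 1 + d) + t' - F.start (r + 1)) (by linarith) (by linarith)
      (by linarith)
    obtain ⟨w, hw⟩ := F.exists_sector (r := r) hσ0 (F.ω_pos r).le le_rfl
    have hσε : σ < ε := hσ.trans_lt (max_lt hρ hs)
    have g1 := hloc u w ρ σ r t _ hρ hσε hu hw
    have g2 := ih hσε hw.next hv (by linarith) (by linarith)
    rw [abs_sub_comm, abs_of_nonneg (by linarith)] at g1
    refine (htri u w v).trans ((add_le_add g1 g2).trans (le_of_eq ?_))
    rw [← ENNReal.ofReal_add (coneDist_nonneg _ _ _) (coneDist_nonneg _ _ _), add_zero, hadd]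
    congr 2
    rw [h2]; ring

/-- The general case: directions at an angular distance of at least `π` are joined through the
apex. -/
theorem le_coneDist (F : Fan I) {ε : ℝ} (hε : 0 < ε) {g : (I → ℝ) → (I → ℝ) → ℝ≥0∞}
    (hcomm : ∀ u v, g u v = g v u) (htri : ∀ u v w, g u w ≤ g u v + g v w)
    (hloc : ∀ u v ρ s r t t', ρ < ε → s < ε → F.Sector u ρ r t → F.Sector v s r t' →
      g u v ≤ ENNReal.ofReal (coneDist ρ s |t - t'|))
    {u v : I → ℝ} {ρ s t t' : ℝ} {r r' : ℕ} (hρ : ρ < ε) (hs : s < ε)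
    (hu : F.Sector u ρ r t) (hv : F.Sector v s r' t') :
    g u v ≤ ENNReal.ofReal (coneDist ρ s
      ‖((F.start r + t : ℝ) : AddCircle F.angle) - ((F.start r' + t' : ℝ) : AddCircle F.angle)‖) := by
  rcases le_or_gt π ‖((F.start r + t : ℝ) : AddCircle F.angle) -
    ((F.start r' + t' : ℝ) : AddCircle F.angle)‖ with hπ | hπ
  · have hz : ∀ r, F.Sector (0 : I → ℝ) 0 r 0 := fun r =>
      ⟨le_rfl, le_rfl, (F.ω_pos r).le, by simp, by simp, fun _ _ _ => rfl⟩
    have g1 := hloc u 0 ρ 0 r t 0 hρ hε hu (hz r)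
    have g2 := hloc 0 v 0 s r' 0 t' hε hs (hz r') hv
    rw [coneDist_zero_right hu.nonneg] at g1
    rw [coneDist_zero_left hv.nonneg] at g2
    rw [coneDist_of_pi_le hu.nonneg hv.nonneg hπ, ENNReal.ofReal_add hu.nonneg hv.nonneg]
    exact (htri u 0 v).trans (add_le_add g1 g2)
  rw [← AddCircle.coe_sub, AddCircle.norm_eq] at hπ ⊢
  obtain ⟨k, hk⟩ : ∃ k : ℤ, k = round (F.angle⁻¹ * (F.start r + t - (F.start r' + t'))) := ⟨_, rfl⟩
  rw [← hk] at hπ ⊢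
  -- after shifts by full turns, the difference of the real angles is the distance on the circle
  obtain ⟨p, q, rfl⟩ : ∃ p q : ℕ, k = (p : ℤ) - q := ⟨k.toNat, (-k).toNat, by omega⟩
  have hu' := hu.shift q
  have hv' := hv.shift p
  have eu := F.start_add_mul r q
  have ev := F.start_add_mul r' p
  push_cast at hπ ⊢
  rw [show F.start r + t - (F.start r' + t') - ((p : ℝ) - q) * F.angle =
    (F.start (r + q * F.M) + t) - (F.start (r' + p * F.M) + t') by rw [eu, ev]; ring] at hπ ⊢
  rcases le_total (F.start (r + q * F.M) + t) (F.start (r' + p * F.M) + t') with hle | hle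
  · rw [abs_sub_comm, abs_of_nonneg (by linarith)] at hπ ⊢
    exact F.le_coneDist_of_le htri hloc hρ hs hu' hv' hle hπ.le
  · rw [abs_of_nonneg (by linarith)] at hπ ⊢
    rw [hcomm, coneDist_comm]
    exact F.le_coneDist_of_le htri hloc hs hρ hv' hu' hle hπ.le

end Fan

namespace LoopArrangement

variable {N n : ℕ} {V : LabeledSphere N} {A : LoopArrangement V n} {δ : Fin N → ℝ} {a : Fin n → ℝ}

/-! ### The cone angle at a vertex -/

/-- The corners, in cyclic order, of the parallelograms at a vertex `x` of the dual graph. -/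
def vertexFan (h : A.Admissible δ a) {x : Fin n → ℝ} (hx : ∀ k, x k = 1 ∨ x k = -1) {M : ℕ}
    {b : ℕ → Fin n} (hb : CyclicList (A.signedNormal x) M b) : Fan (Fin n) where
  M := M
  b := b
  ω r := V.sepAngle δ (A.signedNormal x (b r)) (A.signedNormal x (b (r + 1)))
  three_le := hb.three_le
  periodic := hb.periodic
  modEq_of_eq := hb.modEq_of_eq
  ω_periodic r := by rw [show r + M + 1 = r + 1 + M by ring, hb.periodic, hb.periodic]
  ω_pos r :=
    (A.sepAngle_sign h.deficit_pos h.sum_deficit h.three_le (hb.isFacet r).1 (hx _) (hx _)).1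
  ω_lt r :=
    (A.sepAngle_sign h.deficit_pos h.sum_deficit h.three_le (hb.isFacet r).1 (hx _) (hx _)).2.1

theorem eq_code_iff {x : Fin n → ℝ} (hx : ∀ k, x k = 1 ∨ x k = -1) (p : S2) :
    x = A.code p ↔ ∀ k, 0 < ⟪A.signedNormal x k, p⟫ := by
  rw [funext_iff]
  refine forall_congr' fun k => ?_
  rw [code_apply, eq_sign_iff (hx k), inner_signedNormal]

/-- The sides of a face whose loops separate `k⁺` from the face form an interval in the cyclic order.
Each end of this interval contributes `δ k / 2` to the sum of the angles. If `k⁺` or `k⁻` lies in the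
face, no side or every side separates `k⁺` from it, and `k` contributes nothing. -/
theorem angle_vertexFan (h : A.Admissible δ a) {x : Fin n → ℝ} (hx : ∀ k, x k = 1 ∨ x k = -1)
    {p : E3} (hp : ∀ k, 0 < ⟪A.signedNormal x k, p⟫) {M : ℕ} {b : ℕ → Fin n}
    (hb : CyclicList (A.signedNormal x) M b)
    [DecidablePred fun k => ∃ s, x = A.code (V.vertex k s)] :
    (vertexFan h hx hb).angle =
      2 * π - ∑ k, if ∃ s, x = A.code (V.vertex k s) then δ k else 0 := by
  have hn : 3 ≤ Fintype.card (Fin n) := by simpa using h.three_le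
  have hm := inGeneralPosition_signedNormal (A := A) hx
  have hne : ∀ i k, ⟪A.signedNormal x i, (V.vertex k true : E3)⟫ ≠ 0 := fun i k => by
    rw [inner_signedNormal]
    refine mul_ne_zero ?_ (A.inner_vertex_ne_zero i k true)
    rcases hx i with h | h <;> rw [h] <;> norm_num
  have hfalse : ∀ k, x = A.code (V.vertex k false) ↔
      ∀ i, ⟪A.signedNormal x i, (V.vertex k true : E3)⟫ < 0 := fun k => by
    rw [eq_code_iff hx]
    refine forall_congr' fun i => ?_
    rw [V.vertex_false, inner_neg_right, neg_pos]
  have hcount : ∀ k, ∑ r ∈ Finset.range M, (if 0 < ⟪A.signedNormal x (b r), (V.vertex k true : E3)⟫ *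
      ⟪A.signedNormal x (b (r + 1)), (V.vertex k true : E3)⟫ then 0 else δ k) =
      if ∃ s, x = A.code (V.vertex k s) then 0 else 2 * δ k := by
    intro k
    split_ifs with hk
    · refine Finset.sum_eq_zero fun r _ => if_pos ?_
      obtain ⟨_ | _, hs⟩ := hk
      · rw [hfalse] at hs
        exact mul_pos_of_neg_of_neg (hs _) (hs _)
      · rw [eq_code_iff hx] at hs
        exact mul_pos (hs _) (hs _)
    · push Not at hk
      have h1 := hb.sum_sign_changes hm hn hp (v := (V.vertex k true : E3)) (fun i => hne i k)
        (fun hall => hk true ((eq_code_iff hx _).mpr hall))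
        (fun hall => hk false ((hfalse k).mpr hall))
      rw [← h1, Finset.sum_mul]
      refine Finset.sum_congr rfl fun r _ => ?_
      rcases (mul_ne_zero (hne (b r) k) (hne (b (r + 1)) k)).lt_or_gt with h2 | h2
      · rw [if_neg h2.not_gt, if_pos h2, one_mul]
      · rw [if_pos h2, if_neg h2.not_gt, zero_mul]
  have e : (vertexFan h hx hb).angle = ∑ r ∈ Finset.range M, (1 / 2) * ∑ k,
      if 0 < ⟪A.signedNormal x (b r), (V.vertex k true : E3)⟫ *
        ⟪A.signedNormal x (b (r + 1)), (V.vertex k true : E3)⟫ then 0 else δ k := rfl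
  rw [e, ← Finset.mul_sum, Finset.sum_comm, Finset.sum_congr rfl fun k _ => hcount k,
    ← h.sum_deficit, ← Finset.sum_sub_distrib, Finset.mul_sum]
  refine Finset.sum_congr rfl fun k _ => ?_
  split_ifs <;> ring

/-- The distances, along the edges of the parallelograms at the vertex `x`, of a point from `x`. -/
def gap (x : Fin n → ℝ) (a : Fin n → ℝ) (y : Fin n → ℝ) (k : Fin n) : ℝ := (1 - x k * y k) * a k / 2

theorem gap_nonneg (h : A.Admissible δ a) {x y : Fin n → ℝ} {k : Fin n} (hx : x k = 1 ∨ x k = -1)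
    (hy : y k ∈ Set.Icc (-1 : ℝ) 1) : 0 ≤ gap x a y k := by
  have := h.length_pos k
  have h1 : 0 ≤ 1 - x k * y k := by rcases hx with h | h <;> rw [h] <;> linarith [hy.1, hy.2]
  unfold gap
  positivity

theorem gap_of_eq {x y : Fin n → ℝ} {k : Fin n} (hx : x k = 1 ∨ x k = -1) (hy : y k = x k) :
    gap x a y k = 0 := by
  rw [gap, hy]
  rcases hx with h | h <;> rw [h] <;> norm_num

theorem gap_injective (h : A.Admissible δ a) {x : Fin n → ℝ} (hx : ∀ k, x k = 1 ∨ x k = -1) :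
    Function.Injective (gap x a) := by
  intro y z hyz
  funext k
  have h1 := congrFun hyz k
  have h2 := (h.length_pos k).ne'
  have h3 : x k * y k = x k * z k := by
    have : (1 - x k * y k) * a k = (1 - x k * z k) * a k := by
      simp only [gap] at h1; linarith
    linarith [mul_right_cancel₀ h2 this]
  refine mul_left_cancel₀ ?_ h3
  rcases hx k with h | h <;> rw [h] <;> norm_num

theorem len_eq_norm_gap (h : A.Admissible δ a) {x : Fin n → ℝ} (hx : ∀ k, x k = 1 ∨ x k = -1)
    {i j : Fin n} (hij : i ≠ j) (y z : Fin n → ℝ) : A.len δ a i j (y - z) =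
      ‖((gap x a y i - gap x a z i : ℝ) : ℂ) + ((gap x a y j - gap x a z j : ℝ) : ℂ) *
        Complex.exp (V.sepAngle δ (A.signedNormal x i) (A.signedNormal x j) * Complex.I)‖ := by
  have h1 := (A.sepAngle_sign h.deficit_pos h.sum_deficit h.three_le hij (hx i) (hx j)).2.2
  rw [norm_add_mul_exp, signedNormal, signedNormal, h1, len]
  congr 1
  have e : ∀ k, x k ^ 2 = 1 := fun k => by rcases hx k with h | h <;> rw [h] <;> norm_num
  simp only [gap, Pi.sub_apply]
  have ei := e i
  have ej := e j
  generalize Real.cos (V.sepAngle δ (A.nv i) (A.nv j)) = c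
  linear_combination (-((y i - z i) * a i / 2) ^ 2 - 2 * ((y i - z i) * a i / 2) *
    ((y j - z j) * a j / 2) * c * x j ^ 2) * ei + (-((y j - z j) * a j / 2) ^ 2 -
    2 * ((y i - z i) * a i / 2) * ((y j - z j) * a j / 2) * c) * ej

theorem exists_nonneg_coe_eq {p : ℝ} (hp : 0 < p) (α : AddCircle p) :
    ∃ t : ℝ, 0 ≤ t ∧ (t : AddCircle p) = α := by
  have : Fact (0 < p) := ⟨hp⟩
  exact ⟨_, (AddCircle.equivIco p 0 α).2.1, AddCircle.coe_equivIco⟩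

/-- At a vertex of the dual graph, the sectors of the parallelograms form a cone. -/
theorem hasConeAngle_of_vertexFan (h : A.Admissible δ a) {x : A.Points}
    (hx : ∀ k, x.1 k = 1 ∨ x.1 k = -1) {M : ℕ} {b : ℕ → Fin n}
    (hb : CyclicList (A.signedNormal x.1) M b) :
    HasConeAngle (toGlued δ a x) (vertexFan h hx hb).angle := by
  classical
  obtain ⟨η, hη, hη1, -, hmatch⟩ := exists_forall_matches h.three_le x
  obtain ⟨κ, hκ, hκle⟩ := exists_mul_abs_le_len h
  set F := vertexFan h hx hb with hF
  have hlen : ∀ r (y z : Fin n → ℝ), A.len δ a (b r) (b (r + 1)) (y - z) =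
      ‖((gap x.1 a y (b r) - gap x.1 a z (b r) : ℝ) : ℂ) +
        ((gap x.1 a y (b (r + 1)) - gap x.1 a z (b (r + 1)) : ℝ) : ℂ) *
        Complex.exp (F.ω r * Complex.I)‖ := fun r y z => len_eq_norm_gap h hx (hb.isFacet r).1 y z
  have hgap0 : gap x.1 a x.1 = 0 := funext fun k => gap_of_eq (hx k) rfl
  -- every parallelogram close to `x` is one of the sectors
  have hcross : ∀ e : A.Crossing, Matches x.1 e → ∃ r, (∀ w, A.len δ a e.i e.j w =
      A.len δ a (b r) (b (r + 1)) w) ∧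
      ∀ y ∈ A.quad e, ∃ ρ t, F.Sector (gap x.1 a y) ρ r t := by
    have key : ∀ e : A.Crossing, Matches x.1 e → ∀ r, b r = e.i → b (r + 1) = e.j →
        ∀ y ∈ A.quad e, ∃ ρ t, F.Sector (gap x.1 a y) ρ r t := by
      intro e he r h1 h2 y hy
      obtain ⟨ρ, t, h3, h4, h5, h6, h7⟩ := exists_polar_of_sector (F.ω_pos r) (F.ω_lt r)
        (gap_nonneg h (hx (b r)) (mem_Icc_of_mem_quad hy _))
        (gap_nonneg h (hx (b (r + 1))) (mem_Icc_of_mem_quad hy _))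
      refine ⟨ρ, t, h3, h4, h5, h6, h7, fun k hk hk' => gap_of_eq (hx k) (he.apply_eq hy ?_ ?_)⟩
      · rw [← h1]; exact hk
      · rw [← h2]; exact hk'
    intro e he
    rcases isFacet_of_matches h.three_le hx he with hf | hf <;>
      obtain ⟨r, h1, h2⟩ := hb.exists_of_isFacet _ _ hf
    · exact ⟨r, fun w => by rw [h1, h2], key e he r h1 h2⟩
    · refine ⟨r, fun w => by rw [h1, h2, len_comm], fun y hy => ?_⟩
      rw [← quad_swap] at hy
      exact key e.swap he.swap r h1 h2 y hy
  -- the points of the sectors that are close to the apex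
  have hpoint : ∀ r, ∃ c : A.Crossing, c.i = b r ∧ c.j = b (r + 1) ∧ ∀ u ρ t, ρ < κ * η →
      F.Sector u ρ r t → ∃ y : A.Points, y.1 ∈ A.quad c ∧ dist y.1 x.1 < η ∧ gap x.1 a y.1 = u := by
    intro r
    obtain ⟨c, hci, hcj, hc⟩ := exists_matches_of_isFacet h.three_le hx (hb.isFacet r)
    refine ⟨c, hci, hcj, fun u ρ t hρ hu => ?_⟩
    let w : Fin n → ℝ := fun k => x.1 k * (1 - 2 * u k / a k)
    have hgw : gap x.1 a w = u := funext fun k => by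
      have h1 : x.1 k * x.1 k = 1 := by rcases hx k with h | h <;> rw [h] <;> norm_num
      have h2 := h.length_pos k
      simp only [gap, w]
      rw [← mul_assoc, h1]
      field_simp; ring
    have hlt : |w (b r) - x.1 (b r)| < η ∧ |w (b (r + 1)) - x.1 (b (r + 1))| < η := by
      have h1 := hκle _ _ (hb.isFacet r).1 (w - x.1)
      have h2 : A.len δ a (b r) (b (r + 1)) (w - x.1) = ρ := by
        rw [hlen, hgw, hgap0, hu.eq_norm]
        simp only [Pi.zero_apply, sub_zero]
        rfl
      rw [h2] at h1
      exact ⟨lt_of_mul_lt_mul_left (h1.1.trans_lt hρ) hκ.le,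
        lt_of_mul_lt_mul_left (h1.2.trans_lt hρ) hκ.le⟩
    have hIcc : ∀ k, |w k - x.1 k| < η → w k ∈ Set.Icc (-1 : ℝ) 1 := by
      intro k hk
      have h0 := h.length_pos k
      have h1 : 0 ≤ 2 * u k / a k := by have := hu.apply_nonneg k; positivity
      have h2 : |2 * u k / a k| < 1 := by
        have h3 := hk.trans_le hη1
        have h4 : w k - x.1 k = -x.1 k * (2 * u k / a k) := by simp only [w]; ring
        rw [h4, abs_mul, abs_neg] at h3
        rcases hx k with h5 | h5 <;> rw [h5] at h3 <;> simpa using h3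
      rw [abs_of_nonneg h1] at h2
      simp only [w]
      rcases hx k with h5 | h5 <;> rw [h5] <;> constructor <;> linarith
    obtain ⟨y, hyq, hyi, hyj, hyk, hyx⟩ := exists_point hc hη (hIcc _ hlt.1) (hIcc _ hlt.2)
      (by rw [hci]; exact hlt.1) (by rw [hcj]; exact hlt.2)
    refine ⟨y, hyq, hyx, ?_⟩
    rw [← hgw]
    refine congrArg _ (funext fun k => ?_)
    by_cases h1 : k = b r
    · rw [h1, ← hyi, hci]
    by_cases h2 : k = b (r + 1)
    · rw [h2, ← hyj, hcj]
    · rw [hyk k (by rw [hci]; exact h1) (by rw [hcj]; exact h2)]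
      have : u k = 0 := hu.other k h1 h2
      simp [w, this]
  have hκη : 0 < κ * η := mul_pos hκ hη
  -- the distance as a function of the oblique coordinates
  let pt : (Fin n → ℝ) → A.Points := fun u =>
    if hu : ∃ y : A.Points, gap x.1 a y.1 = u then hu.choose else x
  have hpt : ∀ y : A.Points, pt (gap x.1 a y.1) = y := by
    intro y
    have hex : ∃ z : A.Points, gap x.1 a z.1 = gap x.1 a y.1 := ⟨y, rfl⟩
    simp only [pt, dif_pos hex]
    exact Subtype.ext (gap_injective h hx hex.choose_spec)
  have hloc : ∀ u v ρ s r t t', ρ < κ * η → s < κ * η → F.Sector u ρ r t → F.Sector v s r t' →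
      A.gdist δ a (pt u) (pt v) ≤ ENNReal.ofReal (coneDist ρ s |t - t'|) := by
    intro u v ρ s r t t' hρ hs hu hv
    obtain ⟨c, hci, hcj, hc⟩ := hpoint r
    obtain ⟨y, hy, -, rfl⟩ := hc u ρ t hρ hu
    obtain ⟨z, hz, -, rfl⟩ := hc v s t' hs hv
    rw [hpt, hpt, hu.coneDist_eq hv]
    refine (gdist_le_len h c hy hz).trans (le_of_eq ?_)
    rw [hci, hcj, hlen]
    rfl
  refine hasConeAngle_of_rel h F.angle_pos hη hκη (fun y ρ α => ∃ r t,
    F.Sector (gap x.1 a y.1) ρ r t ∧ ((F.start r + t : ℝ) : AddCircle F.angle) = α) ?_ ?_ ?_ ?_ ?_ ?_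
  · intro α
    obtain ⟨s, hs, rfl⟩ := exists_nonneg_coe_eq F.angle_pos α
    obtain ⟨r, t, h1, h2, h3⟩ := F.exists_start_add hs
    refine ⟨r, t, ⟨le_rfl, h1, h2, ?_, ?_, ?_⟩, by rw [h3]⟩ <;> simp [hgap0]
  · rintro y ρ ρ' α α' ⟨r, t, h1, rfl⟩ ⟨r', t', h2, rfl⟩
    exact h1.unique h2
  · intro y hy
    obtain ⟨e, he⟩ := exists_mem_quad h.three_le y
    obtain ⟨r, -, hr⟩ := hcross e (hmatch e _ he hy)
    obtain ⟨ρ, t, h1⟩ := hr _ he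
    exact ⟨ρ, _, h1.nonneg, r, t, h1, rfl⟩
  · intro c y z hyc hzc hy hz
    obtain ⟨r, hr, hr'⟩ := hcross c (hmatch c _ hyc hy)
    obtain ⟨ρ, t, h1⟩ := hr' _ hyc
    obtain ⟨s, t', h2⟩ := hr' _ hzc
    refine ⟨ρ, _, s, _, ⟨r, t, h1, rfl⟩, ⟨r, t', h2, rfl⟩, ?_⟩
    have e : A.len δ a c.i c.j (y.1 - z.1) = coneDist ρ s |t - t'| := by
      rw [hr, hlen, h1.coneDist_eq h2]; rfl
    rw [e, ← AddCircle.coe_sub, add_sub_add_left_eq_sub]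
    exact coneDist_mono h1.nonneg h2.nonneg (norm_nonneg _) QuotientAddGroup.norm_mk_le_norm
  · intro ρ α hρ hρε
    obtain ⟨s, hs, rfl⟩ := exists_nonneg_coe_eq F.angle_pos α
    obtain ⟨r, t, h1, h2, h3⟩ := F.exists_start_add hs
    obtain ⟨u, hu⟩ := F.exists_sector hρ h1 h2
    obtain ⟨c, -, -, hc⟩ := hpoint r
    obtain ⟨y, -, hy, rfl⟩ := hc u ρ t hρε hu
    exact ⟨y, hy, r, t, hu, by rw [h3]⟩
  · rintro y z ρ s _ _ - - hρ hs ⟨r, t, h1, rfl⟩ ⟨r', t', h2, rfl⟩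
    have := F.le_coneDist hκη (g := fun u v => A.gdist δ a (pt u) (pt v))
      (fun _ _ => gdist_comm _ _) (fun _ _ _ => gdist_triangle _ _ _) hloc hρ hs h1 h2
    rwa [hpt, hpt] at this

/-- The cone angle at a vertex of the dual graph. -/
theorem hasConeAngle_of_vertex (h : A.Admissible δ a) {x : A.Points}
    (hx : ∀ k, x.1 k = 1 ∨ x.1 k = -1) [DecidablePred fun k => ∃ s, x.1 = A.code (V.vertex k s)] :
    HasConeAngle (toGlued δ a x)
      (2 * π - ∑ k, if ∃ s, x.1 = A.code (V.vertex k s) then δ k else 0) := by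
  obtain ⟨c, hc⟩ := exists_mem_quad h.three_le x
  obtain ⟨p, hp⟩ := exists_interior_of_vertex h.three_le (matches_of_mem hc) hx
  obtain ⟨M, b, hb⟩ := exists_cyclicList (inGeneralPosition_signedNormal (A := A) hx)
    (by simpa using h.three_le) hp
  rw [← angle_vertexFan h hx hp hb]
  exact hasConeAngle_of_vertexFan h hx hb

/-! ### The polyhedral surface -/

theorem vertex_apply (k : Fin N) (b : Bool) (i : Fin n) :
    A.code (V.vertex k b) i = 1 ∨ A.code (V.vertex k b) i = -1 :=
  code_eq_one_or (A.inner_vertex_ne_zero i k b)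

/-- The surface is flat outside the vertices of the dual graph that are labeled. -/
theorem hasConeAngle_two_pi (h : A.Admissible δ a) {x : A.Points}
    (hx : ∀ k b, x.1 ≠ A.code (V.vertex k b)) : HasConeAngle (toGlued δ a x) (2 * π) := by
  classical
  obtain ⟨c, hc⟩ := exists_mem_quad h.three_le x
  have hIoo : ∀ k, ¬ (x.1 k = 1 ∨ x.1 k = -1) → x.1 k ∈ Set.Ioo (-1 : ℝ) 1 := fun k hk => by
    push Not at hk
    have h1 := mem_Icc_of_mem_quad hc k
    exact ⟨h1.1.lt_of_ne hk.2.symm, h1.2.lt_of_ne hk.1⟩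
  by_cases hi : x.1 c.i = 1 ∨ x.1 c.i = -1 <;> by_cases hj : x.1 c.j = 1 ∨ x.1 c.j = -1
  · have hall : ∀ k, x.1 k = 1 ∨ x.1 k = -1 := fun k => by
      by_cases h1 : k = c.i
      · rwa [h1]
      by_cases h2 : k = c.j
      · rwa [h2]
      exact eq_one_or_of_mem_quad hc h1 h2
    have h1 := hasConeAngle_of_vertex h hall
    rwa [Finset.sum_eq_zero fun k _ => if_neg fun ⟨s, hs⟩ => hx k s hs, sub_zero] at h1
  · rw [← quad_swap] at hc
    refine hasConeAngle_of_mem_edge h (c₀ := c.swap) hc (hIoo _ hj) fun k hk => ?_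
    by_cases h1 : k = c.i
    · rwa [h1]
    · exact eq_one_or_of_mem_quad hc hk h1
  · refine hasConeAngle_of_mem_edge h hc (hIoo _ hi) fun k hk => ?_
    by_cases h1 : k = c.j
    · rwa [h1]
    · exact eq_one_or_of_mem_quad hc hk h1
  · exact hasConeAngle_of_mem_interior h hc (hIoo _ hi) (hIoo _ hj)

/-- If the labeled vertices lie in different faces, the dual graph gives a centrally symmetric
convex polyhedral surface. -/
theorem isCentrallySymmetricConvex_surface (h : A.Admissible δ a) (hN : 2 ≤ N)
    (hsep : A.Separating) : IsCentrallySymmetricConvex δ (A.surface δ a) where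
  sphere := nonempty_homeomorph_sphere h
  isLengthSpace := isLengthSpace h
  vertex_injective v w hvw := hsep v w (congrArg Subtype.val hvw)
  convex k := by
    refine ⟨h.deficit_pos k, ?_⟩
    rw [← h.sum_deficit]
    have : Nontrivial (Fin N) := Fin.nontrivial_iff_two_le.mpr hN
    obtain ⟨l, hl⟩ := exists_ne k
    exact Finset.single_lt_sum hl (Finset.mem_univ k) (Finset.mem_univ l) (h.deficit_pos l)
      fun i _ _ => (h.deficit_pos i).le
  cone k b := by
    classical
    let x : A.Points := ⟨A.code (V.vertex k b), Or.inl ⟨V.vertex k b, fun i => A.avoids i k b, rfl⟩⟩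
    have h1 := hasConeAngle_of_vertex h (x := x) (vertex_apply k b)
    have hiff : ∀ l, (∃ s, x.1 = A.code (V.vertex l s)) ↔ k = l := fun l =>
      ⟨fun ⟨s, hs⟩ => congrArg Prod.fst (hsep (k, b) (l, s) hs), fun e => ⟨b, e ▸ rfl⟩⟩
    simp only [hiff, Finset.sum_ite_eq, Finset.mem_univ, if_true] at h1
    exact h1
  flat x hx := hasConeAngle_two_pi h (x := x) fun k b e => hx k b (Subtype.ext e)
  antipodal := ⟨antipodeEquiv h, antipode_antipode, antipode_ne h.three_le, fun k b => by
    refine Subtype.ext ?_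
    show -A.code (V.vertex k b) = A.code (V.vertex k (!b))
    rw [V.antipodal, code_neg]⟩

end LoopArrangement

end LoopSurface

end

theorem theorem3 (N : ℕ) (hN : 3 ≤ N)
    (δ : Fin N → ℝ) (hδ : ∀ k, 0 < δ k) (hsum : ∑ k, δ k = 2 * Real.pi)
    (V : LoopSurface.LabeledSphere N) (A : LoopSurface.LoopArrangement V (2 * N - 2))
    (hsep : 6 ≤ N → A.Separating)
    (a : Fin (2 * N - 2) → ℝ) (ha : ∀ i, 0 < a i) :
    (Quotient.mk _ (A.surface δ a) : Quotient (LoopSurface.LabeledSurface.setoid N)) ∈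
      LoopSurface.centrallySymmetricSpace δ := by
  have hS : A.Separating := by
    rcases Nat.lt_or_ge N 6 with h | h
    · exact LoopSurface.LoopArrangement.separating_of_le_five A hN (by omega)
    · exact hsep h
  exact ⟨A.surface δ a, LoopSurface.LoopArrangement.isCentrallySymmetricConvex_surface
    ⟨by omega, hδ, hsum, ha⟩ (by omega) hS, rfl⟩
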